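/- Let $\mathbf k$ be a field of characteristic $0$, $\lambda\in\mathbf k$, $\Omega$ a semigroup and $A$ a $\mathbf k$-vector space. **Families.** For vector spaces $V,W$ and $n\ge 1$ let $\mathrm{Hom}_\Omega(V^{\otimes n},W)$ be the space of families $f=\{f_{\alpha_1,\dots,\alpha_n}:V^{\otimes n}\to W\}_{\alpha_i\in\Omega}$ of linear maps; such an $f$ has degree $|f|=n-1$. For $W=V$, $f$ of arity $n$ and $g_1,\dots,g_n$ of arities $m_1,\dots,m_n$, the composition $f\circ(g_1\otimes\dots\otimes g_n)$ is formed by inserting the $g_j$ into $f$, where the label of the $j$-th input of $f$ is the product in $\Omega$ of the labels of the inputs of $g_j$; $f\circ_i g$ is the case $g_i=g$ and all other $g_j=\mathrm{id}$. For $f,g$ of arities $m,n$ put $$[f,g]_\Omega=\sum_{i=1}^m(-1)^{(i-1)(n-1)}f\circ_i g-(-1)^{(m-1)(n-1)}\sum_{i=1}^n(-1)^{(i-1)(m-1)}g\circ_i f .$$ **$L_\infty[1]$-algebras.** An $L_\infty[1]$-algebra is a $\mathbb Z$-graded vector space with multilinear maps $l_n$ ($n\ge1$) of degree $1$ such that,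 for homogeneous $x_1,\dots,x_n$, $l_n(x_{\sigma(1)},\dots,x_{\sigma(n)})=\varepsilon(\sigma)\,l_n(x_1,\dots,x_n)$ for all $\sigma\in\mathbb S_n$ ($\varepsilon$ the Koszul sign) and $\sum_{i=1}^n\sum_{\sigma\in \mathrm{Sh}(i,n-i)}\varepsilon(\sigma)\,l_{n-i+1}(l_i(x_{\sigma(1)},\dots,x_{\sigma(i)}),x_{\sigma(i+1)},\dots,x_{\sigma(n)})=0$. An $L_\infty[1]$-subalgebra is a graded subspace closed under all $l_n$. **The modified algebra, for $V=A$.** Let $V=A$ be a second copy of $A$, $\mathfrak a=\bigoplus_{n\ge1}\mathrm{Hom}_\Omega(V^{\otimes n},A)$, and let $\mathfrak L'=\bigoplus_{n\ge1}\mathfrak L'(n)$, where $\mathfrak L'(n)\subset\mathrm{Hom}_\Omega((A\oplus V)^{\otimes n},A\oplus V)$ consists of the families whose values lie in $A$ if all inputs lie in $A$, and lie in $V$ if at least one input lies in $V$. Let $P$ be the projection of $\bigoplus_{n\ge1}\mathrm{Hom}_\Omega((A\oplus V)^{\otimes n},A\oplus V)$ onto its component $\mathfrak a$. Let $s^{-1}$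 denote desuspension, so $|s^{-1}f|=|f|-1$. On $s^{-1}\mathfrak L'\oplus\mathfrak a$ let $l'_1=0$, $$l'_2(s^{-1}f,s^{-1}g)=(-1)^{|f|}s^{-1}[f,g]_\Omega,\qquad l'_{i}(s^{-1}f,\theta_1,\dots,\theta_{i-1})=\lambda^{n-(i-1)}P\big[\cdots[[f,\theta_1]_\Omega,\theta_2]_\Omega\cdots,\theta_{i-1}\big]_\Omega\quad(i\ge2)$$ for homogeneous $f\in\mathfrak L'(n)$, $g\in\mathfrak L'$, $\theta_j\in\mathfrak a$ (the last expression being $0$ for $i-1>n$, when the iterated bracket vanishes, and with $\lambda^0=1$), extended by graded symmetry; all other products are zero. **The diagonal embedding.** Let $\mathfrak M=\mathfrak h=\bigoplus_{n\ge1}\mathrm{Hom}_\Omega(A^{\otimes n},A)$, with arity-$n$ components $\mathfrak M(n)$ and $\mathfrak h(n)$. For $f\in\mathfrak M(n)$ let $\tilde f\in\mathfrak L'(n)$ have component $f$ from $A^{\otimes n}$ to $A$, component $f$ to $V=A$ on each tensor product of $n$ factors from $\{A,V\}$ in which at least one factor is $V$, and all other components zero. Let $\iota:s^{-1}\mathfrak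 M\oplus\mathfrak h\to s^{-1}\mathfrak L'\oplus\mathfrak a$, $\iota(s^{-1}f)=s^{-1}\tilde f$, $\iota(\theta)=\theta$. **Theorem.** The map $\iota$ is an injective map of graded vector spaces and $\mathrm{Im}(\iota)$ is an $L_\infty[1]$-subalgebra of the $L_\infty[1]$-algebra $(s^{-1}\mathfrak L'\oplus\mathfrak a,\{l'_i\}_{i\ge1})$. Consequently, with $p:\mathrm{Im}(\iota)\to s^{-1}\mathfrak M\oplus\mathfrak h$ the inverse of $\iota$ and $\varrho_k(x_1,\dots,x_k)=p\,l'_k(\iota(x_1),\dots,\iota(x_k))$, the pair $(s^{-1}\mathfrak M\oplus\mathfrak h,\{\varrho_i\}_{i\ge1})$ is an $L_\infty[1]$-algebra, and $\iota\varrho_k(x_1,\dots,x_k)=l'_k(\iota(x_1),\dots,\iota(x_k))$. Explicitly, for $f\in\mathfrak M(n)$, $g\in\mathfrak M(m)$ and $\theta_i\in\mathfrak h(p_i)$: $\varrho_1=0$, $\varrho_2(s^{-1}f,s^{-1}g)=(-1)^{|f|}s^{-1}[f,g]_\Omega$, and for $1\le k\le n$ $$\begin{aligned}\varrho_{k+1}(s^{-1}f,\theta_1,\dots,\theta_k)={}&\delta_{k,n}\sum_{\sigma\in\mathbb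 S_n}(-1)^{\xi_1}f\circ(\theta_{\sigma(1)}\otimes\dots\otimes\theta_{\sigma(n)})\\&+\sum_{\sigma\in\mathbb S_k}\ \sum_{1\le q_2<\dots<q_k\le n}\ \sum_{r=1}^{p_{\sigma(1)}}(-1)^{\xi}\lambda^{n-k}\,\theta_{\sigma(1)}\circ_r\big(f\circ(\mathrm{id}\otimes\dots\otimes\underset{q_2}{\theta_{\sigma(2)}}\otimes\dots\otimes\underset{q_k}{\theta_{\sigma(k)}}\otimes\dots\otimes\mathrm{id})\big),\end{aligned}$$ where $\delta_{k,n}$ is the Kronecker symbol and $$(-1)^{\xi_1}=\varepsilon(\sigma;\theta_1,\dots,\theta_n)(-1)^{\sum_{i=2}^n(\sum_{j=1}^{i-1}p_{\sigma(j)})|\theta_{\sigma(i)}|},$$ $$(-1)^{\xi}=\varepsilon(\sigma;\theta_1,\dots,\theta_k)(-1)^{1+|f||\theta_{\sigma(1)}|+\sum_{i=2}^k(q_i+\sum_{j=2}^{i-1}p_{\sigma(j)}-i+1)|\theta_{\sigma(i)}|+(r-1)(|f|+\sum_{i=2}^k|\theta_{\sigma(i)}|)} .$$ Moreover $\varrho_{k+1}(s^{-1}f,\theta_1,\dots,\theta_k)=0$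 for $k>n$, $\varrho_k$ vanishes if all its arguments lie in $\mathfrak h$, and $\varrho_k$ with $k\ge3$ vanishes if at least two of its arguments lie in $s^{-1}\mathfrak M$. -/

import Mathlib

open DirectSum

noncomputable section

/-! ### `L_∞[1]`-algebras -/

namespace LInftyOne

/-- The Koszul sign `ε(σ; x₁, …, xₙ)` of homogeneous elements of degrees `d i`:
`x₁ ⊙ ⋯ ⊙ xₙ = ε(σ; x₁, …, xₙ) x_{σ(1)} ⊙ ⋯ ⊙ x_{σ(n)}` in the graded symmetric algebra. It is the
product of the signs `(-1)^{|x_{σ(a)}| |x_{σ(b)}|}` over the inversions `a < b`, `σ(b) < σ(a)`. -/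
def koszulSign {n : ℕ} (σ : Equiv.Perm (Fin n)) (d : Fin n → ℤ) : ℤˣ :=
  ∏ a : Fin n, ∏ b : Fin n,
    if a < b ∧ σ b < σ a then Int.negOnePow (d (σ a) * d (σ b)) else 1

/-- `(i, n - i)`-shuffles (in `0`-based indexing). -/
def IsShuffle {n : ℕ} (i : ℕ) (σ : Equiv.Perm (Fin n)) : Prop :=
  (∀ a b : Fin n, a < b → (b : ℕ) < i → σ a < σ b) ∧
    ∀ a b : Fin n, i ≤ (a : ℕ) → a < b → σ a < σ b

/-- The term `l_{n-i}(l_{i+1}(x_{σ(1)}, …, x_{σ(i+1)}), x_{σ(i+2)}, …, x_{σ(n)})`. -/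
def jacobiTerm {𝕜 X : Type*} [Field 𝕜] [AddCommGroup X] [Module 𝕜 X]
    (l : ∀ n : ℕ, MultilinearMap 𝕜 (fun _ : Fin n => X) X) {n : ℕ} (x : Fin n → X)
    (i : Fin n) (σ : Equiv.Perm (Fin n)) : X :=
  l (n - (i + 1) + 1) (Fin.cons
    (l (i + 1) fun a : Fin (i + 1) => x (σ ⟨a, by omega⟩))
    fun b : Fin (n - (i + 1)) => x (σ ⟨i + 1 + b, by omega⟩))

open Classical in
/-- An `L_∞[1]`-algebra: a vector space `X` with a `ℤ`-grading `gr` and multilinear brackets `l n`,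
`n ≥ 1`, of degree `1`, that are graded symmetric and satisfy the generalised Jacobi identities.
The map `l 0` plays no role. -/
structure IsLInftyOneAlgebra {𝕜 X : Type*} [Field 𝕜] [AddCommGroup X] [Module 𝕜 X]
    (gr : ℤ → Submodule 𝕜 X) (l : ∀ n : ℕ, MultilinearMap 𝕜 (fun _ : Fin n => X) X) : Prop where
  isInternal : DirectSum.IsInternal gr
  degree_one : ∀ (n : ℕ), 1 ≤ n → ∀ (d : Fin n → ℤ) (x : Fin n → X), (∀ i, x i ∈ gr (d i)) →
    l n x ∈ gr ((∑ i, d i) + 1)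
  symmetric : ∀ (n : ℕ), 1 ≤ n → ∀ (d : Fin n → ℤ) (x : Fin n → X), (∀ i, x i ∈ gr (d i)) →
    ∀ σ : Equiv.Perm (Fin n), l n (fun i => x (σ i)) = koszulSign σ d • l n x
  jacobi : ∀ (n : ℕ), 1 ≤ n → ∀ (d : Fin n → ℤ) (x : Fin n → X), (∀ i, x i ∈ gr (d i)) →
    ∑ i : Fin n, ∑ σ : Equiv.Perm (Fin n) with IsShuffle (i + 1) σ,
      koszulSign σ d • jacobiTerm l x i σ = 0

/-- `S` is an `L_∞[1]`-subalgebra of the `L_∞[1]`-algebra `(X, gr, l)`: a graded subspace that is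
closed under all brackets. -/
structure IsLInftyOneSubalgebra {𝕜 X : Type*} [Field 𝕜] [AddCommGroup X] [Module 𝕜 X]
    (gr : ℤ → Submodule 𝕜 X) (l : ∀ n : ℕ, MultilinearMap 𝕜 (fun _ : Fin n => X) X)
    (S : Submodule 𝕜 X) : Prop where
  isAlgebra : IsLInftyOneAlgebra gr l
  graded : S ≤ ⨆ d : ℤ, S ⊓ gr d
  closed : ∀ (n : ℕ), 1 ≤ n → ∀ x : Fin n → X, (∀ i, x i ∈ S) → l n x ∈ S

end LInftyOne

/-! ### Families of multilinear maps and the `Ω`-Gerstenhaber bracket -/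

namespace OmegaFamily

/-- The left-nested iterated operation `(x₀, …, x_k) ↦ b(… b(b(x₀, x₁), x₂) …, x_k)`. -/
def nest {𝕜 X : Type*} [Field 𝕜] [AddCommGroup X] [Module 𝕜 X] (b : X →ₗ[𝕜] X →ₗ[𝕜] X) :
    ∀ k : ℕ, MultilinearMap 𝕜 (fun _ : Fin (k + 1) => X) X
  | 0 => MultilinearMap.ofSubsingleton 𝕜 X X (0 : Fin 1) LinearMap.id
  | k + 1 => MultilinearMap.uncurryRight (b.compMultilinearMap (nest b k))

/-- The product `α₀ α₁ ⋯ αₙ` in a semigroup. -/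
def semiProd {Ω : Type*} [Semigroup Ω] : ∀ n : ℕ, (Fin (n + 1) → Ω) → Ω
  | 0, α => α 0
  | n + 1, α => α 0 * semiProd n (Fin.tail α)

/-- `(x₀, …, x_{m+n}) ↦ (x₀, …, x_{i-1}, φ(x_i, …, x_{i+n}), x_{i+n+1}, …, x_{m+n})`. -/
def contract {X : Type*} {m n : ℕ} (i : Fin (m + 1)) (φ : (Fin (n + 1) → X) → X)
    (x : Fin (m + n + 1) → X) : Fin (m + 1) → X := fun j =>
  if j < i then x ⟨j, by omega⟩
  else if j = i then φ fun b => x ⟨i + b, by omega⟩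
  else x ⟨j + n, by omega⟩

variable (𝕜 Ω : Type*) [Field 𝕜]

/-- `Hom_Ω(V^{⊗(n+1)}, W)`: families of linear maps `V^{⊗(n+1)} → W` labelled by `Ω^{n+1}`. Such a
family has degree `n`. -/
def Fam (V W : Type*) [AddCommGroup V] [Module 𝕜 V] [AddCommGroup W] [Module 𝕜 W] (n : ℕ) :=
  (Fin (n + 1) → Ω) → MultilinearMap 𝕜 (fun _ : Fin (n + 1) => V) W

section FamInstances

variable {𝕜 Ω}
variable {V W : Type*} [AddCommGroup V] [Module 𝕜 V] [AddCommGroup W] [Module 𝕜 W] {n : ℕ}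

instance : AddCommGroup (Fam 𝕜 Ω V W n) :=
  inferInstanceAs
    (AddCommGroup ((Fin (n + 1) → Ω) → MultilinearMap 𝕜 (fun _ : Fin (n + 1) => V) W))

instance : Module 𝕜 (Fam 𝕜 Ω V W n) :=
  inferInstanceAs
    (Module 𝕜 ((Fin (n + 1) → Ω) → MultilinearMap 𝕜 (fun _ : Fin (n + 1) => V) W))

theorem Fam.ext {f g : Fam 𝕜 Ω V W n} (h : ∀ α v, f α v = g α v) : f = g :=
  funext fun α => MultilinearMap.ext (h α)

@[simp] theorem Fam.add_apply (f g : Fam 𝕜 Ω V W n) (α : Fin (n + 1) → Ω) (v : Fin (n + 1) → V) :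
    (f + g) α v = f α v + g α v := rfl

@[simp] theorem Fam.smul_apply (c : 𝕜) (f : Fam 𝕜 Ω V W n) (α : Fin (n + 1) → Ω)
    (v : Fin (n + 1) → V) : (c • f) α v = c • f α v := rfl

@[simp] theorem Fam.zero_apply (α : Fin (n + 1) → Ω) (v : Fin (n + 1) → V) :
    (0 : Fam 𝕜 Ω V W n) α v = 0 := rfl

end FamInstances

/-- `⨁_{n ≥ 0} Hom_Ω(V^{⊗(n+1)}, W)`. -/
abbrev TotFam (V W : Type*) [AddCommGroup V] [Module 𝕜 V] [AddCommGroup W] [Module 𝕜 W] :=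
  ⨁ n : ℕ, Fam 𝕜 Ω V W n

/-- The identity of `W`, as a family that does not depend on the label. -/
def idFam (W : Type*) [AddCommGroup W] [Module 𝕜 W] : Fam 𝕜 Ω W W 0 :=
  fun _ => MultilinearMap.ofSubsingleton 𝕜 W W (0 : Fin 1) LinearMap.id

variable {𝕜 Ω}
variable {W : Type*} [AddCommGroup W] [Module 𝕜 W]

/-- The position, among `N + 1 + ∑ m j` inputs, of the `b`-th input of the `j`-th block. -/
def blockEquiv {N : ℕ} (m : Fin (N + 1) → ℕ) :
    ((j : Fin (N + 1)) × Fin (m j + 1)) ≃ Fin (N + ∑ j, m j + 1) :=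
  finSigmaFinEquiv.trans (finCongr (by
    rw [Finset.sum_add_distrib]
    simp
    omega))

/-- The composition `f ∘ (g₀ ⊗ ⋯ ⊗ g_N)`: the label of the `j`-th input of `f` is the product of
the labels of the inputs of `g_j`. -/
def fullComp [Semigroup Ω] {N : ℕ} (f : Fam 𝕜 Ω W W N) (g : Fin (N + 1) → Σ n : ℕ, Fam 𝕜 Ω W W n) :
    Fam 𝕜 Ω W W (N + ∑ j, (g j).1) := fun α =>
  ((f fun j => semiProd _ fun b => α (blockEquiv (fun j => (g j).1) ⟨j, b⟩)).compMultilinearMap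
    fun j => (g j).2 fun b => α (blockEquiv (fun j => (g j).1) ⟨j, b⟩)).domDomCongr
      (blockEquiv fun j => (g j).1)

theorem contract_eq_update {X : Type*} {m n : ℕ} (i : Fin (m + 1)) (φ : (Fin (n + 1) → X) → X)
    (x : Fin (m + n + 1) → X) (y : X) :
    contract i φ x = Function.update (contract i (fun _ => y) x) i
      (φ fun b => x ⟨i + b, by omega⟩) := by
  funext j
  by_cases h : j = i
  · subst h
    simp [contract]
  · rw [Function.update_of_ne h]
    simp [contract, h]

theorem contract_update {X : Type*} {m n : ℕ} (i : Fin (m + 1)) (φ : (Fin (n + 1) → X) → X)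
    (x : Fin (m + n + 1) → X) (l : Fin (m + n + 1)) :
    (∃ j : Fin (m + 1), ∀ c : X, contract i φ (Function.update x l c) =
      Function.update (contract i φ x) j c) ∨
    (∃ b : Fin (n + 1), ∀ c : X, contract i φ (Function.update x l c) =
      Function.update (contract i φ x) i
        (φ (Function.update (fun b => x ⟨i + b, by omega⟩) b c))) := by
  have hi := i.2
  have hl := l.2
  by_cases h1 : (l : ℕ) < i
  · refine Or.inl ⟨⟨l, by omega⟩, fun c => ?_⟩
    funext j
    by_cases hj : j = ⟨l, by omega⟩
    · subst hj
      rw [Function.update_self]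
      simp [contract, Fin.lt_def, h1]
    · rw [Function.update_of_ne hj]
      have hj' : (j : ℕ) ≠ l := fun h => hj (Fin.ext h)
      simp only [contract]
      split_ifs with h2 h3
      · exact Function.update_of_ne (fun h => hj' (congrArg Fin.val h)) _ _
      · congr 1
        funext b
        refine Function.update_of_ne (fun h => ?_) _ _
        have := congrArg Fin.val h
        simp only at this
        omega
      · refine Function.update_of_ne (fun h => ?_) _ _
        have := congrArg Fin.val h
        simp only [Fin.lt_def] at this h2
        omega
  · by_cases h2 : (l : ℕ) ≤ i + n
    · refine Or.inr ⟨⟨l - i, by omega⟩, fun c => ?_⟩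
      funext j
      by_cases hj : j = i
      · subst hj
        rw [Function.update_self]
        simp only [contract, lt_irrefl, if_false, if_true]
        congr 1
        funext b
        by_cases hb : b = ⟨l - j, by omega⟩
        · subst hb
          rw [Function.update_self]
          have : (⟨j + (l - j), by omega⟩ : Fin (m + n + 1)) = l := Fin.ext (by simp; omega)
          rw [this, Function.update_self]
        · rw [Function.update_of_ne hb]
          refine Function.update_of_ne (fun h => hb (Fin.ext ?_)) _ _
          have := congrArg Fin.val h
          simp only at this ⊢
          omega
      · rw [Function.update_of_ne hj]
        have hj' : (j : ℕ) ≠ i := fun h => hj (Fin.ext h)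
        simp only [contract, hj, if_false]
        split_ifs with h3
        · refine Function.update_of_ne (fun h => ?_) _ _
          have := congrArg Fin.val h
          simp only [Fin.lt_def] at this h3
          omega
        · refine Function.update_of_ne (fun h => ?_) _ _
          have := congrArg Fin.val h
          simp only [Fin.lt_def] at this h3
          omega
    · refine Or.inl ⟨⟨l - n, by omega⟩, fun c => ?_⟩
      funext j
      by_cases hj : j = ⟨l - n, by omega⟩
      · subst hj
        rw [Function.update_self]
        have h3 : ¬ ((l : ℕ) - n < i) := by omega
        have h4 : (l : ℕ) - n ≠ i := by omega
        have h5 : (⟨(l - n : ℕ) + n, by omega⟩ : Fin (m + n + 1)) = l := Fin.ext (by simp; omega)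
        simp only [contract, Fin.lt_def, Fin.ext_iff, h3, h4, if_false]
        rw [h5, Function.update_self]
      · rw [Function.update_of_ne hj]
        have hj' : (j : ℕ) ≠ l - n := fun h => hj (Fin.ext h)
        have hj2 := j.2
        simp only [contract]
        split_ifs with h3 h4
        · refine Function.update_of_ne (fun h => ?_) _ _
          have := congrArg Fin.val h
          simp only [Fin.lt_def] at this h3
          omega
        · congr 1
          funext b
          refine Function.update_of_ne (fun h => ?_) _ _
          have := congrArg Fin.val h
          simp only at this
          omega
        · refine Function.update_of_ne (fun h => ?_) _ _
          have := congrArg Fin.val h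
          simp only at this
          omega

/-- The partial composition `f ∘ᵢ g`. -/
def circ [Semigroup Ω] {m n : ℕ} (i : Fin (m + 1)) (f : Fam 𝕜 Ω W W m) (g : Fam 𝕜 Ω W W n) :
    Fam 𝕜 Ω W W (m + n) := fun α =>
  { toFun := fun v =>
      f (contract i (semiProd n) α) (contract i (g fun b => α ⟨i + b, by omega⟩) v)
    map_update_add' := by
      intro hdec v l x y
      rw [Subsingleton.elim hdec (instDecidableEqFin _)]
      rcases contract_update i (g fun b => α ⟨i + b, by omega⟩) v l with ⟨j, h⟩ | ⟨b, h⟩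
      · simp only [h, MultilinearMap.map_update_add]
      · simp only [h, MultilinearMap.map_update_add]
    map_update_smul' := by
      intro hdec v l c x
      rw [Subsingleton.elim hdec (instDecidableEqFin _)]
      rcases contract_update i (g fun b => α ⟨i + b, by omega⟩) v l with ⟨j, h⟩ | ⟨b, h⟩
      · simp only [h, MultilinearMap.map_update_smul]
      · simp only [h, MultilinearMap.map_update_smul] }

/-- `∘ᵢ` as a bilinear map. -/
def circₗ [Semigroup Ω] {m n : ℕ} (i : Fin (m + 1)) :
    Fam 𝕜 Ω W W m →ₗ[𝕜] Fam 𝕜 Ω W W n →ₗ[𝕜] Fam 𝕜 Ω W W (m + n) :=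
  LinearMap.mk₂ 𝕜 (circ i)
    (fun f f' g => Fam.ext fun α v => by simp [circ])
    (fun c f g => Fam.ext fun α v => by simp [circ])
    (fun f g g' => Fam.ext fun α v => by
      simp only [circ, Fam.add_apply, MultilinearMap.coe_mk]
      rw [contract_eq_update i _ v 0]
      conv_rhs => rw [contract_eq_update i (g _) v 0, contract_eq_update i (g' _) v 0]
      rw [Fam.add_apply, MultilinearMap.map_update_add])
    (fun c f g => Fam.ext fun α v => by
      simp only [circ, Fam.smul_apply, MultilinearMap.coe_mk]
      rw [contract_eq_update i _ v 0]
      conv_rhs => rw [contract_eq_update i (g _) v 0]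
      rw [Fam.smul_apply, MultilinearMap.map_update_smul])

/-- The signed sum `∑ᵢ (-1)^{(i-1)|g|} f ∘ᵢ g` for `f` of degree `m` and `g` of degree `n`. -/
def insertion [Semigroup Ω] (m n : ℕ) :
    Fam 𝕜 Ω W W m →ₗ[𝕜] Fam 𝕜 Ω W W n →ₗ[𝕜] Fam 𝕜 Ω W W (m + n) :=
  ∑ i : Fin (m + 1), (-1 : 𝕜) ^ ((i : ℕ) * n) • circₗ i

/-- The `Ω`-Gerstenhaber bracket
`[f, g]_Ω = ∑ᵢ (-1)^{(i-1)|g|} f ∘ᵢ g - (-1)^{|f||g|} ∑ᵢ (-1)^{(i-1)|f|} g ∘ᵢ f`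
of homogeneous elements `f` of degree `m` and `g` of degree `n`. -/
def gerstHom [Semigroup Ω] (m n : ℕ) :
    Fam 𝕜 Ω W W m →ₗ[𝕜] Fam 𝕜 Ω W W n →ₗ[𝕜] TotFam 𝕜 Ω W W :=
  (insertion m n).compr₂ (DirectSum.lof 𝕜 ℕ (Fam 𝕜 Ω W W) (m + n)) -
    (-1 : 𝕜) ^ (m * n) •
      (insertion n m).flip.compr₂ (DirectSum.lof 𝕜 ℕ (Fam 𝕜 Ω W W) (n + m))

/-- The `Ω`-Gerstenhaber bracket on `⨁_{n ≥ 0} Hom_Ω(W^{⊗(n+1)}, W)`. -/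
def gerst [Semigroup Ω] :
    TotFam 𝕜 Ω W W →ₗ[𝕜] TotFam 𝕜 Ω W W →ₗ[𝕜] TotFam 𝕜 Ω W W :=
  DirectSum.toModule 𝕜 ℕ _ fun m =>
    (DirectSum.toModule 𝕜 ℕ _ fun n => (gerstHom m n).flip).flip

/-! ### The spaces `𝔏'` and `𝔞` for a pair `(A, V)` -/

variable (𝕜 Ω)
variable (A V : Type*) [AddCommGroup A] [Module 𝕜 A] [AddCommGroup V] [Module 𝕜 V]

/-- `𝔏'(n+1) = Hom_Ω(A^{⊗(n+1)}, A) ⊕ ⨁_{i ≤ n} Hom_Ω(𝒜^{i,n+1-i}, V)`, as a subspace of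
`Hom_Ω((A ⊕ V)^{⊗(n+1)}, A ⊕ V)`: the families whose value lies in `A` if all inputs lie in `A`,
and lies in `V` if at least one input lies in `V` (and hence, by multilinearity, whose components in
`Hom_Ω(A^{⊗(n+1)}, V)` and in `Hom_Ω(𝒜^{i,n+1-i}, A)`, `i ≤ n`, vanish). -/
def LPrime (n : ℕ) : Submodule 𝕜 (Fam 𝕜 Ω (A × V) (A × V) n) where
  carrier := {F | ∀ (α : Fin (n + 1) → Ω) (w : Fin (n + 1) → A × V),
    ((∀ j, (w j).2 = 0) → (F α w).2 = 0) ∧ ((∃ j, (w j).1 = 0) → (F α w).1 = 0)}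
  add_mem' := by
    intro F G hF hG α w
    exact ⟨fun h => by simp [(hF α w).1 h, (hG α w).1 h],
      fun h => by simp [(hF α w).2 h, (hG α w).2 h]⟩
  zero_mem' := by
    intro α w
    simp
  smul_mem' := by
    intro c F hF α w
    exact ⟨fun h => by simp [(hF α w).1 h], fun h => by simp [(hF α w).2 h]⟩

/-- `𝔏' = ⨁_{n ≥ 0} 𝔏'(n+1)`, as a subspace of `⨁_{n ≥ 0} Hom_Ω((A ⊕ V)^{⊗(n+1)}, A ⊕ V)`. -/
def TotLPrime : Submodule 𝕜 (TotFam 𝕜 Ω (A × V) (A × V)) where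
  carrier := {F | ∀ n, F n ∈ LPrime 𝕜 Ω A V n}
  add_mem' := fun hF hG n => by
    rw [DirectSum.add_apply]
    exact add_mem (hF n) (hG n)
  zero_mem' := fun n => by
    rw [DirectSum.zero_apply]
    exact zero_mem _
  smul_mem' := fun c F hF n => by
    rw [DirectSum.smul_apply]
    exact Submodule.smul_mem _ _ (hF n)

variable {𝕜 Ω A V}

theorem circ_mem_LPrime [Semigroup Ω] {m n : ℕ} (i : Fin (m + 1))
    {F : Fam 𝕜 Ω (A × V) (A × V) m} {G : Fam 𝕜 Ω (A × V) (A × V) n}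
    (hF : F ∈ LPrime 𝕜 Ω A V m) (hG : G ∈ LPrime 𝕜 Ω A V n) :
    circ i F G ∈ LPrime 𝕜 Ω A V (m + n) := by
  intro α w
  refine ⟨fun h => (hF _ _).1 fun j => ?_, ?_⟩
  · simp only [contract]
    split_ifs
    · exact h _
    · exact (hG _ _).1 fun b => h _
    · exact h _
  · rintro ⟨l, hl⟩
    have hi := i.2
    have hl2 := l.2
    refine (hF _ _).2 ?_
    by_cases h1 : (l : ℕ) < i
    · refine ⟨⟨l, by omega⟩, ?_⟩
      simpa [contract, Fin.lt_def, h1] using hl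
    · by_cases h2 : (l : ℕ) ≤ i + n
      · refine ⟨i, ?_⟩
        simp only [contract, lt_irrefl, if_false, if_true]
        refine (hG _ _).2 ⟨⟨l - i, by omega⟩, ?_⟩
        have : (⟨i + (l - i), by omega⟩ : Fin (m + n + 1)) = l := Fin.ext (by simp; omega)
        simpa only [this] using hl
      · refine ⟨⟨l - n, by omega⟩, ?_⟩
        have h3 : ¬ ((l : ℕ) - n < i) := by omega
        have h4 : (l : ℕ) - n ≠ i := by omega
        have h5 : (⟨(l - n : ℕ) + n, by omega⟩ : Fin (m + n + 1)) = l := Fin.ext (by simp; omega)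
        simp only [contract, Fin.lt_def, Fin.ext_iff, h3, h4, if_false]
        simpa only [h5] using hl

theorem insertion_mem_LPrime [Semigroup Ω] {m n : ℕ}
    {F : Fam 𝕜 Ω (A × V) (A × V) m} {G : Fam 𝕜 Ω (A × V) (A × V) n}
    (hF : F ∈ LPrime 𝕜 Ω A V m) (hG : G ∈ LPrime 𝕜 Ω A V n) :
    insertion m n F G ∈ LPrime 𝕜 Ω A V (m + n) := by
  simp only [insertion, LinearMap.sum_apply, LinearMap.smul_apply]
  exact Submodule.sum_mem _ fun i _ =>
    Submodule.smul_mem _ _ (circ_mem_LPrime i hF hG)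

theorem lof_mem_TotLPrime {n : ℕ} {F : Fam 𝕜 Ω (A × V) (A × V) n} (hF : F ∈ LPrime 𝕜 Ω A V n) :
    DirectSum.lof 𝕜 ℕ (Fam 𝕜 Ω (A × V) (A × V)) n F ∈ TotLPrime 𝕜 Ω A V := by
  intro k
  by_cases h : n = k
  · subst h
    rwa [DirectSum.lof_apply]
  · rw [DirectSum.lof_eq_of, DirectSum.of_eq_of_ne _ _ _ (Ne.symm h)]
    exact zero_mem _

/-- `𝔏'` is closed under the `Ω`-Gerstenhaber bracket. -/
theorem gerst_mem_TotLPrime [Semigroup Ω] {F G : TotFam 𝕜 Ω (A × V) (A × V)}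
    (hF : F ∈ TotLPrime 𝕜 Ω A V) (hG : G ∈ TotLPrime 𝕜 Ω A V) :
    gerst F G ∈ TotLPrime 𝕜 Ω A V := by
  classical
  rw [← DirectSum.sum_support_of F, ← DirectSum.sum_support_of G]
  simp only [map_sum, LinearMap.sum_apply]
  refine Submodule.sum_mem _ fun m _ => Submodule.sum_mem _ fun n _ => ?_
  simp only [← DirectSum.lof_eq_of 𝕜, gerst, DirectSum.toModule_lof, LinearMap.flip_apply]
  exact Submodule.sub_mem _ (lof_mem_TotLPrime (insertion_mem_LPrime (hF _) (hG _)))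
    (Submodule.smul_mem _ _ (lof_mem_TotLPrime (insertion_mem_LPrime (hG _) (hF _))))

/-- The linear map `f ↦ (-1)^{|f|} f`. -/
def parity : TotFam 𝕜 Ω W W →ₗ[𝕜] TotFam 𝕜 Ω W W :=
  DirectSum.lmap fun n => ((-1 : 𝕜) ^ n) • LinearMap.id

theorem parity_mem_TotLPrime {F : TotFam 𝕜 Ω (A × V) (A × V)} (hF : F ∈ TotLPrime 𝕜 Ω A V) :
    parity F ∈ TotLPrime 𝕜 Ω A V := by
  intro n
  rw [parity, DirectSum.lmap_apply]
  exact Submodule.smul_mem _ _ (hF n)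

/-- The map `f ⊗ g ↦ (-1)^{|f|} [f, g]_Ω` on `𝔏'`. -/
def signedBracket [Semigroup Ω] :
    TotLPrime 𝕜 Ω A V →ₗ[𝕜] TotLPrime 𝕜 Ω A V →ₗ[𝕜] TotLPrime 𝕜 Ω A V :=
  LinearMap.mk₂ 𝕜
    (fun F G => ⟨gerst (parity F.1) G.1, gerst_mem_TotLPrime (parity_mem_TotLPrime F.2) G.2⟩)
    (fun F F' G => Subtype.ext (by
      change gerst (parity (F.1 + F'.1)) G.1 = gerst (parity F.1) G.1 + gerst (parity F'.1) G.1
      rw [map_add, map_add, LinearMap.add_apply]))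
    (fun c F G => Subtype.ext (by
      change gerst (parity (c • F.1)) G.1 = c • gerst (parity F.1) G.1
      rw [map_smul, map_smul, LinearMap.smul_apply]))
    (fun F G G' => Subtype.ext (map_add (gerst (parity F.1)) G.1 G'.1))
    (fun c F G => Subtype.ext (map_smul (gerst (parity F.1)) c G.1))

/-- The inclusion of `Hom_Ω(V^{⊗(n+1)}, A)` into `Hom_Ω((A ⊕ V)^{⊗(n+1)}, A ⊕ V)`. -/
def inclFam (n : ℕ) : Fam 𝕜 Ω V A n →ₗ[𝕜] Fam 𝕜 Ω (A × V) (A × V) n where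
  toFun θ := fun α => (LinearMap.inl 𝕜 A V).compMultilinearMap
    ((θ α).compLinearMap fun _ => LinearMap.snd 𝕜 A V)
  map_add' θ θ' := Fam.ext fun α w => Eq.trans (by simp) (Fam.add_apply _ _ α w).symm
  map_smul' c θ := Fam.ext fun α w => Eq.trans (by simp) (Fam.smul_apply _ _ α w).symm

/-- The component in `Hom_Ω(V^{⊗(n+1)}, A)` of a family in `Hom_Ω((A ⊕ V)^{⊗(n+1)}, A ⊕ V)`. -/
def projFam (n : ℕ) : Fam 𝕜 Ω (A × V) (A × V) n →ₗ[𝕜] Fam 𝕜 Ω V A n where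
  toFun F := fun α => (LinearMap.fst 𝕜 A V).compMultilinearMap
    ((F α).compLinearMap fun _ => LinearMap.inr 𝕜 A V)
  map_add' F F' := Fam.ext fun α w => Eq.trans (by simp) (Fam.add_apply _ _ α w).symm
  map_smul' c F := Fam.ext fun α w => Eq.trans (by simp) (Fam.smul_apply _ _ α w).symm

/-- The inclusion of `𝔞 = ⨁_{n ≥ 0} Hom_Ω(V^{⊗(n+1)}, A)` into
`𝔏 = ⨁_{n ≥ 0} Hom_Ω((A ⊕ V)^{⊗(n+1)}, A ⊕ V)`. -/
def inclTot : TotFam 𝕜 Ω V A →ₗ[𝕜] TotFam 𝕜 Ω (A × V) (A × V) := DirectSum.lmap inclFam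

/-- The projection `P` of `𝔏` onto `𝔞`. -/
def projTot : TotFam 𝕜 Ω (A × V) (A × V) →ₗ[𝕜] TotFam 𝕜 Ω V A := DirectSum.lmap projFam

/-! ### The modified brackets on `s⁻¹𝔏' ⊕ 𝔞` -/

variable (𝕜 Ω A V)

/-- The space `s⁻¹𝔏' ⊕ 𝔞`. -/
abbrev RelSpace := TotLPrime 𝕜 Ω A V × TotFam 𝕜 Ω V A

/-- The grading of `s⁻¹𝔏' ⊕ 𝔞`: an element of `𝔏'(n+1)` has degree `n - 1`, an element of
`Hom_Ω(V^{⊗(n+1)}, A)` has degree `n`. -/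
def relGrading (d : ℤ) : Submodule 𝕜 (RelSpace 𝕜 Ω A V) where
  carrier := {x | (∀ n : ℕ, (n : ℤ) - 1 ≠ d → x.1.1 n = 0) ∧ ∀ n : ℕ, (n : ℤ) ≠ d → x.2 n = 0}
  add_mem' := fun hx hy => ⟨fun n hn => by simp [DirectSum.add_apply, hx.1 n hn, hy.1 n hn],
    fun n hn => by simp [DirectSum.add_apply, hx.2 n hn, hy.2 n hn]⟩
  zero_mem' := ⟨fun n _ => by simp, fun n _ => by simp⟩
  smul_mem' := fun c x hx => ⟨fun n hn => by simp [DirectSum.smul_apply, hx.1 n hn],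
    fun n hn => by simp [DirectSum.smul_apply, hx.2 n hn]⟩

variable {𝕜 Ω A V}

/-- The multilinear map whose value on homogeneous `(x₀, …, x_k)`, where `x_j = f` has degree `d j`
(that is, arity `d j + 1`) and is to be read as `s⁻¹f`, and the other entries are
`θ₁, …, θ_k` in this order, is
`± λ^{d j + 1 - k} [⋯[[f, θ₁]_Ω, θ₂]_Ω ⋯, θ_k]_Ω`,
where `±` is the Koszul sign for moving `s⁻¹f`, of degree `d j - 1`, in front of `x₀, …, x_{j-1}`.
(If `k > d j + 1`, where the subtraction in the exponent truncates, then the iterated bracket of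
`f ∈ 𝔏'` and `θ₁, …, θ_k ∈ 𝔞` is zero.) -/
def movedNest [Semigroup Ω] (lam : 𝕜) (k : ℕ) (j : Fin (k + 1)) :
    MultilinearMap 𝕜 (fun _ : Fin (k + 1) => TotFam 𝕜 Ω W W) (TotFam 𝕜 Ω W W) :=
  MultilinearMap.fromDirectSumEquiv (M := fun _ => Fam 𝕜 Ω W W) fun d : Fin (k + 1) → ℕ =>
    Int.negOnePow (((d j : ℤ) - 1) * ∑ i : Fin (k + 1) with i < j, (d i : ℤ)) •
      lam ^ (d j + 1 - k) •
        ((nest gerst k).domDomCongr j.cycleRange.symm).compLinearMap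
          fun i => DirectSum.lof 𝕜 ℕ (Fam 𝕜 Ω W W) (d i)

/-- The part of the modified bracket `l'_{k+1}`, `k ≥ 1`, that takes one argument from `s⁻¹𝔏'` (the
`j`-th one, summed over `j`) and `k` arguments from `𝔞`:
`l'_{k+1}(s⁻¹f, θ₁, …, θ_k) = λ^{n-k} P[⋯[[f, θ₁]_Ω, θ₂]_Ω ⋯, θ_k]_Ω` for `f ∈ 𝔏'(n)`, extended by
graded symmetry. -/
def derivedPart [Semigroup Ω] (lam : 𝕜) (k : ℕ) :
    MultilinearMap 𝕜 (fun _ : Fin (k + 1) => RelSpace 𝕜 Ω A V) (RelSpace 𝕜 Ω A V) :=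
  ∑ j : Fin (k + 1),
    (LinearMap.inr 𝕜 (TotLPrime 𝕜 Ω A V) (TotFam 𝕜 Ω V A) ∘ₗ projTot).compMultilinearMap
      ((movedNest lam k j).compLinearMap fun i =>
        if i = j then (TotLPrime 𝕜 Ω A V).subtype ∘ₗ LinearMap.fst 𝕜 _ _
        else inclTot ∘ₗ LinearMap.snd 𝕜 _ _)

/-- The part of the modified bracket `l'₂` that takes both arguments from `s⁻¹𝔏'`:
`l'₂(s⁻¹f, s⁻¹g) = (-1)^{|f|} s⁻¹[f, g]_Ω`. -/
def liePart [Semigroup Ω] :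
    MultilinearMap 𝕜 (fun _ : Fin 2 => RelSpace 𝕜 Ω A V) (RelSpace 𝕜 Ω A V) :=
  (LinearMap.inl 𝕜 (TotLPrime 𝕜 Ω A V) (TotFam 𝕜 Ω V A)).compMultilinearMap
    ((nest signedBracket 1).compLinearMap fun _ => LinearMap.fst 𝕜 _ _)

/-- The modified brackets `l'_n` of weight `λ` on `s⁻¹𝔏' ⊕ 𝔞`. -/
def modBracket [Semigroup Ω] (lam : 𝕜) : ∀ n : ℕ,
    MultilinearMap 𝕜 (fun _ : Fin n => RelSpace 𝕜 Ω A V) (RelSpace 𝕜 Ω A V)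
  | 0 => 0
  | 1 => 0
  | 2 => liePart + derivedPart lam 1
  | k + 3 => derivedPart lam (k + 2)

/-! ### The diagonal embedding of `s⁻¹𝔐 ⊕ 𝔥` and the transferred brackets -/

variable (𝕜 Ω A)

/-- The space `s⁻¹𝔐 ⊕ 𝔥`, where `𝔐 = 𝔥 = ⨁_{n ≥ 0} Hom_Ω(A^{⊗(n+1)}, A)`. -/
abbrev AbsSpace := TotFam 𝕜 Ω A A × TotFam 𝕜 Ω A A

/-- The grading of `s⁻¹𝔐 ⊕ 𝔥`: an element of `𝔐(n+1)` has degree `n - 1`, an element of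
`𝔥(n+1)` has degree `n`. -/
def absGrading (d : ℤ) : Submodule 𝕜 (AbsSpace 𝕜 Ω A) where
  carrier := {x | (∀ n : ℕ, (n : ℤ) - 1 ≠ d → x.1 n = 0) ∧ ∀ n : ℕ, (n : ℤ) ≠ d → x.2 n = 0}
  add_mem' := fun hx hy => ⟨fun n hn => by simp [DirectSum.add_apply, hx.1 n hn, hy.1 n hn],
    fun n hn => by simp [DirectSum.add_apply, hx.2 n hn, hy.2 n hn]⟩
  zero_mem' := ⟨fun n _ => by simp, fun n _ => by simp⟩
  smul_mem' := fun c x hx => ⟨fun n hn => by simp [DirectSum.smul_apply, hx.1 n hn],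
    fun n hn => by simp [DirectSum.smul_apply, hx.2 n hn]⟩

variable {𝕜 Ω A}

/-- The map `f ↦ f̃ = (0, …, 0, f; f, …, f, 0)`: with `V = A`, the component of `f̃` from
`A^{⊗(n+1)}` to `A` is `f`; for each proper subset `I` of the set of inputs, the component of `f̃`
to `V` on the inputs with the entries in `I` from `A` and the others from `V` is `f`; all other
components are `0`. -/
def tildeFam (n : ℕ) : Fam 𝕜 Ω A A n →ₗ[𝕜] Fam 𝕜 Ω (A × A) (A × A) n where
  toFun f := fun α =>
    ((f α).compLinearMap fun _ => LinearMap.fst 𝕜 A A).prod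
      (∑ I : Finset (Fin (n + 1)) with I ≠ Finset.univ, (f α).compLinearMap fun j =>
        if j ∈ I then LinearMap.fst 𝕜 A A else LinearMap.snd 𝕜 A A)
  map_add' f f' := Fam.ext fun α w => Eq.trans
    (by simp [Finset.sum_add_distrib]) (Fam.add_apply _ _ α w).symm
  map_smul' c f := Fam.ext fun α w => Eq.trans
    (by simp [Finset.smul_sum]) (Fam.smul_apply _ _ α w).symm

theorem tildeFam_apply (n : ℕ) (f : Fam 𝕜 Ω A A n) (α : Fin (n + 1) → Ω)
    (w : Fin (n + 1) → A × A) : tildeFam n f α w =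
      (f α fun j => (w j).1, ∑ I : Finset (Fin (n + 1)) with I ≠ Finset.univ,
        f α fun j => if j ∈ I then (w j).1 else (w j).2) := by
  refine Prod.ext rfl ?_
  change (∑ I : Finset (Fin (n + 1)) with I ≠ Finset.univ, (f α).compLinearMap fun j =>
        if j ∈ I then LinearMap.fst 𝕜 A A else LinearMap.snd 𝕜 A A) w =
      ∑ I : Finset (Fin (n + 1)) with I ≠ Finset.univ,
        f α fun j => if j ∈ I then (w j).1 else (w j).2
  rw [_root_.sum_apply]
  refine Finset.sum_congr rfl fun I _ => ?_
  rw [MultilinearMap.compLinearMap_apply]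
  congr 1
  funext j
  split_ifs <;> rfl

theorem tildeFam_mem (n : ℕ) (f : Fam 𝕜 Ω A A n) : tildeFam n f ∈ LPrime 𝕜 Ω A A n := by
  intro α w
  rw [tildeFam_apply]
  refine ⟨fun h => ?_, fun ⟨j, hj⟩ => (f α).map_coord_zero j hj⟩
  dsimp only
  refine Finset.sum_eq_zero fun I hI => ?_
  obtain ⟨j, hj⟩ : ∃ j, j ∉ I := by
    by_contra hcon
    push Not at hcon
    exact (Finset.mem_filter.1 hI).2 (Finset.eq_univ_iff_forall.2 hcon)
  exact (f α).map_coord_zero j (by simp [hj, h j])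

/-- The embedding `ι : s⁻¹𝔐 ⊕ 𝔥 → s⁻¹𝔏' ⊕ 𝔞`, `s⁻¹f ↦ s⁻¹f̃`, `θ ↦ θ`, where `V = A`. -/
def diagEmb : AbsSpace 𝕜 Ω A →ₗ[𝕜] RelSpace 𝕜 Ω A A :=
  LinearMap.prodMap
    (LinearMap.codRestrict (TotLPrime 𝕜 Ω A A) (DirectSum.lmap tildeFam) fun F n => by
      rw [DirectSum.lmap_apply]
      exact tildeFam_mem n _)
    LinearMap.id

/-- The component in `Hom_Ω(A^{⊗(n+1)}, A)` of a family in `Hom_Ω((A ⊕ V)^{⊗(n+1)}, A ⊕ V)`. -/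
def topFam (n : ℕ) : Fam 𝕜 Ω (A × V) (A × V) n →ₗ[𝕜] Fam 𝕜 Ω A A n where
  toFun F := fun α => (LinearMap.fst 𝕜 A V).compMultilinearMap
    ((F α).compLinearMap fun _ => LinearMap.inl 𝕜 A V)
  map_add' F F' := Fam.ext fun α w => Eq.trans (by simp) (Fam.add_apply _ _ α w).symm
  map_smul' c F := Fam.ext fun α w => Eq.trans (by simp) (Fam.smul_apply _ _ α w).symm

/-- The map `p`, `s⁻¹f̃ ↦ s⁻¹f`, `θ ↦ θ`. It is written as a map on all of `s⁻¹𝔏' ⊕ 𝔞`, but matters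
on the image of `diagEmb` only, where it is the inverse of `diagEmb`. -/
def diagRetr : RelSpace 𝕜 Ω A A →ₗ[𝕜] AbsSpace 𝕜 Ω A :=
  LinearMap.prodMap (DirectSum.lmap topFam ∘ₗ (TotLPrime 𝕜 Ω A A).subtype) LinearMap.id

/-- The transferred brackets `ϱ_k(x₁, …, x_k) = p l'_k(ι x₁, …, ι x_k)` on `s⁻¹𝔐 ⊕ 𝔥`. -/
def rho [Semigroup Ω] (lam : 𝕜) (k : ℕ) :
    MultilinearMap 𝕜 (fun _ : Fin k => AbsSpace 𝕜 Ω A) (AbsSpace 𝕜 Ω A) :=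
  diagRetr.compMultilinearMap ((modBracket lam k).compLinearMap fun _ => diagEmb)

/-! ### The explicit formulas -/

/-- The element `s⁻¹f` of `s⁻¹𝔐 ⊕ 𝔥`. -/
def inM {n : ℕ} (f : Fam 𝕜 Ω A A n) : AbsSpace 𝕜 Ω A :=
  (DirectSum.lof 𝕜 ℕ (Fam 𝕜 Ω A A) n f, 0)

/-- The element `θ` of `s⁻¹𝔐 ⊕ 𝔥`. -/
def inH {n : ℕ} (θ : Fam 𝕜 Ω A A n) : AbsSpace 𝕜 Ω A :=
  (0, DirectSum.lof 𝕜 ℕ (Fam 𝕜 Ω A A) n θ)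

/-- The exponent `ξ₁` for `f ∘ (θ_{σ(1)} ⊗ ⋯ ⊗ θ_{σ(n)})`, apart from the Koszul sign; `p i` is the
degree of `θ_i`, whose arity is `p i + 1`:
`∑_{i ≥ 2} (∑_{j < i} (p_{σ(j)} + 1)) p_{σ(i)}`. -/
def xiFull {n : ℕ} (p : Fin n → ℕ) (σ : Equiv.Perm (Fin n)) : ℕ :=
  ∑ i : Fin n, (∑ j : Fin n with j < i, (p (σ j) + 1)) * p (σ i)

/-- The term `∑_σ ± f ∘ (θ_{σ(1)} ⊗ ⋯ ⊗ θ_{σ(n+1)})` for `f` of arity `n + 1`. -/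
def fullTerm [Semigroup Ω] {n : ℕ} (f : Fam 𝕜 Ω A A n) (p : Fin (n + 1) → ℕ)
    (θ : ∀ i, Fam 𝕜 Ω A A (p i)) : TotFam 𝕜 Ω A A :=
  ∑ σ : Equiv.Perm (Fin (n + 1)),
    LInftyOne.koszulSign σ (fun i => (p i : ℤ)) • (-1 : 𝕜) ^ xiFull p σ •
      DirectSum.lof 𝕜 ℕ (Fam 𝕜 Ω A A) _ (fullComp f fun i => ⟨p (σ i), θ (σ i)⟩)

/-- The exponent `ξ₃` (and `ξ₂`), apart from the Koszul sign, in `0`-based indexing of `q` and `r`: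
with `n = |f|` and `p i = |θ_i|`, it is
`1 + |f||θ_{σ(1)}| + ∑_{i ≥ 2} (q_i + ∑_{2 ≤ j < i} p_{σ(j)}) |θ_{σ(i)}|
  + r (|f| + ∑_{i ≥ 2} |θ_{σ(i)}|)`. -/
def xiInner {K : ℕ} (n : ℕ) (p : Fin (K + 1) → ℕ) (σ : Equiv.Perm (Fin (K + 1)))
    (q : Fin K → ℕ) (r : ℕ) : ℕ :=
  1 + n * p (σ 0) +
    (∑ i : Fin K, (q i + ∑ j : Fin K with j < i, p (σ j.succ)) * p (σ i.succ)) +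
    r * (n + ∑ i : Fin K, p (σ i.succ))

/-- The composition `f ∘ (id ⊗ ⋯ ⊗ θ_{σ(2)} ⊗ ⋯ ⊗ θ_{σ(K+1)} ⊗ ⋯ ⊗ id)` with `θ_{σ(2)}, …, θ_{σ(K+1)}`
in the positions `q₂ < ⋯ < q_{K+1}` and identity maps elsewhere. -/
def innerComp [Semigroup Ω] {n K : ℕ} (f : Fam 𝕜 Ω A A n) (p : Fin (K + 1) → ℕ)
    (θ : ∀ i, Fam 𝕜 Ω A A (p i)) (σ : Equiv.Perm (Fin (K + 1))) (q : Fin K ↪o Fin (n + 1)) :=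
  fullComp f (Function.extend q (fun i => ⟨p (σ i.succ), θ (σ i.succ)⟩)
    fun _ => ⟨0, idFam 𝕜 Ω A⟩)

open Classical in
/-- The term
`∑_σ ∑_{q₂ < ⋯ < q_{K+1}} ∑_r ± λ^{n-K} θ_{σ(1)} ∘_r (f ∘ (id ⊗ ⋯ θ_{σ(2)} ⋯ θ_{σ(K+1)} ⋯ ⊗ id))`
for `f` of arity `n + 1` and `θ₁, …, θ_{K+1}`. -/
def innerTerm [Semigroup Ω] (lam : 𝕜) {n K : ℕ} (f : Fam 𝕜 Ω A A n) (p : Fin (K + 1) → ℕ)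
    (θ : ∀ i, Fam 𝕜 Ω A A (p i)) : TotFam 𝕜 Ω A A :=
  ∑ σ : Equiv.Perm (Fin (K + 1)), ∑ q : Fin K ↪o Fin (n + 1), ∑ r : Fin (p (σ 0) + 1),
    LInftyOne.koszulSign σ (fun i => (p i : ℤ)) •
      ((-1 : 𝕜) ^ xiInner n p σ (fun i => (q i : ℕ)) r * lam ^ (n - K)) •
        DirectSum.lof 𝕜 ℕ (Fam 𝕜 Ω A A) _ (circ r (θ (σ 0)) (innerComp f p θ σ q))

end OmegaFamily

end

open LInftyOne OmegaFamily

/-! The signed sum of partial compositions (`insT`) satisfies the graded pre-Lie identity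
`insT_preLie`: in the associator of `f`, `g`, `h` everything cancels except the terms where `g` and
`h` sit in two different inputs of `f`, and these are symmetric up to sign. Hence the bracket obeys
the graded Jacobi identity (`gerst_leibniz`). Associativity of `Ω` enters only through the labels of
nested compositions (`seqProd_contrSeq`).

The modified algebra is a derived bracket construction. Elements of `𝔞` take inputs from `V` and
give values in `A`, so `𝔞` is abelian; and `ker P` is closed under insertions, since a family that
sends `V`-inputs to `V` passes only `V`-inputs on. Together this gives `P[u, v] = P[Pu, v] + P[u,
Pv]` (`projTot_gerst`). Moreover `𝔏'` is closed under the bracket and lies in `ker P`. The Jacobi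
identities are sorted by the number of arguments from `s⁻¹𝔏'`. With at most one, every term is zero.
With two, `P` of the iterated bracket of `[u, v]` is expanded by the Leibniz rule and the rule for
`P` (`projTot_foldS_gerst_gerst`), and its summands cancel the other terms one by one
(`sum_jacobiTerm_pair`). With three there is only the Jacobi identity of the bracket itself, when
there are no further arguments. The weight is harmless: the two exponents of `λ` in a composite of
brackets add up to a number that depends only on the arities and on the number of arguments, and
where the truncated subtraction would spoil this the iterated brackets vanish. Graded symmetry is
checked on adjacent transpositions.

The diagonal embedding rests on the closed form `f̃(a, v) = (f(a), f(a + v) - f(a))`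
(`tildeFam_apply'`): both `(a, v) ↦ a` and `(a, v) ↦ a + v` intertwine `f̃` with `f`. Hence `f ↦ f̃`
respects all partial compositions and the bracket. All other brackets take values in `𝔞`, where `ι`
is the identity, so the image is closed and the algebra structure pulls back along the injective map
`ι`.

For the explicit formulas, the iterated bracket of `f̃` with elements of `𝔞` reduces to iterated
insertions into `f̃` and to single insertions of these into some `θ_j` (`foldS_gerst_eq`), because
elements of `𝔞` cannot be inserted into one another. Iterated insertions are sums over placements of
the `θ_i` into the inputs, here called colourings (`foldS_insT_eq_sum`). After projection the first
kind survives only if no input is free, the second only if some input is free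
(`projTot_foldS_gerst_tildeFam`). Reading placements as permutations and increasing sequences of
positions gives the stated sums and signs. -/

noncomputable section

namespace OmegaFamily

open LInftyOne

/-! ### Signs with exponents in `ZMod 2` -/

/-- The sign `(-1)^z` for `z` in `ZMod 2`. -/
def ksgn (𝕜 : Type*) [Field 𝕜] (z : ZMod 2) : 𝕜 := (-1) ^ z.val

section Signs

variable {𝕜 : Type*} [Field 𝕜]

@[simp] theorem ksgn_zero : ksgn 𝕜 0 = 1 := by simp [ksgn]

theorem ksgn_add (x y : ZMod 2) : ksgn 𝕜 (x + y) = ksgn 𝕜 x * ksgn 𝕜 y := by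
  unfold ksgn
  rw [ZMod.val_add, ← pow_add]
  conv_rhs => rw [← Nat.mod_add_div (x.val + y.val) 2, pow_add, pow_mul]
  simp

theorem ksgn_natCast (n : ℕ) : ksgn 𝕜 (n : ZMod 2) = (-1) ^ n := by
  unfold ksgn
  rw [ZMod.val_natCast]
  conv_rhs => rw [← Nat.mod_add_div n 2, pow_add, pow_mul]
  simp

@[simp] theorem ksgn_one : ksgn 𝕜 1 = -1 := by
  have := ksgn_natCast (𝕜 := 𝕜) 1
  simpa using this

theorem ksgn_mul_self (x : ZMod 2) : ksgn 𝕜 x * ksgn 𝕜 x = 1 := by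
  rw [← ksgn_add, CharTwo.add_self_eq_zero, ksgn_zero]

theorem ksgn_eq_or (x : ZMod 2) : ksgn 𝕜 x = 1 ∨ ksgn 𝕜 x = -1 :=
  mul_self_eq_one_iff.1 (ksgn_mul_self x)

theorem neg_ksgn (x : ZMod 2) : -ksgn 𝕜 x = ksgn 𝕜 (x + 1) := by
  rw [ksgn_add, ksgn_one, mul_neg_one]

theorem ksgn_sum {ι : Type*} (s : Finset ι) (f : ι → ZMod 2) :
    ksgn 𝕜 (∑ i ∈ s, f i) = ∏ i ∈ s, ksgn 𝕜 (f i) := by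
  classical
  induction s using Finset.induction_on with
  | empty => simp
  | insert a s ha ih => rw [Finset.sum_insert ha, Finset.prod_insert ha, ksgn_add, ih]

/-- Multiples of this equation are what `linear_combination` needs to compare sign exponents, which
are polynomials in the degrees. -/
theorem two_eq_zero_zmod : (2 : ZMod 2) = 0 := rfl

theorem units_coe_negOnePow (z : ℤ) : (((Int.negOnePow z : ℤˣ) : ℤ) : 𝕜) = ksgn 𝕜 (z : ZMod 2) := by
  rcases Int.even_or_odd z with h | h
  · rw [Int.negOnePow_even z h]
    have : (z : ZMod 2) = 0 := (ZMod.intCast_zmod_eq_zero_iff_dvd z 2).2 h.two_dvd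
    simp [this]
  · rw [Int.negOnePow_odd z h]
    obtain ⟨k, rfl⟩ := h
    have : ((2 * k + 1 : ℤ) : ZMod 2) = 1 := by
      push_cast
      linear_combination (k : ZMod 2) * two_eq_zero_zmod
    rw [this]
    simp

theorem units_smul_eq {X : Type*} [AddCommGroup X] [Module 𝕜 X] (u : ℤˣ) (x : X) :
    u • x = ((u : ℤ) : 𝕜) • x := by
  rw [Units.smul_def, Int.cast_smul_eq_zsmul]

theorem negOnePow_smul {X : Type*} [AddCommGroup X] [Module 𝕜 X] (z : ℤ) (x : X) :
    Int.negOnePow z • x = ksgn 𝕜 (z : ZMod 2) • x := by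
  rw [units_smul_eq (𝕜 := 𝕜), units_coe_negOnePow]

/-- The exponent of the Koszul sign. -/
def koszulExp {n : ℕ} (σ : Equiv.Perm (Fin n)) (d : Fin n → ZMod 2) : ZMod 2 :=
  ∑ a : Fin n, ∑ b : Fin n, if a < b ∧ σ b < σ a then d (σ a) * d (σ b) else 0

/-- Passing from products of signs to additive exponents in `ZMod 2` turns all later sign
comparisons into polynomial identities. -/
theorem koszulSign_smul {X : Type*} [AddCommGroup X] [Module 𝕜 X] {n : ℕ}
    (σ : Equiv.Perm (Fin n)) (d : Fin n → ℤ) (x : X) :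
    koszulSign σ d • x = ksgn 𝕜 (koszulExp σ fun i => (d i : ZMod 2)) • x := by
  rw [units_smul_eq (𝕜 := 𝕜)]
  congr 1
  unfold koszulSign koszulExp
  rw [ksgn_sum]
  push_cast
  refine Finset.prod_congr rfl fun a _ => ?_
  rw [ksgn_sum]
  refine Finset.prod_congr rfl fun b _ => ?_
  split_ifs
  · rw [units_coe_negOnePow]
    push_cast
    rfl
  · simp

end Signs

/-! ### Evaluation of families on sequences -/

section Eval

/-- The shifted sequence. -/
def shift {X : Type*} (i : ℕ) (x : ℕ → X) : ℕ → X := fun k => x (i + k)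

/-- The sequence in which the `n + 1` entries from the `i`-th one on are replaced by `y`. -/
def contrSeq {X : Type*} (i n : ℕ) (y : X) (x : ℕ → X) : ℕ → X := fun k =>
  if k < i then x k else if k = i then y else x (k + n)

variable {𝕜 Ω : Type*} [Field 𝕜]
variable {V W : Type*} [AddCommGroup V] [Module 𝕜 V] [AddCommGroup W] [Module 𝕜 W]

/-- The value of a family on the initial segment of a sequence. -/
def Fam.ev {n : ℕ} (F : Fam 𝕜 Ω V W n) (a : ℕ → Ω) (w : ℕ → V) : W :=
  F (fun i => a i) (fun i => w i)

variable (𝕜 Ω V W) in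
/-- Homogeneous families. -/
abbrev HFam := Σ n : ℕ, Fam 𝕜 Ω V W n

/-- Evaluating on sequences indexed by `ℕ` makes families comparable whose arities agree only
propositionally, such as `m + (n + p)` and `m + n + p` inputs, without casts. -/
theorem exists_seq {X : Type*} {n : ℕ} (x : Fin (n + 1) → X) :
    ∃ y : ℕ → X, x = fun i : Fin (n + 1) => y i :=
  ⟨fun k => x (Fin.ofNat (n + 1) k), by simp⟩

theorem Fam.ext_ev {n : ℕ} {F G : Fam 𝕜 Ω V W n} (h : ∀ a w, F.ev a w = G.ev a w) : F = G := by
  refine Fam.ext fun α v => ?_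
  obtain ⟨a, rfl⟩ := exists_seq α
  obtain ⟨w, rfl⟩ := exists_seq v
  exact h a w

theorem HFam.ext {s t : HFam 𝕜 Ω V W} (h : s.1 = t.1) (h' : ∀ a w, s.2.ev a w = t.2.ev a w) :
    s = t := by
  obtain ⟨n, F⟩ := s
  obtain ⟨m, G⟩ := t
  dsimp only at h
  subst h
  exact congrArg (Sigma.mk n) (Fam.ext_ev h')

/-- A homogeneous family as an element of the direct sum. -/
def HFam.tot (s : HFam 𝕜 Ω V W) : TotFam 𝕜 Ω V W := DirectSum.lof 𝕜 ℕ (Fam 𝕜 Ω V W) s.1 s.2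

theorem lof_eq_of_ev {n m : ℕ} {F : Fam 𝕜 Ω V W n} {G : Fam 𝕜 Ω V W m} (h : n = m)
    (h' : ∀ a w, F.ev a w = G.ev a w) :
    DirectSum.lof 𝕜 ℕ (Fam 𝕜 Ω V W) n F = DirectSum.lof 𝕜 ℕ (Fam 𝕜 Ω V W) m G :=
  congrArg HFam.tot (HFam.ext (s := ⟨n, F⟩) (t := ⟨m, G⟩) h h')

/-- The product of the first `n + 1` entries of a sequence in a semigroup. -/
def seqProd [Semigroup Ω] (n : ℕ) (a : ℕ → Ω) : Ω := semiProd n fun i => a i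

theorem seqProd_zero [Semigroup Ω] (a : ℕ → Ω) : seqProd 0 a = a 0 := rfl

theorem seqProd_succ [Semigroup Ω] (n : ℕ) (a : ℕ → Ω) :
    seqProd (n + 1) a = a 0 * seqProd n (shift 1 a) := by
  change a 0 * semiProd n _ = a 0 * semiProd n _
  congr 2
  funext i
  simp only [Fin.tail, shift, Fin.val_succ]
  rw [add_comm]

theorem shift_shift {X : Type*} (i j : ℕ) (x : ℕ → X) : shift i (shift j x) = shift (j + i) x := by
  funext k
  simp only [shift]
  congr 1
  omega

theorem seqProd_add [Semigroup Ω] (m n : ℕ) (a : ℕ → Ω) :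
    seqProd (n + (m + 1)) a = seqProd n a * seqProd m (shift (n + 1) a) := by
  induction n generalizing a with
  | zero =>
    rw [Nat.zero_add, seqProd_succ, seqProd_zero]
  | succ n ih =>
    rw [show n + 1 + (m + 1) = n + (m + 1) + 1 by omega, seqProd_succ, ih, seqProd_succ n a,
      shift_shift, mul_assoc]
    congr 3
    funext k
    simp only [shift]
    congr 1
    omega

/-- This is associativity in `Ω`: multiplying a block of labels first does not change the total
product. The induction peels off the labels to the left of the block. -/
theorem seqProd_contrSeq [Semigroup Ω] (m n i : ℕ) (h : i ≤ m) (a : ℕ → Ω) :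
    seqProd m (contrSeq i n (seqProd n (shift i a)) a) = seqProd (m + n) a := by
  induction i generalizing a m with
  | zero =>
    rcases m with _ | m
    · rw [Nat.zero_add, seqProd_zero]
      simp only [contrSeq, lt_irrefl, if_false, if_true]
      congr 1
      funext k
      simp [shift]
    · rw [seqProd_succ, show m + 1 + n = n + (m + 1) by omega, seqProd_add]
      congr 1
      · simp only [contrSeq, lt_irrefl, if_false, if_true]
        congr 1
        funext k
        simp [shift]
      · congr 1
        funext k
        simp only [contrSeq, shift]
        rw [if_neg (by omega), if_neg (by omega)]
        congr 1
        omega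
  | succ i ih =>
    obtain ⟨m, rfl⟩ : ∃ m', m = m' + 1 := ⟨m - 1, by omega⟩
    rw [seqProd_succ, show m + 1 + n = m + n + 1 by omega, seqProd_succ, ← ih m (by omega),
      shift_shift]
    congr 1
    congr 1
    funext k
    simp only [contrSeq, shift]
    rw [add_comm 1 i]
    split_ifs <;> first | omega | rfl | (congr 1; omega)

theorem contract_seq {X : Type*} {m n : ℕ} (i : Fin (m + 1)) (φ : (Fin (n + 1) → X) → X)
    (x : ℕ → X) : contract i φ (fun k : Fin (m + n + 1) => x k) =
      fun k : Fin (m + 1) => contrSeq i n (φ fun b => shift i x b) x k := by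
  funext k
  simp only [contract, contrSeq, shift, Fin.lt_def, Fin.ext_iff]

theorem circ_ev [Semigroup Ω] {m n : ℕ} (i : Fin (m + 1)) (F : Fam 𝕜 Ω W W m)
    (G : Fam 𝕜 Ω W W n) (a : ℕ → Ω) (w : ℕ → W) :
    (circ i F G).ev a w = F.ev (contrSeq i n (seqProd n (shift i a)) a)
      (contrSeq i n (G.ev (shift i a) (shift i w)) w) := by
  change F (contract i (semiProd n) fun k : Fin (m + n + 1) => a k)
    (contract i (G fun b => a (i + b)) fun k : Fin (m + n + 1) => w k) = _
  rw [contract_seq, contract_seq]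
  rfl

/-- The position of the first input of the `j`-th block. -/
def blockOffset {N : ℕ} (m : Fin (N + 1) → ℕ) (j : Fin (N + 1)) : ℕ :=
  ∑ i : Fin (N + 1) with i < j, (m i + 1)

theorem sum_castLE_eq {N : ℕ} (m : Fin (N + 1) → ℕ) (j : Fin (N + 1)) :
    ∑ i : Fin j, m (Fin.castLE j.2.le i) = ∑ i : Fin (N + 1) with i < j, m i := by
  refine Finset.sum_bij (fun i _ => Fin.castLE j.2.le i) ?_ ?_ ?_ ?_
  · intro i _
    exact Finset.mem_filter.2 ⟨Finset.mem_univ _, i.2⟩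
  · intro i _ i' _ h
    simpa [Fin.ext_iff] using h
  · intro i hi
    refine ⟨⟨i, (Finset.mem_filter.1 hi).2⟩, Finset.mem_univ _, rfl⟩
  · intro i _
    rfl

theorem blockEquiv_val {N : ℕ} (m : Fin (N + 1) → ℕ) (s : (j : Fin (N + 1)) × Fin (m j + 1)) :
    (blockEquiv m s : ℕ) = blockOffset m s.1 + s.2 := by
  simp only [blockEquiv, Equiv.trans_apply, finCongr_apply, Fin.val_cast, finSigmaFinEquiv_apply]
  congr 1
  exact sum_castLE_eq (fun i => m i + 1) s.1

theorem fullComp_ev [Semigroup Ω] {N : ℕ} (f : Fam 𝕜 Ω W W N) (g : Fin (N + 1) → HFam 𝕜 Ω W W)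
    (a : ℕ → Ω) (w : ℕ → W) :
    (fullComp f g).ev a w =
      f (fun j => seqProd (g j).1 (shift (blockOffset (fun j => (g j).1) j) a))
        (fun j => (g j).2.ev (shift (blockOffset (fun j => (g j).1) j) a)
          (shift (blockOffset (fun j => (g j).1) j) w)) := by
  simp only [Fam.ev, fullComp, MultilinearMap.domDomCongr_apply,
    MultilinearMap.compMultilinearMap_apply, seqProd, shift, blockEquiv_val]
  rfl

theorem Fam.ev_congr {n : ℕ} (F : Fam 𝕜 Ω V W n) {a a' : ℕ → Ω} {w w' : ℕ → V}
    (ha : ∀ k ≤ n, a k = a' k) (hw : ∀ k ≤ n, w k = w' k) : F.ev a w = F.ev a' w' := by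
  unfold Fam.ev
  have h1 : (fun i : Fin (n + 1) => a i) = fun i : Fin (n + 1) => a' i :=
    funext fun i => ha i (Nat.le_of_lt_succ i.2)
  have h2 : (fun i : Fin (n + 1) => w i) = fun i : Fin (n + 1) => w' i :=
    funext fun i => hw i (Nat.le_of_lt_succ i.2)
  rw [h1, h2]

theorem seqProd_congr [Semigroup Ω] {n : ℕ} {a a' : ℕ → Ω} (ha : ∀ k ≤ n, a k = a' k) :
    seqProd n a = seqProd n a' := by
  unfold seqProd
  congr 1
  exact funext fun i => ha i (Nat.le_of_lt_succ i.2)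

theorem update_fst {N : ℕ} (G : Fin (N + 1) → HFam 𝕜 Ω W W) (j : Fin (N + 1))
    (s : HFam 𝕜 Ω W W) :
    (fun i => (Function.update G j s i).1) = Function.update (fun i => (G i).1) j s.1 := by
  funext i
  by_cases h : i = j
  · subst h
    simp
  · simp [h]

theorem blockOffset_update_of_le {N : ℕ} (m : Fin (N + 1) → ℕ) {i j : Fin (N + 1)} (h : i ≤ j)
    (d : ℕ) : blockOffset (Function.update m j d) i = blockOffset m i := by
  unfold blockOffset
  refine Finset.sum_congr rfl fun k hk => ?_
  rw [Function.update_of_ne (ne_of_lt (lt_of_lt_of_le (Finset.mem_filter.1 hk).2 h))]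

theorem blockOffset_update_of_lt {N : ℕ} (m : Fin (N + 1) → ℕ) {i j : Fin (N + 1)} (h : j < i)
    (d : ℕ) : blockOffset (Function.update m j (m j + d)) i = blockOffset m i + d := by
  unfold blockOffset
  have hj : j ∈ Finset.univ.filter (· < i) := Finset.mem_filter.2 ⟨Finset.mem_univ _, h⟩
  rw [← Finset.add_sum_erase _ _ hj, ← Finset.add_sum_erase _ (fun i => m i + 1) hj,
    Function.update_self]
  rw [Finset.sum_congr rfl fun k hk => by
    rw [Function.update_of_ne (Finset.ne_of_mem_erase hk)]]
  omega

theorem blockOffset_add_lt {N : ℕ} (m : Fin (N + 1) → ℕ) {i j : Fin (N + 1)} (h : j < i) :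
    blockOffset m j + m j < blockOffset m i := by
  unfold blockOffset
  have hj : j ∈ Finset.univ.filter (· < i) := Finset.mem_filter.2 ⟨Finset.mem_univ _, h⟩
  rw [← Finset.add_sum_erase _ (fun i => m i + 1) hj]
  have : ∑ k : Fin (N + 1) with k < j, (m k + 1) ≤
      ∑ k ∈ (Finset.univ.filter (· < i)).erase j, (m k + 1) := by
    refine Finset.sum_le_sum_of_subset fun k hk => ?_
    have hk := (Finset.mem_filter.1 hk).2
    exact Finset.mem_erase.2 ⟨hk.ne, Finset.mem_filter.2 ⟨Finset.mem_univ _, hk.trans h⟩⟩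
  omega

theorem shift_contrSeq {X : Type*} (o b p : ℕ) (y : X) (x : ℕ → X) :
    shift o (contrSeq (o + b) p y x) = contrSeq b p y (shift o x) := by
  funext k
  simp only [shift, contrSeq]
  split_ifs <;> first | omega | rfl | (congr 1; omega)

theorem shift_contrSeq_of_lt {X : Type*} {o l p : ℕ} (h : l < o) (y : X) (x : ℕ → X) :
    shift o (contrSeq l p y x) = shift (o + p) x := by
  funext k
  simp only [shift, contrSeq]
  rw [if_neg (by omega), if_neg (by omega)]
  congr 1
  omega

/-- The composition `f ∘ (G₀ ⊗ ⋯ ⊗ G_N)` as an element of the total space. -/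
def fullTot [Semigroup Ω] {N : ℕ} (f : Fam 𝕜 Ω W W N) (G : Fin (N + 1) → HFam 𝕜 Ω W W) :
    TotFam 𝕜 Ω W W := DirectSum.lof 𝕜 ℕ (Fam 𝕜 Ω W W) _ (fullComp f G)

/-- Inserting a family into the `b`-th input of the `j`-th block of `f ∘ (G₀ ⊗ ⋯ ⊗ G_N)`. -/
theorem circ_fullComp [Semigroup Ω] {N p : ℕ} (f : Fam 𝕜 Ω W W N)
    (G : Fin (N + 1) → HFam 𝕜 Ω W W) (h : Fam 𝕜 Ω W W p) (j : Fin (N + 1))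
    (b : Fin ((G j).1 + 1)) :
    DirectSum.lof 𝕜 ℕ (Fam 𝕜 Ω W W) _
        (circ (blockEquiv (fun i => (G i).1) ⟨j, b⟩) (fullComp f G) h) =
      fullTot f (Function.update G j ⟨_, circ b (G j).2 h⟩) := by
  refine lof_eq_of_ev ?_ fun a w => ?_
  · have := congrArg (fun m : Fin (N + 1) → ℕ => ∑ i, m i)
      (update_fst G j ⟨_, circ b (G j).2 h⟩)
    dsimp only at this
    rw [this, Finset.sum_update_of_mem (Finset.mem_univ _),
      ← Finset.add_sum_erase Finset.univ _ (Finset.mem_univ j), Finset.sdiff_singleton_eq_erase]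
    omega
  rw [circ_ev, fullComp_ev, fullComp_ev, blockEquiv_val, update_fst]
  have hb := b.2
  have key : ∀ i, seqProd (G i).1 (shift (blockOffset (fun j => (G j).1) i)
        (contrSeq (blockOffset (fun i => (G i).1) j + b) p
          (seqProd p (shift (blockOffset (fun i => (G i).1) j + b) a)) a)) =
      seqProd (Function.update G j ⟨_, circ b (G j).2 h⟩ i).1
        (shift (blockOffset (Function.update (fun i => (G i).1) j ((G j).1 + p)) i) a) ∧
      (G i).2.ev (shift (blockOffset (fun j => (G j).1) i)
        (contrSeq (blockOffset (fun i => (G i).1) j + b) p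
          (seqProd p (shift (blockOffset (fun i => (G i).1) j + b) a)) a))
        (shift (blockOffset (fun j => (G j).1) i)
        (contrSeq (blockOffset (fun i => (G i).1) j + b) p
          (h.ev (shift (blockOffset (fun i => (G i).1) j + b) a)
            (shift (blockOffset (fun i => (G i).1) j + b) w)) w)) =
      (Function.update G j ⟨_, circ b (G j).2 h⟩ i).2.ev
        (shift (blockOffset (Function.update (fun i => (G i).1) j ((G j).1 + p)) i) a)
        (shift (blockOffset (Function.update (fun i => (G i).1) j ((G j).1 + p)) i) w) := by
    intro i
    -- Blocks to the left of the `j`-th are unaffected, the `j`-th is a partial composition whose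
    -- label is handled by `seqProd_contrSeq`, and the blocks to the right move by the degree `p` of
    -- `h`.
    rcases lt_trichotomy i j with hij | rfl | hij
    · rw [Function.update_of_ne hij.ne, blockOffset_update_of_le _ hij.le]
      have hlt := blockOffset_add_lt (fun i => (G i).1) hij
      have aux : ∀ {X : Type _} (y : X) (x : ℕ → X), ∀ k ≤ (G i).1,
          shift (blockOffset (fun j => (G j).1) i)
            (contrSeq (blockOffset (fun i => (G i).1) j + b) p y x) k =
          shift (blockOffset (fun j => (G j).1) i) x k := by
        intro X y x k hk
        simp only [shift, contrSeq]
        rw [if_pos (by omega)]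
      have aux' : ∀ (y : W) (x : ℕ → W), ∀ k ≤ (G i).1,
          shift (blockOffset (fun j => (G j).1) i)
            (contrSeq (blockOffset (fun i => (G i).1) j + b) p y x) k =
          shift (blockOffset (fun j => (G j).1) i) x k := by
        intro y x k hk
        simp only [shift, contrSeq]
        rw [if_pos (by omega)]
      exact ⟨seqProd_congr (aux _ _), Fam.ev_congr _ (aux _ _) (aux' _ _)⟩
    · rw [Function.update_self, blockOffset_update_of_le _ le_rfl, shift_contrSeq, shift_contrSeq]
      rw [circ_ev, shift_shift, shift_shift, ← seqProd_contrSeq _ _ _ (Nat.le_of_lt_succ hb),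
        shift_shift]
      exact ⟨rfl, rfl⟩
    · have hlt := blockOffset_add_lt (fun i => (G i).1) hij
      rw [Function.update_of_ne hij.ne', blockOffset_update_of_lt (fun i => (G i).1) hij,
        shift_contrSeq_of_lt (by omega), shift_contrSeq_of_lt (by omega)]
      exact ⟨rfl, rfl⟩
  congr 1
  · congr 1
    exact funext fun i => (key i).1
  · exact funext fun i => (key i).2

/-- The identity as a homogeneous family. -/
def idH (𝕜 Ω W : Type*) [Field 𝕜] [AddCommGroup W] [Module 𝕜 W] : HFam 𝕜 Ω W W :=
  ⟨0, idFam 𝕜 Ω W⟩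

theorem idFam_ev (a : ℕ → Ω) (w : ℕ → W) : (idFam 𝕜 Ω W).ev a w = w 0 := rfl

theorem blockOffset_single {N : ℕ} (i : Fin (N + 1)) (d : ℕ) (j : Fin (N + 1)) :
    blockOffset (Function.update (fun _ => 0) i d) j = j + if i < j then d else 0 := by
  have h0 : blockOffset (fun _ : Fin (N + 1) => 0) j = j := by
    have : Finset.univ.filter (· < j) = Finset.Iio j := by
      ext k
      simp
    simp [blockOffset, this]
  split_ifs with h
  · have := blockOffset_update_of_lt (fun _ => 0) h d
    rw [zero_add] at this
    rw [this, h0]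
  · rw [blockOffset_update_of_le _ (not_lt.1 h), h0, add_zero]

/-- Writing a single insertion as a full composition with identities elsewhere allows the next
insertion to be described by `circ_fullComp`. -/
theorem circ_eq_fullComp [Semigroup Ω] {m n : ℕ} (i : Fin (m + 1)) (f : Fam 𝕜 Ω W W m)
    (g : Fam 𝕜 Ω W W n) :
    DirectSum.lof 𝕜 ℕ (Fam 𝕜 Ω W W) _ (circ i f g) =
      fullTot f (Function.update (fun _ => idH 𝕜 Ω W) i ⟨n, g⟩) := by
  have hfst : (fun j => (Function.update (fun _ => idH 𝕜 Ω W) i ⟨n, g⟩ j).1) =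
      Function.update (fun _ : Fin (m + 1) => 0) i n :=
    update_fst (fun _ => idH 𝕜 Ω W) i ⟨n, g⟩
  refine lof_eq_of_ev ?_ fun a w => ?_
  · have := congrArg (fun m' : Fin (m + 1) → ℕ => ∑ i, m' i) hfst
    rw [this, Finset.sum_update_of_mem (Finset.mem_univ _)]
    simp
  rw [circ_ev, fullComp_ev, hfst]
  have key : ∀ j : Fin (m + 1), contrSeq i n (seqProd n (shift i a)) a j =
      seqProd (Function.update (fun _ => idH 𝕜 Ω W) i ⟨n, g⟩ j).1
        (shift (blockOffset (Function.update (fun _ => 0) i n) j) a) ∧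
      contrSeq i n (g.ev (shift i a) (shift i w)) w j =
        (Function.update (fun _ => idH 𝕜 Ω W) i ⟨n, g⟩ j).2.ev
        (shift (blockOffset (Function.update (fun _ => 0) i n) j) a)
        (shift (blockOffset (Function.update (fun _ => 0) i n) j) w) := by
    intro j
    rw [blockOffset_single]
    rcases lt_trichotomy j i with hij | rfl | hij
    · rw [Function.update_of_ne hij.ne, if_neg hij.le.not_gt]
      simp [contrSeq, idH, seqProd_zero, shift, idFam_ev, hij]
    · rw [Function.update_self]
      simp [contrSeq]
    · rw [Function.update_of_ne hij.ne', if_pos hij]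
      simp [contrSeq, idH, seqProd_zero, shift, idFam_ev, hij.ne', hij.not_gt, Fin.val_inj]
  unfold Fam.ev
  congr 1
  · congr 1
    exact funext fun i => (key i).1
  · exact funext fun i => (key i).2

theorem circ_idFam [Semigroup Ω] {p : ℕ} (b : Fin 1) (h : Fam 𝕜 Ω W W p) :
    (⟨0 + p, circ b (idFam 𝕜 Ω W) h⟩ : HFam 𝕜 Ω W W) = ⟨p, h⟩ := by
  refine HFam.ext (Nat.zero_add p) fun a w => ?_
  dsimp only
  rw [circ_ev, idFam_ev]
  have hb : (b : ℕ) = 0 := by omega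
  simp only [contrSeq, hb, lt_irrefl, if_false, if_true]
  refine Fam.ev_congr _ ?_ ?_ <;> simp [shift]

end Eval

/-! ### The pre-Lie identity and the graded Lie algebra of families -/

section Lie

variable {𝕜 Ω : Type*} [Field 𝕜]
variable {W : Type*} [AddCommGroup W] [Module 𝕜 W]

variable (𝕜 Ω W) in
/-- The homogeneous elements of degree `n`. -/
def homog (n : ℕ) : Submodule 𝕜 (TotFam 𝕜 Ω W W) :=
  LinearMap.range (DirectSum.lof 𝕜 ℕ (Fam 𝕜 Ω W W) n)

theorem lof_mem_homog {n : ℕ} (f : Fam 𝕜 Ω W W n) :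
    DirectSum.lof 𝕜 ℕ (Fam 𝕜 Ω W W) n f ∈ homog 𝕜 Ω W n := ⟨f, rfl⟩

variable [Semigroup Ω]

/-- The signed sum of all partial compositions, as a bilinear map on the total space. -/
def insT : TotFam 𝕜 Ω W W →ₗ[𝕜] TotFam 𝕜 Ω W W →ₗ[𝕜] TotFam 𝕜 Ω W W :=
  DirectSum.toModule 𝕜 ℕ _ fun m =>
    (DirectSum.toModule 𝕜 ℕ _ fun n =>
      ((insertion m n).compr₂ (DirectSum.lof 𝕜 ℕ (Fam 𝕜 Ω W W) (m + n))).flip).flip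

theorem insT_lof (m n : ℕ) (f : Fam 𝕜 Ω W W m) (g : Fam 𝕜 Ω W W n) :
    insT (DirectSum.lof 𝕜 ℕ (Fam 𝕜 Ω W W) m f) (DirectSum.lof 𝕜 ℕ (Fam 𝕜 Ω W W) n g) =
      DirectSum.lof 𝕜 ℕ (Fam 𝕜 Ω W W) (m + n) (insertion m n f g) := by
  simp only [insT, DirectSum.toModule_lof, LinearMap.flip_apply, LinearMap.compr₂_apply]

theorem insT_lof_eq_sum (m n : ℕ) (f : Fam 𝕜 Ω W W m) (g : Fam 𝕜 Ω W W n) :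
    insT (DirectSum.lof 𝕜 ℕ (Fam 𝕜 Ω W W) m f) (DirectSum.lof 𝕜 ℕ (Fam 𝕜 Ω W W) n g) =
      ∑ i : Fin (m + 1), ksgn 𝕜 ((i : ℕ) * n) •
        DirectSum.lof 𝕜 ℕ (Fam 𝕜 Ω W W) (m + n) (circ i f g) := by
  rw [insT_lof]
  simp only [insertion, LinearMap.sum_apply, map_sum, LinearMap.smul_apply, map_smul]
  refine Finset.sum_congr rfl fun i _ => ?_
  rw [← ksgn_natCast]
  push_cast
  rfl

theorem gerst_lof (m n : ℕ) (f : Fam 𝕜 Ω W W m) (g : Fam 𝕜 Ω W W n) :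
    gerst (DirectSum.lof 𝕜 ℕ (Fam 𝕜 Ω W W) m f) (DirectSum.lof 𝕜 ℕ (Fam 𝕜 Ω W W) n g) =
      gerstHom m n f g := by
  simp only [gerst, DirectSum.toModule_lof, LinearMap.flip_apply]

theorem insT_mem_homog {m n : ℕ} {u v : TotFam 𝕜 Ω W W} (hu : u ∈ homog 𝕜 Ω W m)
    (hv : v ∈ homog 𝕜 Ω W n) : insT u v ∈ homog 𝕜 Ω W (m + n) := by
  obtain ⟨f, rfl⟩ := hu
  obtain ⟨g, rfl⟩ := hv
  rw [insT_lof]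
  exact lof_mem_homog _

theorem gerst_eq_insT {m n : ℕ} {u v : TotFam 𝕜 Ω W W} (hu : u ∈ homog 𝕜 Ω W m)
    (hv : v ∈ homog 𝕜 Ω W n) : gerst u v = insT u v - ksgn 𝕜 (m * n) • insT v u := by
  obtain ⟨f, rfl⟩ := hu
  obtain ⟨g, rfl⟩ := hv
  rw [gerst_lof, insT_lof, insT_lof, ← Nat.cast_mul, ksgn_natCast]
  rfl

theorem gerst_mem_homog {m n : ℕ} {u v : TotFam 𝕜 Ω W W} (hu : u ∈ homog 𝕜 Ω W m)
    (hv : v ∈ homog 𝕜 Ω W n) : gerst u v ∈ homog 𝕜 Ω W (m + n) := by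
  rw [gerst_eq_insT hu hv]
  refine Submodule.sub_mem _ (insT_mem_homog hu hv) (Submodule.smul_mem _ _ ?_)
  rw [add_comm]
  exact insT_mem_homog hv hu

/-- The first steps of a Leibniz rule for insertions into `f ∘ (G₀ ⊗ ⋯ ⊗ G_N)`. -/
theorem insT_fullComp {N p : ℕ} (f : Fam 𝕜 Ω W W N) (G : Fin (N + 1) → HFam 𝕜 Ω W W)
    (h : Fam 𝕜 Ω W W p) :
    insT (fullTot f G)
        (DirectSum.lof 𝕜 ℕ (Fam 𝕜 Ω W W) p h) =
      ∑ j, ∑ b : Fin ((G j).1 + 1), ksgn 𝕜 ((blockOffset (fun i => (G i).1) j + b : ℕ) * p) •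
        fullTot f (Function.update G j ⟨_, circ b (G j).2 h⟩) := by
  -- The inputs of the composite are indexed by a block and a position within that block.
  rw [fullTot, insT_lof_eq_sum, ← (blockEquiv fun i => (G i).1).sum_comp, Fintype.sum_sigma]
  refine Finset.sum_congr rfl fun j _ => Finset.sum_congr rfl fun b _ => ?_
  rw [circ_fullComp, blockEquiv_val]

/-- The contribution of two families inserted side by side. -/
def parallel {m n p : ℕ} (f : Fam 𝕜 Ω W W m) (g : Fam 𝕜 Ω W W n) (h : Fam 𝕜 Ω W W p)
    (i j : Fin (m + 1)) : TotFam 𝕜 Ω W W :=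
  fullTot f (Function.update (Function.update (fun _ => idH 𝕜 Ω W) i ⟨n, g⟩) j ⟨p, h⟩)

/-- Insertions into distinct inputs commute. This symmetry is the source of the pre-Lie identity. -/
theorem parallel_comm {m n p : ℕ} (f : Fam 𝕜 Ω W W m) (g : Fam 𝕜 Ω W W n) (h : Fam 𝕜 Ω W W p)
    {i j : Fin (m + 1)} (hij : i ≠ j) : parallel f g h i j = parallel f h g j i := by
  unfold parallel
  rw [Function.update_comm hij]

/-- The new family `h` goes either into `g`, which reproduces the nested composition, or into
another input `j` of `f`, whose position is moved by `n` if it lies to the right of `g`. -/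
theorem insT_circ {m n p : ℕ} (f : Fam 𝕜 Ω W W m) (g : Fam 𝕜 Ω W W n) (h : Fam 𝕜 Ω W W p)
    (i : Fin (m + 1)) :
    insT (DirectSum.lof 𝕜 ℕ (Fam 𝕜 Ω W W) _ (circ i f g))
        (DirectSum.lof 𝕜 ℕ (Fam 𝕜 Ω W W) p h) =
      ksgn 𝕜 ((i : ℕ) * p) • DirectSum.lof 𝕜 ℕ (Fam 𝕜 Ω W W) _ (circ i f (insertion n p g h)) +
      ∑ j ∈ Finset.univ.erase i, ksgn 𝕜 (((j : ℕ) + if i < j then n else 0 : ℕ) * p) •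
        parallel f g h i j := by
  rw [circ_eq_fullComp, insT_fullComp, ← Finset.add_sum_erase _ _ (Finset.mem_univ i)]
  have hoff : ∀ j, blockOffset
      (fun k => (Function.update (fun _ => idH 𝕜 Ω W) i ⟨n, g⟩ k).1) j =
        j + if i < j then n else 0 := fun j => by
    rw [update_fst]
    exact blockOffset_single i n j
  congr 1
  · simp only [hoff]
    rw [Function.update_self]
    simp only [Function.update_idem, lt_irrefl, if_false, add_zero]
    have : circ i f (insertion n p g h) = circₗ i f (insertion n p g h) := rfl
    rw [this]
    simp only [insertion, LinearMap.sum_apply, LinearMap.smul_apply, map_sum, map_smul]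
    rw [Finset.smul_sum]
    refine Finset.sum_congr rfl fun b _ => ?_
    rw [smul_smul, ← ksgn_natCast, ← ksgn_add]
    push_cast
    rw [add_mul, ← circ_eq_fullComp]
    rfl
  · refine Finset.sum_congr rfl fun j hj => ?_
    have hj := Finset.ne_of_mem_erase hj
    rw [hoff, Function.update_of_ne hj]
    have h1 : ∀ b : Fin ((idH 𝕜 Ω W).1 + 1), (b : ℕ) = 0 := fun b => Fin.val_eq_zero b
    have h2 : ∀ b : Fin ((idH 𝕜 Ω W).1 + 1),
        (⟨_, circ b (idH 𝕜 Ω W).2 h⟩ : HFam 𝕜 Ω W W) = ⟨p, h⟩ := fun b => circ_idFam b h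
    simp only [h1, h2, add_zero]
    have h3 : (Finset.univ : Finset (Fin ((idH 𝕜 Ω W).1 + 1))).card = 1 := rfl
    rw [Finset.sum_const, h3, one_smul]
    rfl

/-- The nested terms of `insT_circ` cancel against the second summand, so the associator consists of
the side-by-side terms only. -/
theorem preLie_aux {m n p : ℕ} (f : Fam 𝕜 Ω W W m) (g : Fam 𝕜 Ω W W n) (h : Fam 𝕜 Ω W W p) :
    insT (insT (DirectSum.lof 𝕜 ℕ (Fam 𝕜 Ω W W) m f) (DirectSum.lof 𝕜 ℕ (Fam 𝕜 Ω W W) n g))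
        (DirectSum.lof 𝕜 ℕ (Fam 𝕜 Ω W W) p h) -
      insT (DirectSum.lof 𝕜 ℕ (Fam 𝕜 Ω W W) m f)
        (insT (DirectSum.lof 𝕜 ℕ (Fam 𝕜 Ω W W) n g) (DirectSum.lof 𝕜 ℕ (Fam 𝕜 Ω W W) p h)) =
      ∑ i : Fin (m + 1), ∑ j : Fin (m + 1), if i = j then 0 else
        ksgn 𝕜 ((i : ℕ) * n + (j : ℕ) * p + if i < j then (n : ZMod 2) * p else 0) •
          parallel f g h i j := by
  rw [insT_lof_eq_sum m n, map_sum, LinearMap.sum_apply, insT_lof n p, insT_lof_eq_sum,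
    ← Finset.sum_sub_distrib]
  refine Finset.sum_congr rfl fun i _ => ?_
  rw [map_smul, LinearMap.smul_apply, insT_circ, smul_add, smul_smul, ← ksgn_add]
  have : DirectSum.lof 𝕜 ℕ (Fam 𝕜 Ω W W) _ (circ i f (insertion n p g h)) =
      DirectSum.lof 𝕜 ℕ (Fam 𝕜 Ω W W) (m + (n + p)) (circ i f (insertion n p g h)) := rfl
  rw [this]
  push_cast
  rw [mul_add, add_sub_cancel_left, ← Finset.add_sum_erase _ _ (Finset.mem_univ i), if_pos rfl,
    zero_add, Finset.smul_sum]
  refine Finset.sum_congr rfl fun j hj => ?_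
  rw [if_neg (Finset.ne_of_mem_erase hj).symm, smul_smul, ← ksgn_add]
  congr 2
  split_ifs <;> ring

/-- The graded pre-Lie identity. -/
theorem insT_preLie {m n p : ℕ} {u v w : TotFam 𝕜 Ω W W} (hu : u ∈ homog 𝕜 Ω W m)
    (hv : v ∈ homog 𝕜 Ω W n) (hw : w ∈ homog 𝕜 Ω W p) :
    insT (insT u v) w - insT u (insT v w) =
      ksgn 𝕜 (n * p) • (insT (insT u w) v - insT u (insT w v)) := by
  obtain ⟨f, rfl⟩ := hu
  obtain ⟨g, rfl⟩ := hv
  obtain ⟨h, rfl⟩ := hw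
  rw [preLie_aux, preLie_aux, Finset.sum_comm, Finset.smul_sum]
  refine Finset.sum_congr rfl fun j _ => ?_
  rw [Finset.smul_sum]
  refine Finset.sum_congr rfl fun i _ => ?_
  by_cases hij : i = j
  · rw [if_pos hij, if_pos hij.symm, smul_zero]
  · rw [if_neg hij, if_neg (Ne.symm hij), smul_smul, ← ksgn_add, parallel_comm f g h hij]
    congr 2
    -- The extra exponent `n * p` occurs on exactly one of the two sides, depending on which of `g`,
    -- `h` is further left; the global sign makes up for it.
    rcases lt_or_gt_of_ne hij with hlt | hlt
    · rw [if_pos hlt, if_neg hlt.not_gt]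
      ring
    · rw [if_pos hlt, if_neg hlt.not_gt]
      linear_combination (-(n : ZMod 2) * p) * two_eq_zero_zmod

theorem gerst_antisymm {m n : ℕ} {u v : TotFam 𝕜 Ω W W} (hu : u ∈ homog 𝕜 Ω W m)
    (hv : v ∈ homog 𝕜 Ω W n) : gerst u v = ksgn 𝕜 (m * n + 1) • gerst v u := by
  rw [gerst_eq_insT hu hv, gerst_eq_insT hv hu, ksgn_add, ksgn_one, mul_comm (n : ZMod 2) m,
    smul_sub, smul_smul, mul_neg_one, neg_mul, ksgn_mul_self, neg_smul, neg_smul, one_smul]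
  abel

/-- The graded Jacobi identity, in the form of a Leibniz rule for a bracketing from the right. -/
theorem gerst_leibniz {m n p : ℕ} {u v w : TotFam 𝕜 Ω W W} (hu : u ∈ homog 𝕜 Ω W m)
    (hv : v ∈ homog 𝕜 Ω W n) (hw : w ∈ homog 𝕜 Ω W p) :
    gerst (gerst u v) w = gerst u (gerst v w) + ksgn 𝕜 (n * p) • gerst (gerst u w) v := by
  have h1 := insT_preLie hu hv hw
  have h2 := insT_preLie hv hu hw
  have h3 := insT_preLie hw hu hv
  rw [gerst_eq_insT (gerst_mem_homog hu hv) hw, gerst_eq_insT hu (gerst_mem_homog hv hw),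
    gerst_eq_insT (gerst_mem_homog hu hw) hv, gerst_eq_insT hu hv, gerst_eq_insT hv hw,
    gerst_eq_insT hu hw]
  simp only [map_sub, map_smul, LinearMap.sub_apply, LinearMap.smul_apply, Nat.cast_add,
    mul_add, add_mul, ksgn_add] at h1 h2 h3 ⊢
  rw [mul_comm (p : ZMod 2) n]
  -- Once the sign of `n * p` is known and the other two are scalars, the claim is a linear
  -- combination of the pre-Lie identities with `u`, `v` and `w` in the outer position.
  generalize ksgn 𝕜 ((m : ZMod 2) * n) = a at *
  generalize ksgn 𝕜 ((m : ZMod 2) * p) = b at *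
  rcases ksgn_eq_or (𝕜 := 𝕜) ((n : ZMod 2) * p) with hc | hc
  · rw [hc] at h1 ⊢
    linear_combination (norm := module) h1 - a • h2 + b • h3
  · rw [hc] at h1 ⊢
    linear_combination (norm := module) h1 - a • h2 - b • h3

end Lie

/-! ### The projection onto `𝔞` and the map `f ↦ f̃` -/

section Pair

variable {𝕜 Ω : Type*} [Field 𝕜]
variable {A V : Type*} [AddCommGroup A] [Module 𝕜 A] [AddCommGroup V] [Module 𝕜 V]

theorem map_contrSeq {X Y : Type*} (φ : X → Y) (i n : ℕ) (y : X) (x : ℕ → X) (k : ℕ) :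
    φ (contrSeq i n y x k) = contrSeq i n (φ y) (fun k => φ (x k)) k := by
  unfold contrSeq
  split_ifs <;> rfl

theorem contrSeq_self {X : Type*} (i n : ℕ) (y : X) (x : ℕ → X) : contrSeq i n y x i = y := by
  simp [contrSeq]

theorem Fam.ev_eq_zero {W : Type*} [AddCommGroup W] [Module 𝕜 W] {n : ℕ} (F : Fam 𝕜 Ω V W n)
    {a : ℕ → Ω} {w : ℕ → V} {k : ℕ} (hk : k ≤ n) (h : w k = 0) : F.ev a w = 0 :=
  (F fun i => a i).map_coord_zero ⟨k, Nat.lt_succ_of_le hk⟩ h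

theorem inclFam_ev {n : ℕ} (θ : Fam 𝕜 Ω V A n) (a : ℕ → Ω) (w : ℕ → A × V) :
    (inclFam n θ).ev a w = (θ.ev a fun k => (w k).2, 0) := rfl

theorem projFam_ev {n : ℕ} (F : Fam 𝕜 Ω (A × V) (A × V) n) (a : ℕ → Ω) (v : ℕ → V) :
    (projFam n F).ev a v = (F.ev a fun k => (0, v k)).1 := rfl

theorem projFam_inclFam {n : ℕ} (θ : Fam 𝕜 Ω V A n) : projFam n (inclFam n θ) = θ :=
  Fam.ext_ev fun _ _ => rfl

/-- The inner value lies in `A`, while the outer family sees only `V`-components. Therefore `𝔞` is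
abelian. -/
theorem circ_inclFam [Semigroup Ω] {m n : ℕ} (i : Fin (m + 1)) (θ : Fam 𝕜 Ω V A m)
    (θ' : Fam 𝕜 Ω V A n) : circ i (inclFam m θ) (inclFam n θ') = 0 := by
  refine Fam.ext_ev fun a w => ?_
  rw [circ_ev, inclFam_ev, inclFam_ev, Fam.ev_eq_zero θ (Nat.le_of_lt_succ i.2)]
  · rfl
  · rw [contrSeq_self]

/-- On inputs from `V` the inner family returns an element of `V`, so the outer one still receives
only inputs from `V`. Thus `ker P` is closed under partial composition. -/
theorem projFam_circ [Semigroup Ω] {m n : ℕ} (i : Fin (m + 1)) (F : Fam 𝕜 Ω (A × V) (A × V) m)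
    (G : Fam 𝕜 Ω (A × V) (A × V) n) (hF : projFam m F = 0) (hG : projFam n G = 0) :
    projFam (m + n) (circ i F G) = 0 := by
  refine Fam.ext_ev fun a v => ?_
  rw [projFam_ev, circ_ev]
  have h1 : (G.ev (shift i a) (shift i fun k => ((0 : A), v k))).1 = 0 := by
    have h2 : (projFam n G).ev (shift i a) (shift i v) = 0 := by
      rw [hG]
      rfl
    rwa [projFam_ev] at h2
  have h3 : contrSeq (i : ℕ) n (G.ev (shift i a) (shift i fun k => ((0 : A), v k)))
      (fun k => ((0 : A), v k)) = fun k => (0, contrSeq (i : ℕ) n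
        (G.ev (shift i a) (shift i fun k => ((0 : A), v k))).2 v k) := by
    funext k
    refine Prod.ext ?_ ?_
    · rw [map_contrSeq Prod.fst, h1]
      simp [contrSeq]
    · rw [map_contrSeq Prod.snd]
  rw [h3, ← projFam_ev, hF]
  rfl

theorem projTot_lof {n : ℕ} (F : Fam 𝕜 Ω (A × V) (A × V) n) :
    projTot (DirectSum.lof 𝕜 ℕ (Fam 𝕜 Ω (A × V) (A × V)) n F) =
      DirectSum.lof 𝕜 ℕ (Fam 𝕜 Ω V A) n (projFam n F) := by
  rw [projTot, DirectSum.lmap_lof]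

theorem inclTot_lof {n : ℕ} (θ : Fam 𝕜 Ω V A n) :
    inclTot (DirectSum.lof 𝕜 ℕ (Fam 𝕜 Ω V A) n θ) =
      DirectSum.lof 𝕜 ℕ (Fam 𝕜 Ω (A × V) (A × V)) n (inclFam n θ) := by
  rw [inclTot, DirectSum.lmap_lof]

theorem projTot_inclTot (η : TotFam 𝕜 Ω V A) : projTot (inclTot η) = η := by
  induction η using DirectSum.induction_on with
  | zero => simp
  | of n θ =>
    rw [← DirectSum.lof_eq_of 𝕜, inclTot_lof, projTot_lof, projFam_inclFam]
  | add x y hx hy => rw [map_add, map_add, hx, hy]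

/-- Arities are positive, so there is an input, here the first, whose `A`-component vanishes. -/
theorem projFam_eq_zero_of_mem {n : ℕ} {F : Fam 𝕜 Ω (A × V) (A × V) n}
    (hF : F ∈ LPrime 𝕜 Ω A V n) : projFam n F = 0 :=
  Fam.ext_ev fun _ _ => (hF _ _).2 ⟨0, rfl⟩

theorem inclTot_projTot_mem {n : ℕ} {u : TotFam 𝕜 Ω (A × V) (A × V)}
    (hu : u ∈ homog 𝕜 Ω (A × V) n) : inclTot (projTot u) ∈ homog 𝕜 Ω (A × V) n := by
  obtain ⟨F, rfl⟩ := hu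
  rw [projTot_lof, inclTot_lof]
  exact lof_mem_homog _

variable [Semigroup Ω]

theorem projTot_insT {m n : ℕ} {u v : TotFam 𝕜 Ω (A × V) (A × V)}
    (hu : u ∈ homog 𝕜 Ω (A × V) m) (hv : v ∈ homog 𝕜 Ω (A × V) n) (hu0 : projTot u = 0)
    (hv0 : projTot v = 0) : projTot (insT u v) = 0 := by
  obtain ⟨F, rfl⟩ := hu
  obtain ⟨G, rfl⟩ := hv
  rw [projTot_lof] at hu0 hv0
  have hF := DirectSum.of_injective (β := Fam 𝕜 Ω V A) m (hu0.trans (map_zero _).symm)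
  have hG := DirectSum.of_injective (β := Fam 𝕜 Ω V A) n (hv0.trans (map_zero _).symm)
  rw [insT_lof_eq_sum, map_sum]
  refine Finset.sum_eq_zero fun i _ => ?_
  rw [map_smul, projTot_lof, projFam_circ i F G hF hG, map_zero, smul_zero]

theorem projTot_gerst_eq_zero {m n : ℕ} {u v : TotFam 𝕜 Ω (A × V) (A × V)}
    (hu : u ∈ homog 𝕜 Ω (A × V) m) (hv : v ∈ homog 𝕜 Ω (A × V) n) (hu0 : projTot u = 0)
    (hv0 : projTot v = 0) : projTot (gerst u v) = 0 := by
  rw [gerst_eq_insT hu hv, map_sub, map_smul, projTot_insT hu hv hu0 hv0,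
    projTot_insT hv hu hv0 hu0, smul_zero, sub_zero]

theorem insT_inclTot (η η' : TotFam 𝕜 Ω V A) : insT (inclTot η) (inclTot η') = 0 := by
  induction η using DirectSum.induction_on with
  | zero => simp
  | of m θ =>
    induction η' using DirectSum.induction_on with
    | zero => simp
    | of n θ' =>
      rw [← DirectSum.lof_eq_of 𝕜, ← DirectSum.lof_eq_of 𝕜, inclTot_lof, inclTot_lof,
        insT_lof_eq_sum]
      refine Finset.sum_eq_zero fun i _ => ?_
      rw [circ_inclFam, map_zero, smul_zero]
    | add x y hx hy => rw [map_add, map_add, hx, hy, add_zero]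
  | add x y hx hy => rw [map_add, map_add, LinearMap.add_apply, hx, hy, add_zero]

theorem gerst_inclTot {m n : ℕ} {η η' : TotFam 𝕜 Ω V A}
    (hu : inclTot η ∈ homog 𝕜 Ω (A × V) m) (hv : inclTot η' ∈ homog 𝕜 Ω (A × V) n) :
    gerst (inclTot η) (inclTot η') = 0 := by
  rw [gerst_eq_insT hu hv, insT_inclTot, insT_inclTot, smul_zero, sub_zero]

/-- The projection `P` satisfies `P[u, v] = P[Pu, v] + P[u, Pv]`. -/
theorem projTot_gerst {m n : ℕ} {u v : TotFam 𝕜 Ω (A × V) (A × V)}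
    (hu : u ∈ homog 𝕜 Ω (A × V) m) (hv : v ∈ homog 𝕜 Ω (A × V) n) :
    projTot (gerst u v) =
      projTot (gerst (inclTot (projTot u)) v) + projTot (gerst u (inclTot (projTot v))) := by
  have hu' := inclTot_projTot_mem hu
  have hv' := inclTot_projTot_mem hv
  have h1 := gerst_inclTot hu' hv'
  -- Both `u - Pu` and `v - Pv` lie in `ker P`, hence so does their bracket. Expanding it and using
  -- `[Pu, Pv] = 0` gives the rule.
  have h2 := projTot_gerst_eq_zero (Submodule.sub_mem _ hu hu') (Submodule.sub_mem _ hv hv')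
    (by rw [map_sub, projTot_inclTot, sub_self]) (by rw [map_sub, projTot_inclTot, sub_self])
  simp only [map_sub, LinearMap.sub_apply, h1, map_zero] at h2
  linear_combination (norm := module) h2

end Pair

/-! ### Compatibility of `f ↦ f̃` with composition and bracket -/

section Tilde

variable {𝕜 Ω : Type*} [Field 𝕜]
variable {A : Type*} [AddCommGroup A] [Module 𝕜 A]

/-- By multilinearity `f(a + v)` is the sum over all subsets of inputs taken from `A`; the full
subset, which is left out of `f̃`, contributes `f(a)`. In the coordinates `(a, a + v)` the family
`f̃` is therefore `f × f`. -/
theorem tildeFam_apply' (n : ℕ) (f : Fam 𝕜 Ω A A n) (α : Fin (n + 1) → Ω)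
    (w : Fin (n + 1) → A × A) : tildeFam n f α w =
      (f α fun j => (w j).1, (f α fun j => (w j).1 + (w j).2) - f α fun j => (w j).1) := by
  classical
  rw [tildeFam_apply]
  refine Prod.ext rfl ?_
  dsimp only
  have h := (f α).map_add_univ (fun j => (w j).1) (fun j => (w j).2)
  rw [← Finset.add_sum_erase _ _ (Finset.mem_univ (Finset.univ : Finset (Fin (n + 1))))] at h
  have h' : (f α fun j => (w j).1 + (w j).2) =
    f α ((fun j => (w j).1) + fun j => (w j).2) := rfl
  rw [h', h, Finset.piecewise_univ, add_sub_cancel_left]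
  refine Finset.sum_congr ?_ fun I _ => ?_
  · ext I
    simp
  · congr 1

theorem tildeFam_ev {n : ℕ} (f : Fam 𝕜 Ω A A n) (a : ℕ → Ω) (w : ℕ → A × A) :
    (tildeFam n f).ev a w = (f.ev a fun k => (w k).1,
      (f.ev a fun k => (w k).1 + (w k).2) - f.ev a fun k => (w k).1) :=
  tildeFam_apply' n f _ _

/-- The map `f ↦ f̃` on the total space. -/
def tildeTot : TotFam 𝕜 Ω A A →ₗ[𝕜] TotFam 𝕜 Ω (A × A) (A × A) := DirectSum.lmap tildeFam

theorem tildeTot_lof {n : ℕ} (f : Fam 𝕜 Ω A A n) :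
    tildeTot (DirectSum.lof 𝕜 ℕ (Fam 𝕜 Ω A A) n f) =
      DirectSum.lof 𝕜 ℕ (Fam 𝕜 Ω (A × A) (A × A)) n (tildeFam n f) := by
  rw [tildeTot, DirectSum.lmap_lof]

variable [Semigroup Ω]

/-- Both `(a, v) ↦ a` and `(a, v) ↦ a + v` carry `f̃` to `f` and are compatible with contraction of
inputs; the two coordinates together determine the value. -/
theorem tildeFam_circ {m n : ℕ} (i : Fin (m + 1)) (f : Fam 𝕜 Ω A A m) (g : Fam 𝕜 Ω A A n) :
    tildeFam (m + n) (circ i f g) = circ i (tildeFam m f) (tildeFam n g) := by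
  refine Fam.ext_ev fun a w => ?_
  rw [circ_ev, tildeFam_ev, tildeFam_ev, tildeFam_ev, circ_ev, circ_ev]
  have h1 : ∀ y : A × A, (fun k => (contrSeq (i : ℕ) n y w k).1) =
      contrSeq (i : ℕ) n y.1 fun k => (w k).1 := fun y =>
    funext fun k => map_contrSeq Prod.fst _ _ _ _ _
  have h2 : ∀ y : A × A, (fun k => (contrSeq (i : ℕ) n y w k).1 + (contrSeq (i : ℕ) n y w k).2) =
      contrSeq (i : ℕ) n (y.1 + y.2) fun k => (w k).1 + (w k).2 := fun y =>
    funext fun k => map_contrSeq (fun y : A × A => y.1 + y.2) _ _ _ _ _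
  rw [h1, h2]
  dsimp only
  rw [add_sub_cancel]
  rfl

theorem insT_tildeTot (m n : ℕ) (f : Fam 𝕜 Ω A A m) (g : Fam 𝕜 Ω A A n) :
    insT (tildeTot (DirectSum.lof 𝕜 ℕ (Fam 𝕜 Ω A A) m f))
        (tildeTot (DirectSum.lof 𝕜 ℕ (Fam 𝕜 Ω A A) n g)) =
      tildeTot (insT (DirectSum.lof 𝕜 ℕ (Fam 𝕜 Ω A A) m f)
        (DirectSum.lof 𝕜 ℕ (Fam 𝕜 Ω A A) n g)) := by
  rw [tildeTot_lof, tildeTot_lof, insT_lof_eq_sum, insT_lof_eq_sum, map_sum]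
  refine Finset.sum_congr rfl fun i _ => ?_
  rw [map_smul, tildeTot_lof, tildeFam_circ]

theorem gerst_tildeTot (u v : TotFam 𝕜 Ω A A) :
    gerst (tildeTot u) (tildeTot v) = tildeTot (gerst u v) := by
  induction u using DirectSum.induction_on with
  | zero => simp
  | of m f =>
    induction v using DirectSum.induction_on with
    | zero => simp
    | of n g =>
      rw [← DirectSum.lof_eq_of 𝕜, ← DirectSum.lof_eq_of 𝕜,
        gerst_eq_insT (lof_mem_homog f) (lof_mem_homog g), map_sub, map_smul,
        ← insT_tildeTot, ← insT_tildeTot, tildeTot_lof, tildeTot_lof,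
        gerst_eq_insT (lof_mem_homog _) (lof_mem_homog _)]
    | add x y hx hy => rw [map_add, map_add, hx, hy, map_add, map_add]
  | add x y hx hy =>
    rw [map_add, map_add, LinearMap.add_apply, hx, hy, map_add, LinearMap.add_apply, map_add]

end Tilde

/-! ### Iterated operations indexed by finite sets -/

section Fold

theorem sort_union_of_lt {ι : Type*} [LinearOrder ι] {S T : Finset ι}
    (h : ∀ a ∈ S, ∀ b ∈ T, a < b) : (S ∪ T).sort = S.sort ++ T.sort := by
  have hnd : (S.sort ++ T.sort).Nodup := by
    refine List.nodup_append.2 ⟨S.sort_nodup _, T.sort_nodup _, ?_⟩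
    intro a ha b hb
    exact (h a ((Finset.mem_sort _).1 ha) b ((Finset.mem_sort _).1 hb)).ne
  have := (List.toFinset_sort (r := fun a b : ι => a ≤ b) hnd).2 (List.pairwise_append.2
    ⟨S.pairwise_sort _, T.pairwise_sort _, fun a ha b hb =>
      (h a ((Finset.mem_sort _).1 ha) b ((Finset.mem_sort _).1 hb)).le⟩)
  rwa [List.toFinset_append, Finset.sort_toFinset, Finset.sort_toFinset] at this

theorem sort_insert_max {ι : Type*} [LinearOrder ι] {S : Finset ι} {a : ι} (h : ∀ i ∈ S, i < a) :
    (insert a S).sort = S.sort ++ [a] := by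
  have := sort_union_of_lt (S := S) (T := {a}) fun i hi b hb => by
    rw [Finset.mem_singleton.1 hb]
    exact h i hi
  rwa [Finset.sort_singleton, Finset.union_comm, ← Finset.insert_eq] at this

variable {𝕜 X : Type*} [Field 𝕜] [AddCommGroup X] [Module 𝕜 X] {ι : Type*} [LinearOrder ι]

/-- The left-nested iterated operation along a finite subset of a linear order. -/
def foldS (b : X →ₗ[𝕜] X →ₗ[𝕜] X) (u : X) (x : ι → X) (U : Finset ι) : X :=
  (U.sort.map x).foldl (fun v y => b v y) u

@[simp] theorem foldS_empty (b : X →ₗ[𝕜] X →ₗ[𝕜] X) (u : X) (x : ι → X) :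
    foldS b u x ∅ = u := by
  simp [foldS]

/-- Splitting off the last operation in this form makes `Finset.induction_on_max` the induction for
all iterated operations. -/
theorem foldS_insert_max (b : X →ₗ[𝕜] X →ₗ[𝕜] X) (u : X) (x : ι → X) {U : Finset ι} {a : ι}
    (h : ∀ i ∈ U, i < a) : foldS b u x (insert a U) = b (foldS b u x U) (x a) := by
  rw [foldS, sort_insert_max h, List.map_append, List.foldl_append]
  rfl

end Fold

/-! ### Iterated brackets and iterated insertions -/

section Nest

variable {𝕜 Ω : Type*} [Field 𝕜] [Semigroup Ω]
variable {W : Type*} [AddCommGroup W] [Module 𝕜 W] {ι : Type*} [LinearOrder ι]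

theorem foldS_insT_mem {n : ℕ} {u : TotFam 𝕜 Ω W W} (hu : u ∈ homog 𝕜 Ω W n) {p : ι → ℕ}
    {x : ι → TotFam 𝕜 Ω W W} (hx : ∀ i, x i ∈ homog 𝕜 Ω W (p i)) (U : Finset ι) :
    foldS insT u x U ∈ homog 𝕜 Ω W (n + ∑ i ∈ U, p i) := by
  induction U using Finset.induction_on_max with
  | empty => simpa using hu
  | insert a U h ih =>
    rw [foldS_insert_max _ _ _ h, Finset.sum_insert fun ha => lt_irrefl a (h a ha),
      add_comm (p a), ← add_assoc]
    exact insT_mem_homog ih (hx a)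

theorem foldS_gerst_mem {n : ℕ} {u : TotFam 𝕜 Ω W W} (hu : u ∈ homog 𝕜 Ω W n) {p : ι → ℕ}
    {x : ι → TotFam 𝕜 Ω W W} (hx : ∀ i, x i ∈ homog 𝕜 Ω W (p i)) (U : Finset ι) :
    foldS gerst u x U ∈ homog 𝕜 Ω W (n + ∑ i ∈ U, p i) := by
  induction U using Finset.induction_on_max with
  | empty => simpa using hu
  | insert a U h ih =>
    rw [foldS_insert_max _ _ _ h, Finset.sum_insert fun ha => lt_irrefl a (h a ha),
      add_comm (p a), ← add_assoc]
    exact gerst_mem_homog ih (hx a)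

/-- The iterated bracket `[⋯[u, x₁], ⋯, x_k]` in terms of iterated insertions. -/
theorem foldS_gerst_eq {n : ℕ} {u : TotFam 𝕜 Ω W W} (hu : u ∈ homog 𝕜 Ω W n) {p : ι → ℕ}
    {x : ι → TotFam 𝕜 Ω W W} (hx : ∀ i, x i ∈ homog 𝕜 Ω W (p i))
    (h0 : ∀ i j, insT (x i) (x j) = 0) (h1 : ∀ i j v, insT (x i) (insT (x j) v) = 0)
    (U : Finset ι) :
    foldS gerst u x U = foldS insT u x U -
      ∑ j ∈ U, ksgn 𝕜 (p j * (n + ∑ i ∈ U with i < j, (p i : ZMod 2))) •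
        insT (x j) (foldS insT u x (U.erase j)) := by
  induction U using Finset.induction_on_max with
  | empty => simp
  | insert a U h ih =>
    have ha : a ∉ U := fun ha => lt_irrefl a (h a ha)
    have hN := foldS_gerst_mem hu hx U
    rw [foldS_insert_max _ _ _ h, foldS_insert_max _ _ _ h, gerst_eq_insT hN (hx a), ih,
      Finset.sum_insert ha, Finset.erase_insert ha]
    have e1 : (insert a U).filter (· < a) = U := by
      ext i
      simp only [Finset.mem_filter, Finset.mem_insert]
      constructor
      · rintro ⟨rfl | hi, hlt⟩
        · exact absurd hlt (lt_irrefl _)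
        · exact hi
      · exact fun hi => ⟨Or.inr hi, h i hi⟩
    have e2 : ∀ j ∈ U, (insert a U).filter (· < j) = U.filter (· < j) := fun j hj => by
      rw [Finset.filter_insert, if_neg (h j hj).not_gt]
    -- In the pre-Lie identity for `x j`, the inner composite and `x a`, the whole right side
    -- vanishes by `h0` and `h1`. Inserting `x a` last is therefore the same as inserting it into
    -- the inner composite.
    have e3 : ∀ j ∈ U, insT (insT (x j) (foldS insT u x (U.erase j))) (x a) =
        insT (x j) (foldS insT u x ((insert a U).erase j)) := by
      intro j hj
      have hR := foldS_insT_mem hu hx (U.erase j)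
      have hp := insT_preLie (hx j) hR (hx a)
      rw [h0, h1, map_zero, LinearMap.zero_apply, sub_zero, smul_zero, sub_eq_zero] at hp
      rw [hp, Finset.erase_insert_of_ne (h j hj).ne', foldS_insert_max]
      exact fun i hi => h i (Finset.mem_of_mem_erase hi)
    rw [e1]
    -- In the new term with `x a` outermost only the pure insertion part of the shorter bracket
    -- survives: `h1` kills the summands that already have some `x j` outermost.
    simp only [map_sub, map_sum, map_smul, LinearMap.sub_apply, LinearMap.sum_apply,
      LinearMap.smul_apply, h1, smul_zero, Finset.sum_const_zero, sub_zero]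
    have e4 : ∑ j ∈ U, ksgn 𝕜 (p j * (n + ∑ i ∈ insert a U with i < j, (p i : ZMod 2))) •
          insT (x j) (foldS insT u x ((insert a U).erase j)) =
        ∑ j ∈ U, ksgn 𝕜 (p j * (n + ∑ i ∈ U with i < j, (p i : ZMod 2))) •
          insT (insT (x j) (foldS insT u x (U.erase j))) (x a) :=
      Finset.sum_congr rfl fun j hj => by rw [e2 j hj, e3 j hj]
    rw [e4]
    push_cast
    rw [mul_comm (p a : ZMod 2)]
    abel

/-! ### Iterated insertions as a sum over colourings -/

/-- The family put into an input with a given colour. -/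
def colFam (s : ι → HFam 𝕜 Ω W W) : Option ι → HFam 𝕜 Ω W W
  | none => idH 𝕜 Ω W
  | some i => s i

/-- The colourings of the inputs that use each element of `U` exactly once. -/
def IsColouring {N : ℕ} (U : Finset ι) (G : Fin (N + 1) → Option ι) : Prop :=
  (∀ i ∈ U, ∃ c, G c = some i) ∧ (∀ c i, G c = some i → i ∈ U) ∧
    ∀ c c' i, G c = some i → G c' = some i → c = c'

/-- The degree of a colour. -/
def colDeg (p : ι → ℕ) : Option ι → ℕ
  | none => 0
  | some i => p i

/-- The contribution of two colours, the first one to the left of the second one, to the sign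
exponent of a colouring. -/
def colPair (p : ι → ℕ) : Option ι → Option ι → ZMod 2
  | some i, some j => if i < j then p i * p j else 0
  | _, _ => 0

theorem colPair_none_left (p : ι → ℕ) (o : Option ι) : colPair p none o = 0 := by
  cases o <;> rfl

theorem colPair_none_right (p : ι → ℕ) (o : Option ι) : colPair p o none = 0 := by
  cases o <;> rfl

/-- The sign exponent of a colouring. -/
def colExp {N : ℕ} (p : ι → ℕ) (G : Fin (N + 1) → Option ι) : ZMod 2 :=
  ∑ c : Fin (N + 1), ((c : ℕ) * colDeg p (G c) +
    ∑ c' : Fin (N + 1) with c' < c, colPair p (G c') (G c))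

/-- The new colour is the largest, so it forms contributing pairs exactly with the colours to its
left. The exponent grows by `p a` times the parity of the number of inputs in front of the new
block, which is the sign of the insertion. -/
theorem colExp_update {N : ℕ} (p : ι → ℕ) (G : Fin (N + 1) → Option ι) (c : Fin (N + 1)) (a : ι)
    (hc : G c = none) (ha : ∀ c' i, G c' = some i → i < a) :
    colExp p (Function.update G c (some a)) = colExp p G +
      ((c : ℕ) + ∑ c' : Fin (N + 1) with c' < c, (colDeg p (G c') : ZMod 2)) * p a := by
  unfold colExp
  rw [← Finset.add_sum_erase _ _ (Finset.mem_univ c),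
    ← Finset.add_sum_erase Finset.univ (fun c : Fin (N + 1) => (((c : ℕ) * colDeg p (G c) +
    ∑ c' : Fin (N + 1) with c' < c, colPair p (G c') (G c)) : ZMod 2)) (Finset.mem_univ c)]
  have h1 : ∀ c' ∈ Finset.univ.filter (· < c),
      colPair p (Function.update G c (some a) c') (some a) = colDeg p (G c') * p a := by
    intro c' hc'
    rw [Function.update_of_ne (Finset.mem_filter.1 hc').2.ne]
    rcases h : G c' with _ | i
    · simp [colPair, colDeg]
    · simp [colPair, colDeg, ha c' i h]
  have h2 : ∀ d ∈ Finset.univ.erase c,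
      ((d : ℕ) * colDeg p (Function.update G c (some a) d) +
        ∑ c' : Fin (N + 1) with c' < d, colPair p (Function.update G c (some a) c')
          (Function.update G c (some a) d) : ZMod 2) =
      (d : ℕ) * colDeg p (G d) + ∑ c' : Fin (N + 1) with c' < d, colPair p (G c') (G d) := by
    intro d hd
    rw [Function.update_of_ne (Finset.ne_of_mem_erase hd)]
    congr 1
    refine Finset.sum_congr rfl fun c' _ => ?_
    by_cases hcc : c' = c
    · subst hcc
      rw [Function.update_self, hc, colPair_none_left]
      rcases h : G d with _ | i
      · rfl
      · exact if_neg (ha d i h).not_gt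
    · rw [Function.update_of_ne hcc]
  rw [Finset.sum_congr rfl h2, Function.update_self, Finset.sum_congr rfl h1, hc,
    ← Finset.sum_mul]
  simp only [colPair_none_right, Finset.sum_const_zero, colDeg, Nat.cast_zero, mul_zero, add_zero,
    zero_add]
  ring

theorem fullTot_eq_zero {N : ℕ} (f : Fam 𝕜 Ω W W N) (G : Fin (N + 1) → HFam 𝕜 Ω W W)
    (j : Fin (N + 1)) (h : (G j).2 = 0) : fullTot f G = 0 := by
  have : fullComp f G = 0 := by
    refine Fam.ext_ev fun a w => ?_
    rw [fullComp_ev]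
    exact (f _).map_coord_zero j (by rw [h]; rfl)
  rw [fullTot, this, map_zero]

theorem blockOffset_colFam {N : ℕ} (s : ι → HFam 𝕜 Ω W W) (G : Fin (N + 1) → Option ι)
    (c : Fin (N + 1)) : ((blockOffset (fun c => (colFam s (G c)).1) c : ℕ) : ZMod 2) =
      (c : ℕ) + ∑ c' : Fin (N + 1) with c' < c, (colDeg (fun i => (s i).1) (G c') : ZMod 2) := by
  have h0 : Finset.univ.filter (· < c) = Finset.Iio c := by
    ext k
    simp
  unfold blockOffset
  rw [Finset.sum_add_distrib, add_comm]
  push_cast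
  congr 1
  · simp [h0]
  · refine Finset.sum_congr rfl fun c' _ => ?_
    rcases G c' with _ | i <;> rfl

/-- Insertion into an occupied block vanishes by `h0`, and a free block is an identity with a single
input, so only the free inputs contribute, each once. -/
theorem insT_fullTot_colFam {N : ℕ} (f : Fam 𝕜 Ω W W N) (s : ι → HFam 𝕜 Ω W W)
    (h0 : ∀ i j b, circ b (s i).2 (s j).2 = 0) (G : Fin (N + 1) → Option ι) (a : ι) :
    insT (fullTot f fun c => colFam s (G c)) (s a).tot =
      ∑ c with G c = none, ksgn 𝕜 (((c : ℕ) + ∑ c' : Fin (N + 1) with c' < c,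
          (colDeg (fun i => (s i).1) (G c') : ZMod 2)) * (s a).1) •
        fullTot f fun c' => colFam s (Function.update G c (some a) c') := by
  rw [HFam.tot, insT_fullComp, Finset.sum_filter]
  refine Finset.sum_congr rfl fun c _ => ?_
  have hup : (fun c' => colFam s (Function.update G c (some a) c')) =
      Function.update (fun c' => colFam s (G c')) c (s a) := by
    funext c'
    exact Function.apply_update (fun _ o => colFam s o) G c (some a) c'
  rw [hup]
  split_ifs with hc
  · rw [hc]
    have h1 : ∀ b : Fin ((colFam s none).1 + 1), (b : ℕ) = 0 := fun b => Fin.val_eq_zero b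
    have h2 : ∀ b : Fin ((colFam s none).1 + 1),
        (⟨_, circ b (colFam s none).2 (s a).2⟩ : HFam 𝕜 Ω W W) = s a :=
      fun b => circ_idFam b (s a).2
    simp only [h1, h2, add_zero, blockOffset_colFam]
    have h3 : (Finset.univ : Finset (Fin ((colFam s none).1 + 1))).card = 1 := rfl
    rw [Finset.sum_const, h3, one_smul]
  · obtain ⟨i, hi⟩ := Option.ne_none_iff_exists'.1 hc
    refine Finset.sum_eq_zero fun b _ => ?_
    rw [fullTot_eq_zero _ _ c, smul_zero]
    rw [Function.update_self]
    revert b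
    rw [hi]
    exact fun b _ => h0 i a b

theorem fullTot_idH {N : ℕ} (f : Fam 𝕜 Ω W W N) :
    fullTot f (fun _ => idH 𝕜 Ω W) = DirectSum.lof 𝕜 ℕ (Fam 𝕜 Ω W W) N f := by
  refine lof_eq_of_ev ?_ fun a w => ?_
  · simp [idH]
  · rw [fullComp_ev]
    have : ∀ c : Fin (N + 1), blockOffset (fun _ : Fin (N + 1) => (idH 𝕜 Ω W).1) c = c := by
      intro c
      have h := blockOffset_single c 0 c
      simpa [idH] using h
    simp only [this]
    unfold Fam.ev
    congr 1

open Classical in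
/-- Iterated insertions as a sum over colourings. -/
theorem foldS_insT_eq_sum [Fintype ι] {N : ℕ} (f : Fam 𝕜 Ω W W N) (s : ι → HFam 𝕜 Ω W W)
    (h0 : ∀ i j b, circ b (s i).2 (s j).2 = 0) (U : Finset ι) :
    foldS insT (DirectSum.lof 𝕜 ℕ (Fam 𝕜 Ω W W) N f) (fun i => (s i).tot) U =
      ∑ G : Fin (N + 1) → Option ι with IsColouring U G,
        ksgn 𝕜 (colExp (fun i => (s i).1) G) • fullTot f fun c => colFam s (G c) := by
  induction U using Finset.induction_on_max with
  | empty =>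
    have : Finset.univ.filter (IsColouring (N := N) (∅ : Finset ι)) = {fun _ => none} := by
      ext G
      simp only [Finset.mem_filter, Finset.mem_univ, true_and, Finset.mem_singleton]
      constructor
      · intro h
        funext c
        rcases hc : G c with _ | i
        · rfl
        · exact absurd (h.2.1 c i hc) (Finset.notMem_empty i)
      · rintro rfl
        exact ⟨by simp, by simp, by simp⟩
    rw [foldS_empty, this, Finset.sum_singleton]
    have h1 : colExp (fun i => (s i).1) (fun _ : Fin (N + 1) => (none : Option ι)) = 0 := by
      simp [colExp, colPair_none_left, colDeg]
    rw [h1, ksgn_zero, one_smul]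
    exact (fullTot_idH f).symm
  | insert a U h ih =>
    rw [foldS_insert_max _ _ _ h, ih, map_sum, LinearMap.sum_apply]
    simp only [map_smul, LinearMap.smul_apply, insT_fullTot_colFam f s h0, Finset.smul_sum]
    rw [Finset.sum_sigma']
    have hlt : ∀ G : Fin (N + 1) → Option ι, IsColouring U G → ∀ c' i, G c' = some i → i < a :=
      fun G hG c' i hi => h i (hG.2.1 c' i hi)
    -- A colouring by `insert a U` is a colouring by `U` together with a free input that receives
    -- `a`; removing `a` inverts this.
    refine Finset.sum_bij (fun x _ => Function.update x.1 x.2 (some a)) ?_ ?_ ?_ ?_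
    · rintro ⟨G, c⟩ hx
      simp only [Finset.mem_sigma, Finset.mem_filter, Finset.mem_univ, true_and] at hx ⊢
      obtain ⟨hG, hc⟩ := hx
      refine ⟨fun i hi => ?_, fun c' i hi => ?_, fun c' c'' i h1 h2 => ?_⟩
      · rcases Finset.mem_insert.1 hi with rfl | hi
        · exact ⟨c, Function.update_self _ _ _⟩
        · obtain ⟨c', hc'⟩ := hG.1 i hi
          refine ⟨c', ?_⟩
          rw [Function.update_of_ne, hc']
          rintro rfl
          rw [hc] at hc'
          cases hc'
      · by_cases hcc : c' = c
        · subst hcc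
          rw [Function.update_self] at hi
          cases hi
          exact Finset.mem_insert_self _ _
        · rw [Function.update_of_ne hcc] at hi
          exact Finset.mem_insert_of_mem (hG.2.1 c' i hi)
      · have aux : ∀ d, Function.update G c (some a) d = some i → (d = c ∧ i = a) ∨
            (G d = some i ∧ i ≠ a) := by
          intro d hd
          by_cases hdc : d = c
          · subst hdc
            rw [Function.update_self] at hd
            cases hd
            exact Or.inl ⟨rfl, rfl⟩
          · rw [Function.update_of_ne hdc] at hd
            exact Or.inr ⟨hd, (hlt G hG d i hd).ne⟩
        rcases aux c' h1 with ⟨h3, h4⟩ | ⟨h3, h4⟩ <;> rcases aux c'' h2 with ⟨h5, h6⟩ | ⟨h5, h6⟩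
        · rw [h3, h5]
        · exact absurd h4 h6
        · exact absurd h6 h4
        · exact hG.2.2 c' c'' i h3 h5
    · rintro ⟨G, c⟩ hx ⟨G', c'⟩ hx' heq
      simp only [Finset.mem_sigma, Finset.mem_filter, Finset.mem_univ, true_and] at hx hx'
      obtain ⟨hG, hc⟩ := hx
      obtain ⟨hG', hc'⟩ := hx'
      dsimp only at heq
      have hcc : c = c' := by
        by_contra hne
        have := congrFun heq c
        rw [Function.update_self, Function.update_of_ne hne] at this
        exact lt_irrefl a (hlt G' hG' c a this.symm)
      subst hcc
      have hGG : G = G' := by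
        funext d
        by_cases hd : d = c
        · rw [hd, hc, hc']
        · have := congrFun heq d
          rwa [Function.update_of_ne hd, Function.update_of_ne hd] at this
      rw [hGG]
    · intro G hG
      simp only [Finset.mem_filter, Finset.mem_univ, true_and] at hG
      obtain ⟨c, hc⟩ := hG.1 a (Finset.mem_insert_self _ _)
      refine ⟨⟨Function.update G c none, c⟩, ?_, ?_⟩
      · simp only [Finset.mem_sigma, Finset.mem_filter, Finset.mem_univ, true_and]
        refine ⟨⟨fun i hi => ?_, fun c' i hi => ?_, fun c' c'' i h1 h2 => ?_⟩,
          Function.update_self _ _ _⟩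
        · obtain ⟨c', hc'⟩ := hG.1 i (Finset.mem_insert_of_mem hi)
          refine ⟨c', ?_⟩
          rw [Function.update_of_ne, hc']
          rintro rfl
          rw [hc] at hc'
          cases hc'
          exact lt_irrefl a (h a hi)
        · by_cases hcc : c' = c
          · rw [hcc, Function.update_self] at hi
            cases hi
          · rw [Function.update_of_ne hcc] at hi
            rcases Finset.mem_insert.1 (hG.2.1 c' i hi) with rfl | h3
            · exact absurd (hG.2.2 _ _ _ hi hc) hcc
            · exact h3
        · have aux : ∀ d, Function.update G c none d = some i → G d = some i := by
            intro d hd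
            by_cases hdc : d = c
            · rw [hdc, Function.update_self] at hd
              cases hd
            · rwa [Function.update_of_ne hdc] at hd
          exact hG.2.2 _ _ _ (aux _ h1) (aux _ h2)
      · simp only [Function.update_idem]
        rw [← hc, Function.update_eq_self]
    · rintro ⟨G, c⟩ hx
      simp only [Finset.mem_sigma, Finset.mem_filter, Finset.mem_univ, true_and] at hx
      obtain ⟨hG, hc⟩ := hx
      rw [colExp_update _ _ _ _ hc (hlt G hG), ksgn_add, smul_smul]

end Nest

/-! ### The projection of iterated brackets with elements of `𝔞` -/

section Proj

variable {𝕜 Ω : Type*} [Field 𝕜] [Semigroup Ω]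
variable {A V : Type*} [AddCommGroup A] [Module 𝕜 A] [AddCommGroup V] [Module 𝕜 V]
variable {ι : Type*}

/-- The inclusion of `𝔞` on homogeneous families. -/
def inclH (θ : HFam 𝕜 Ω V A) : HFam 𝕜 Ω (A × V) (A × V) := ⟨θ.1, inclFam θ.1 θ.2⟩

theorem inclH_tot (θ : HFam 𝕜 Ω V A) : (inclH θ).tot = inclTot θ.tot := (inclTot_lof θ.2).symm

theorem inclH_tot_mem (θ : HFam 𝕜 Ω V A) : inclTot θ.tot ∈ homog 𝕜 Ω (A × V) θ.1 := by
  rw [← inclH_tot]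
  exact lof_mem_homog _

theorem colFam_inclH_ev_none (θ : ι → HFam 𝕜 Ω V A) {o : Option ι} (ho : o = none) (a : ℕ → Ω)
    (v : ℕ → V) : (colFam (fun i => inclH (θ i)) o).2.ev a (fun k => (0, v k)) = (0, v 0) := by
  subst ho
  rfl

theorem colFam_inclH_ev_some (θ : ι → HFam 𝕜 Ω V A) {o : Option ι} (ho : o ≠ none) (a : ℕ → Ω)
    (w : ℕ → A × V) : ((colFam (fun i => inclH (θ i)) o).2.ev a w).2 = 0 := by
  obtain ⟨i, rfl⟩ := Option.ne_none_iff_exists'.1 ho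
  rfl

/-- When all outer inputs come from `V`, a free input hands an element of `V` to `F ∈ 𝔏'`; the value
then lies in `V` and has no `A`-component. -/
theorem projTot_fullTot_eq_zero {N : ℕ} {F : Fam 𝕜 Ω (A × V) (A × V) N}
    (hF : F ∈ LPrime 𝕜 Ω A V N) (θ : ι → HFam 𝕜 Ω V A) (G : Fin (N + 1) → Option ι)
    (hG : ∃ c, G c = none) :
    projTot (fullTot F fun c => colFam (fun i => inclH (θ i)) (G c)) = 0 := by
  obtain ⟨c, hc⟩ := hG
  have : projFam _ (fullComp F fun c => colFam (fun i => inclH (θ i)) (G c)) = 0 := by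
    refine Fam.ext_ev fun a v => ?_
    rw [projFam_ev, fullComp_ev]
    exact (hF _ _).2 ⟨c, congrArg Prod.fst (colFam_inclH_ev_none θ hc _ (shift _ v))⟩
  rw [fullTot, projTot_lof, this, map_zero]

theorem circ_inclFam_eq_zero {m n : ℕ} (r : Fin (m + 1)) (θ : Fam 𝕜 Ω V A m)
    (F : Fam 𝕜 Ω (A × V) (A × V) n) (hF : ∀ a w, (F.ev a w).2 = 0) :
    circ r (inclFam m θ) F = 0 := by
  refine Fam.ext_ev fun a w => ?_
  rw [circ_ev, inclFam_ev, Fam.ev_eq_zero θ (Nat.le_of_lt_succ r.2)]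
  · rfl
  · rw [contrSeq_self, hF]

/-- The inner composite has values in `A`, which the outer element of `𝔞` annihilates. -/
theorem insT_inclTot_insT (η η' : TotFam 𝕜 Ω V A) (u : TotFam 𝕜 Ω (A × V) (A × V)) :
    insT (inclTot η) (insT (inclTot η') u) = 0 := by
  induction η using DirectSum.induction_on with
  | zero => simp
  | add x y hx hy => rw [map_add, map_add, LinearMap.add_apply, hx, hy, add_zero]
  | of m θ =>
    induction η' using DirectSum.induction_on with
    | zero => simp
    | add x y hx hy =>
      rw [map_add, map_add, LinearMap.add_apply, map_add, hx, hy, add_zero]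
    | of n θ' =>
      induction u using DirectSum.induction_on with
      | zero => simp
      | add x y hx hy => rw [map_add, map_add, hx, hy, add_zero]
      | of l F =>
        rw [← DirectSum.lof_eq_of 𝕜, ← DirectSum.lof_eq_of 𝕜, ← DirectSum.lof_eq_of 𝕜,
          inclTot_lof, inclTot_lof, insT_lof_eq_sum n, map_sum]
        refine Finset.sum_eq_zero fun i _ => ?_
        rw [map_smul, insT_lof_eq_sum, Finset.sum_eq_zero, smul_zero]
        intro r _
        rw [circ_inclFam_eq_zero, map_zero, smul_zero]
        intro a w
        rw [circ_ev, inclFam_ev]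

/-- With every input of `F ∈ 𝔏'` occupied by an element of `𝔞`, all its arguments lie in `A`; so
does its value, and `η` annihilates it even before projection. -/
theorem projTot_insT_fullTot_eq_zero {N : ℕ} {F : Fam 𝕜 Ω (A × V) (A × V) N}
    (hF : F ∈ LPrime 𝕜 Ω A V N) (θ : ι → HFam 𝕜 Ω V A) (η : HFam 𝕜 Ω V A)
    (G : Fin (N + 1) → Option ι) (hG : ∀ c, G c ≠ none) :
    insT (inclTot η.tot) (fullTot F fun c => colFam (fun i => inclH (θ i)) (G c)) = 0 := by
  rw [HFam.tot, inclTot_lof, fullTot, insT_lof_eq_sum]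
  refine Finset.sum_eq_zero fun r _ => ?_
  rw [circ_inclFam_eq_zero, map_zero, smul_zero]
  intro a w
  rw [fullComp_ev]
  exact (hF _ _).1 fun c => colFam_inclH_ev_some θ (hG c) _ _

variable [LinearOrder ι]

theorem circ_inclH (θ : ι → HFam 𝕜 Ω V A) (i j : ι) (b) :
    circ b (inclH (θ i)).2 (inclH (θ j)).2 = 0 := circ_inclFam b _ _

theorem foldS_gerst_inclTot {n : ℕ} {u : TotFam 𝕜 Ω (A × V) (A × V)}
    (hu : u ∈ homog 𝕜 Ω (A × V) n) (θ : ι → HFam 𝕜 Ω V A) (U : Finset ι) :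
    foldS gerst u (fun i => inclTot (θ i).tot) U =
      foldS insT u (fun i => inclTot (θ i).tot) U -
      ∑ j ∈ U, ksgn 𝕜 ((θ j).1 * (n + ∑ i ∈ U with i < j, ((θ i).1 : ZMod 2))) •
        insT (inclTot (θ j).tot) (foldS insT u (fun i => inclTot (θ i).tot) (U.erase j)) :=
  foldS_gerst_eq hu (fun i => inclH_tot_mem (θ i)) (fun _ _ => insT_inclTot _ _)
    (fun _ _ _ => insT_inclTot_insT _ _ _) U

open Classical in
theorem foldS_insT_inclTot [Fintype ι] {N : ℕ} (F : Fam 𝕜 Ω (A × V) (A × V) N)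
    (θ : ι → HFam 𝕜 Ω V A) (U : Finset ι) :
    foldS insT (DirectSum.lof 𝕜 ℕ (Fam 𝕜 Ω (A × V) (A × V)) N F)
        (fun i => inclTot (θ i).tot) U =
      ∑ G : Fin (N + 1) → Option ι with IsColouring U G,
        ksgn 𝕜 (colExp (fun i => (θ i).1) G) •
          fullTot F fun c => colFam (fun i => inclH (θ i)) (G c) := by
  have := foldS_insT_eq_sum F (fun i => inclH (θ i)) (circ_inclH θ) U
  simp only [inclH_tot] at this
  exact this

theorem IsColouring.card_eq {N : ℕ} {U : Finset ι} {G : Fin (N + 1) → Option ι}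
    (hG : IsColouring U G) : (Finset.univ.filter fun c => G c ≠ none).card = U.card := by
  refine Finset.card_bij (fun c hc => (G c).get
    (Option.isSome_iff_ne_none.2 (Finset.mem_filter.1 hc).2)) ?_ ?_ ?_
  · intro c hc
    exact hG.2.1 c _ (Option.some_get _).symm
  · intro c hc c' hc' h
    have h1 := Option.some_get (Option.isSome_iff_ne_none.2 (Finset.mem_filter.1 hc).2)
    have h2 := Option.some_get (Option.isSome_iff_ne_none.2 (Finset.mem_filter.1 hc').2)
    exact hG.2.2 c c' _ h1.symm (h2.symm.trans (congrArg some h.symm))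
  · intro i hi
    obtain ⟨c, hc⟩ := hG.1 i hi
    refine ⟨c, Finset.mem_filter.2 ⟨Finset.mem_univ _, by simp [hc]⟩, ?_⟩
    simp [hc]

theorem IsColouring.card_le {N : ℕ} {U : Finset ι} {G : Fin (N + 1) → Option ι}
    (hG : IsColouring U G) : U.card ≤ N + 1 := by
  rw [← hG.card_eq]
  exact (Finset.card_le_univ _).trans (by simp)

/-- The occupied inputs are in bijection with `U`, so counting decides whether one is left free.
This separates the two kinds of terms in the explicit formulas. -/
theorem IsColouring.exists_none_iff {N : ℕ} {U : Finset ι} {G : Fin (N + 1) → Option ι}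
    (hG : IsColouring U G) : (∃ c, G c = none) ↔ U.card ≠ N + 1 := by
  rw [← hG.card_eq, ← not_iff_not]
  push Not
  constructor
  · intro h
    rw [Finset.filter_true_of_mem fun c _ => h c]
    simp
  · intro h c
    have : Finset.univ.filter (fun c => G c ≠ none) = Finset.univ := by
      rw [← Finset.card_eq_iff_eq_univ, h]
      simp
    have h3 := Finset.mem_univ c
    rw [← this, Finset.mem_filter] at h3
    exact h3.2

/-- The iterated bracket of `f ∈ 𝔏'(n)` with more than `n` elements of `𝔞` has trivial
projection to `𝔞`. -/
theorem projTot_foldS_gerst_eq_zero [Fintype ι] {N : ℕ} {F : Fam 𝕜 Ω (A × V) (A × V) N}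
    (hF : F ∈ LPrime 𝕜 Ω A V N) (θ : ι → HFam 𝕜 Ω V A) (U : Finset ι) (hU : N + 1 < U.card) :
    projTot (foldS gerst (DirectSum.lof 𝕜 ℕ (Fam 𝕜 Ω (A × V) (A × V)) N F)
      (fun i => inclTot (θ i).tot) U) = 0 := by
  classical
  rw [foldS_gerst_inclTot (lof_mem_homog F)]
  simp only [foldS_insT_inclTot]
  rw [Finset.sum_eq_zero, zero_sub, map_neg, map_sum, neg_eq_zero]
  · refine Finset.sum_eq_zero fun j hj => ?_
    rw [map_smul, map_sum, map_sum]
    refine (congrArg _ (Finset.sum_eq_zero fun G hG => ?_)).trans (smul_zero _)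
    have hG := (Finset.mem_filter.1 hG).2
    -- A colouring by `U.erase j` can exist only if `U` has exactly `N + 2` elements, and then it
    -- leaves no input free.
    rw [map_smul, projTot_insT_fullTot_eq_zero hF, smul_zero, map_zero]
    intro c hc
    have h1 := hG.exists_none_iff.1 ⟨c, hc⟩
    have h2 := hG.card_le
    have h3 := Finset.card_erase_add_one hj
    omega
  · intro G hG
    have := (Finset.mem_filter.1 hG).2.card_le
    omega

end Proj

/-! ### Projected iterated brackets of `f̃` with elements of `𝔞` -/

section Explicit

variable {𝕜 Ω : Type*} [Field 𝕜] [Semigroup Ω]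
variable {A : Type*} [AddCommGroup A] [Module 𝕜 A] {ι : Type*}

theorem blockOffset_colFam_inclH {N : ℕ} (θ : ι → HFam 𝕜 Ω A A) (G : Fin (N + 1) → Option ι) :
    blockOffset (fun c => (colFam (fun i => inclH (θ i)) (G c)).1) =
      blockOffset fun c => (colFam θ (G c)).1 := by
  congr 1
  funext c
  rcases G c with _ | i <;> rfl

theorem sum_colFam_inclH {N : ℕ} (θ : ι → HFam 𝕜 Ω A A) (G : Fin (N + 1) → Option ι) :
    ∑ c, (colFam (fun i => inclH (θ i)) (G c)).1 = ∑ c, (colFam θ (G c)).1 := by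
  refine Finset.sum_congr rfl fun c _ => ?_
  rcases G c with _ | i <;> rfl

theorem colFam_inclH_ev_fst (θ : ι → HFam 𝕜 Ω A A) {o : Option ι} (ho : o ≠ none) (a : ℕ → Ω)
    (v : ℕ → A) : ((colFam (fun i => inclH (θ i)) o).2.ev a (fun k => (0, v k))).1 =
      (colFam θ o).2.ev a v := by
  obtain ⟨i, rfl⟩ := Option.ne_none_iff_exists'.1 ho
  rfl

/-- An identity contributes its value in the `V`-component and an element of `𝔞` in the
`A`-component, so the sum of components, on which the `V`-part of `f̃` depends, treats both alike.
-/
theorem colFam_inclH_ev_add (θ : ι → HFam 𝕜 Ω A A) (o : Option ι) (a : ℕ → Ω) (v : ℕ → A) :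
    ((colFam (fun i => inclH (θ i)) o).2.ev a (fun k => (0, v k))).1 +
      ((colFam (fun i => inclH (θ i)) o).2.ev a (fun k => (0, v k))).2 =
      (colFam θ o).2.ev a v := by
  rcases o with _ | i
  · exact zero_add _
  · exact add_zero _

theorem colFam_inclH_fst (θ : ι → HFam 𝕜 Ω A A) (o : Option ι) :
    (colFam (fun i => inclH (θ i)) o).1 = (colFam θ o).1 := by
  rcases o with _ | i <;> rfl

/-- The `A`-component of `f̃` is `f` of the `A`-components, and with no free input these are the
values of the `θ_i`. -/
theorem projTot_fullTot_tildeFam {N : ℕ} (f : Fam 𝕜 Ω A A N) (θ : ι → HFam 𝕜 Ω A A)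
    (G : Fin (N + 1) → Option ι) (hG : ∀ c, G c ≠ none) :
    projTot (fullTot (tildeFam N f) fun c => colFam (fun i => inclH (θ i)) (G c)) =
      fullTot f fun c => colFam θ (G c) := by
  rw [fullTot, projTot_lof]
  refine lof_eq_of_ev ?_ fun a v => ?_
  · rw [sum_colFam_inclH]
  rw [projFam_ev, fullComp_ev, fullComp_ev, tildeFam_apply', blockOffset_colFam_inclH]
  dsimp only
  congr 1
  · congr 1
    funext c
    rw [colFam_inclH_fst]
  · funext c
    exact colFam_inclH_ev_fst θ (hG c) _ (shift _ v)

/-- The family `η` sees only `f(a + v) - f(a)`, where `a` and `v` are the components handed to `f̃`.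
At a free input `a` is zero, so `f(a)` drops out and the composition with identities at the free
inputs remains. -/
theorem projTot_insT_fullTot_tildeFam {N : ℕ} (f : Fam 𝕜 Ω A A N) (θ : ι → HFam 𝕜 Ω A A)
    (η : HFam 𝕜 Ω A A) (G : Fin (N + 1) → Option ι) (hG : ∃ c, G c = none) :
    projTot (insT (inclTot η.tot)
      (fullTot (tildeFam N f) fun c => colFam (fun i => inclH (θ i)) (G c))) =
      insT η.tot (fullTot f fun c => colFam θ (G c)) := by
  obtain ⟨c₀, hc₀⟩ := hG
  rw [HFam.tot, inclTot_lof, fullTot, fullTot, insT_lof_eq_sum, insT_lof_eq_sum, map_sum]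
  refine Finset.sum_congr rfl fun r _ => ?_
  rw [map_smul, projTot_lof]
  refine congrArg₂ (fun x y => x • y) (by rw [sum_colFam_inclH]) ?_
  refine lof_eq_of_ev (by rw [sum_colFam_inclH]) fun a v => ?_
  rw [projFam_ev, circ_ev, inclFam_ev, circ_ev]
  dsimp only
  have h1 : ((fullComp (tildeFam N f) fun c => colFam (fun i => inclH (θ i)) (G c)).ev
      (shift (r : ℕ) a) (shift (r : ℕ) fun k => ((0 : A), v k))).2 =
      (fullComp f fun c => colFam θ (G c)).ev (shift (r : ℕ) a) (shift (r : ℕ) v) := by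
    rw [fullComp_ev, fullComp_ev, tildeFam_apply', blockOffset_colFam_inclH]
    dsimp only
    refine (congrArg₂ (fun x y => x - y) rfl ((f _).map_coord_zero c₀ (congrArg Prod.fst
      (colFam_inclH_ev_none θ hc₀ _ (shift _ (shift _ v)))))).trans ?_
    rw [sub_zero]
    congr 1
    · congr 1
      funext c
      rw [colFam_inclH_fst]
    · funext c
      exact colFam_inclH_ev_add θ (G c) _ (shift _ (shift _ v))
  refine congrArg₂ _ ?_ ?_
  · rw [sum_colFam_inclH]
  · funext k
    rw [map_contrSeq Prod.snd, h1, sum_colFam_inclH]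

variable [LinearOrder ι]

open Classical in
/-- The projection of the iterated bracket of `f̃` with elements of `𝔞`. -/
theorem projTot_foldS_gerst_tildeFam [Fintype ι] {N : ℕ} (f : Fam 𝕜 Ω A A N)
    (θ : ι → HFam 𝕜 Ω A A) (U : Finset ι) :
    projTot (foldS gerst (DirectSum.lof 𝕜 ℕ (Fam 𝕜 Ω (A × A) (A × A)) N (tildeFam N f))
      (fun i => inclTot (θ i).tot) U) =
    (if U.card = N + 1 then ∑ G : Fin (N + 1) → Option ι with IsColouring U G,
        ksgn 𝕜 (colExp (fun i => (θ i).1) G) • fullTot f fun c => colFam θ (G c) else 0) +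
    if U.card ≤ N + 1 then
      ∑ j ∈ U, ∑ G : Fin (N + 1) → Option ι with IsColouring (U.erase j) G,
        ksgn 𝕜 (1 + (θ j).1 * (N + ∑ i ∈ U with i < j, ((θ i).1 : ZMod 2)) +
          colExp (fun i => (θ i).1) G) • insT (θ j).tot (fullTot f fun c => colFam θ (G c))
    else 0 := by
  rw [foldS_gerst_inclTot (lof_mem_homog _)]
  simp only [foldS_insT_inclTot]
  rw [map_sub, sub_eq_add_neg]
  congr 1
  · rw [map_sum]
    split_ifs with hU
    · refine Finset.sum_congr rfl fun G hG => ?_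
      have hG := (Finset.mem_filter.1 hG).2
      rw [map_smul, projTot_fullTot_tildeFam]
      intro c hc
      exact hG.exists_none_iff.1 ⟨c, hc⟩ hU
    · refine Finset.sum_eq_zero fun G hG => ?_
      have hG := (Finset.mem_filter.1 hG).2
      rw [map_smul, projTot_fullTot_eq_zero (tildeFam_mem N f) _ _ (hG.exists_none_iff.2 hU),
        smul_zero]
  · rw [map_sum, ← Finset.sum_neg_distrib]
    have hcard : ∀ j ∈ U, (U.erase j).card + 1 = U.card := fun j hj =>
      Finset.card_erase_add_one hj
    split_ifs with hU
    · refine Finset.sum_congr rfl fun j hj => ?_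
      rw [map_smul, map_sum, map_sum, Finset.smul_sum, ← Finset.sum_neg_distrib]
      refine Finset.sum_congr rfl fun G hG => ?_
      have hG := (Finset.mem_filter.1 hG).2
      have := hcard j hj
      rw [map_smul, map_smul, projTot_insT_fullTot_tildeFam _ _ _ _
        (hG.exists_none_iff.2 (by omega)), smul_smul, ← neg_smul, add_assoc, ksgn_add, ksgn_one,
        ksgn_add, neg_one_mul]
    · refine Finset.sum_eq_zero fun j hj => ?_
      rw [map_smul, map_sum, map_sum, neg_eq_zero]
      refine (congrArg _ (Finset.sum_eq_zero fun G hG => ?_)).trans (smul_zero _)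
      have hG := (Finset.mem_filter.1 hG).2
      have := hcard j hj
      have h2 := hG.card_le
      rw [map_smul, map_smul, projTot_insT_fullTot_eq_zero (tildeFam_mem N f), map_zero, smul_zero]
      intro c hc
      exact hG.exists_none_iff.1 ⟨c, hc⟩ (by omega)

end Explicit

/-! ### Evaluation of the modified brackets -/

section FoldLemmas

variable {𝕜 X : Type*} [Field 𝕜] [AddCommGroup X] [Module 𝕜 X] {ι κ : Type*} [LinearOrder ι]
  [LinearOrder κ]

theorem foldS_union_of_lt (b : X →ₗ[𝕜] X →ₗ[𝕜] X) (u : X) (x : ι → X) {S T : Finset ι}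
    (h : ∀ i ∈ S, ∀ j ∈ T, i < j) : foldS b u x (S ∪ T) = foldS b (foldS b u x S) x T := by
  rw [foldS, sort_union_of_lt h, List.map_append, List.foldl_append]
  rfl

theorem foldS_singleton (b : X →ₗ[𝕜] X →ₗ[𝕜] X) (u : X) (x : ι → X) (a : ι) :
    foldS b u x {a} = b u (x a) := by
  simp [foldS]

theorem foldS_insert_min (b : X →ₗ[𝕜] X →ₗ[𝕜] X) (u : X) (x : ι → X) {U : Finset ι} {a : ι}
    (h : ∀ i ∈ U, a < i) : foldS b u x (insert a U) = foldS b (b u (x a)) x U := by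
  rw [Finset.insert_eq, foldS_union_of_lt, foldS_singleton]
  intro i hi j hj
  rw [Finset.mem_singleton.1 hi]
  exact h j hj

theorem foldS_image (b : X →ₗ[𝕜] X →ₗ[𝕜] X) (u : X) (x : ι → X) (e : κ → ι) (U : Finset κ)
    (he : StrictMonoOn e U) : foldS b u x (U.image e) = foldS b u (fun i => x (e i)) U := by
  induction U using Finset.induction_on_max with
  | empty => simp
  | insert a U h ih =>
    rw [Finset.image_insert, foldS_insert_max, foldS_insert_max _ _ _ h, ih]
    · exact he.mono (by simp)
    · intro i hi
      obtain ⟨k, hk, rfl⟩ := Finset.mem_image.1 hi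
      exact he (by simp [hk]) (by simp) (h k hk)

theorem foldS_congr (b : X →ₗ[𝕜] X →ₗ[𝕜] X) (u : X) {x y : ι → X} {U : Finset ι}
    (h : ∀ i ∈ U, x i = y i) : foldS b u x U = foldS b u y U := by
  unfold foldS
  rw [List.map_congr_left fun i hi => h i ((Finset.mem_sort _).1 hi)]

theorem nest_cons (b : X →ₗ[𝕜] X →ₗ[𝕜] X) (k : ℕ) (u : X) (x : Fin k → X) :
    nest b k (Fin.cons u x) = foldS b u x Finset.univ := by
  induction k with
  | zero =>
    rw [Finset.univ_eq_empty, foldS_empty]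
    rfl
  | succ k ih =>
    have h1 : (Finset.univ : Finset (Fin (k + 1))) =
        insert (Fin.last k) (Finset.univ.image Fin.castSucc) := by
      ext i
      simp only [Finset.mem_univ, Finset.mem_insert, Finset.mem_image, true_and, true_iff]
      exact (Fin.eq_castSucc_or_eq_last i).elim (fun ⟨j, hj⟩ => Or.inr ⟨j, hj.symm⟩) Or.inl
    rw [h1, foldS_insert_max, foldS_image, ← ih]
    · have h2 : Fin.init (α := fun _ => X) (Fin.cons (α := fun _ => X) u x) =
          (Fin.cons u fun i : Fin k => x i.castSucc : Fin (k + 1) → X) := by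
        funext i
        refine Fin.cases rfl (fun i => ?_) i
        rfl
      rw [← h2]
      rfl
    · exact fun i _ j _ hij => hij
    · intro i hi
      obtain ⟨j, _, rfl⟩ := Finset.mem_image.1 hi
      exact Fin.castSucc_lt_last j

/-- The permutation `j.cycleRange.symm` brings the `j`-th entry to the front and keeps the order of
the others, so the operation runs over the remaining indices increasingly. -/
theorem nest_cycleRange (b : X →ₗ[𝕜] X →ₗ[𝕜] X) (k : ℕ) (j : Fin (k + 1)) (x : Fin (k + 1) → X) :
    nest b k (fun i => x (j.cycleRange.symm i)) = foldS b (x j) x (Finset.univ.erase j) := by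
  have h1 : (fun i => x (j.cycleRange.symm i)) = Fin.cons (x j) fun i => x (j.succAbove i) := by
    funext i
    refine Fin.cases ?_ (fun i => ?_) i
    · rw [Fin.cycleRange_symm_zero]
      rfl
    · rw [Fin.cycleRange_symm_succ]
      rfl
  have h2 : Finset.univ.erase j = Finset.univ.image j.succAbove := by
    ext i
    simp only [Finset.mem_erase, Finset.mem_univ, and_true, Finset.mem_image, true_and]
    exact ⟨fun h => Fin.exists_succAbove_eq h, fun ⟨y, hy⟩ => hy ▸ Fin.succAbove_ne j y⟩
  rw [h1, nest_cons, h2, foldS_image]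
  exact (Fin.strictMono_succAbove j).strictMonoOn _

end FoldLemmas

section Brackets

variable {𝕜 Ω : Type*} [Field 𝕜] [Semigroup Ω]
variable {A V : Type*} [AddCommGroup A] [Module 𝕜 A] [AddCommGroup V] [Module 𝕜 V]

theorem movedNest_lof {W : Type*} [AddCommGroup W] [Module 𝕜 W] (lam : 𝕜) (k : ℕ)
    (j : Fin (k + 1)) (s : Fin (k + 1) → HFam 𝕜 Ω W W) :
    movedNest lam k j (fun i => (s i).tot) =
      ksgn 𝕜 (((s j).1 + 1) * ∑ i : Fin (k + 1) with i < j, ((s i).1 : ZMod 2)) •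
        lam ^ ((s j).1 + 1 - k) •
          foldS gerst (s j).tot (fun i => (s i).tot) (Finset.univ.erase j) := by
  have h := MultilinearMap.fromDirectSumEquiv_lof (R := 𝕜) (κ := fun _ : Fin (k + 1) => ℕ)
    (M := fun _ => Fam 𝕜 Ω W W)
    (fun d : Fin (k + 1) → ℕ =>
    Int.negOnePow (((d j : ℤ) - 1) * ∑ i : Fin (k + 1) with i < j, (d i : ℤ)) •
      lam ^ (d j + 1 - k) •
        ((nest (gerst (𝕜 := 𝕜) (Ω := Ω) (W := W)) k).domDomCongr
          j.cycleRange.symm).compLinearMap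
          fun i => DirectSum.lof 𝕜 ℕ (Fam 𝕜 Ω W W) (d i)) (fun i => (s i).1) (fun i => (s i).2)
  refine h.trans ?_
  rw [negOnePow_smul (𝕜 := 𝕜)]
  simp only [_root_.smul_apply, MultilinearMap.compLinearMap_apply,
    MultilinearMap.domDomCongr_apply]
  push_cast
  rw [show ((s j).1 : ZMod 2) - 1 = (s j).1 + 1 by
    linear_combination (-1) * two_eq_zero_zmod]
  congr 2
  exact nest_cycleRange gerst k j fun i => (s i).tot

theorem derivedPart_apply (lam : 𝕜) (k : ℕ) (x : Fin (k + 1) → RelSpace 𝕜 Ω A V) :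
    derivedPart lam k x = (0, ∑ j, projTot (movedNest lam k j fun i =>
      if i = j then ((x i).1 : TotFam 𝕜 Ω (A × V) (A × V)) else inclTot (x i).2)) := by
  rw [derivedPart, _root_.sum_apply]
  have : ∀ j : Fin (k + 1), ((LinearMap.inr 𝕜 (TotLPrime 𝕜 Ω A V) (TotFam 𝕜 Ω V A) ∘ₗ
      projTot).compMultilinearMap ((movedNest lam k j).compLinearMap fun i =>
        if i = j then (TotLPrime 𝕜 Ω A V).subtype ∘ₗ LinearMap.fst 𝕜 _ _
        else inclTot ∘ₗ LinearMap.snd 𝕜 _ _)) x =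
      LinearMap.inr 𝕜 (TotLPrime 𝕜 Ω A V) (TotFam 𝕜 Ω V A)
        (projTot (movedNest lam k j fun i =>
      if i = j then ((x i).1 : TotFam 𝕜 Ω (A × V) (A × V)) else inclTot (x i).2)) := by
    intro j
    refine congrArg (fun y => LinearMap.inr 𝕜 (TotLPrime 𝕜 Ω A V) (TotFam 𝕜 Ω V A)
      (projTot (movedNest lam k j y))) (funext fun i => ?_)
    by_cases h : i = j
    · simp only [if_pos h]
      rfl
    · simp only [if_neg h]
      rfl
  rw [Finset.sum_congr rfl fun j _ => this j, ← map_sum]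
  rfl

/-- The element `s⁻¹F` of `s⁻¹𝔏' ⊕ 𝔞`. -/
def relL {n : ℕ} (F : Fam 𝕜 Ω (A × V) (A × V) n) (hF : F ∈ LPrime 𝕜 Ω A V n) :
    RelSpace 𝕜 Ω A V :=
  (⟨DirectSum.lof 𝕜 ℕ (Fam 𝕜 Ω (A × V) (A × V)) n F, lof_mem_TotLPrime hF⟩, 0)

/-- The element `θ` of `s⁻¹𝔏' ⊕ 𝔞`. -/
def relH (θ : HFam 𝕜 Ω V A) : RelSpace 𝕜 Ω A V := (0, θ.tot)

theorem derivedPart_eq_zero_of_fst (lam : 𝕜) (k : ℕ) (x : Fin (k + 1) → RelSpace 𝕜 Ω A V)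
    (h : ∀ i, (x i).1 = 0) : derivedPart lam k x = 0 := by
  rw [derivedPart_apply, Finset.sum_eq_zero]
  · rfl
  · intro j _
    rw [(movedNest lam k j).map_coord_zero j, map_zero]
    rw [if_pos rfl, h]
    rfl

/-- Each summand reads all but one of its arguments in `𝔞`, hence at least one of any two. -/
theorem derivedPart_eq_zero_of_snd (lam : 𝕜) (k : ℕ) (x : Fin (k + 1) → RelSpace 𝕜 Ω A V)
    {i j : Fin (k + 1)} (hij : i ≠ j) (hi : (x i).2 = 0) (hj : (x j).2 = 0) :
    derivedPart lam k x = 0 := by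
  rw [derivedPart_apply, Finset.sum_eq_zero]
  · rfl
  · intro t _
    obtain ⟨r, hr, hr0⟩ : ∃ r, r ≠ t ∧ (x r).2 = 0 := by
      by_cases h : i = t
      · exact ⟨j, fun hjt => hij (h.trans hjt.symm), hj⟩
      · exact ⟨i, h, hi⟩
    rw [(movedNest lam k t).map_coord_zero r, map_zero]
    rw [if_neg hr, hr0, map_zero]

/-- The value of the derived brackets on one element of `s⁻¹𝔏'` and elements of `𝔞`. -/
theorem derivedPart_relL (lam : 𝕜) (k : ℕ) (x : Fin (k + 1) → RelSpace 𝕜 Ω A V)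
    (j : Fin (k + 1)) {N : ℕ} {F : Fam 𝕜 Ω (A × V) (A × V) N} (hF : F ∈ LPrime 𝕜 Ω A V N)
    (θ : Fin (k + 1) → HFam 𝕜 Ω V A) (hj : x j = relL F hF) (hx : ∀ i, i ≠ j → x i = relH (θ i)) :
    derivedPart lam k x = (0,
      ksgn 𝕜 ((N + 1) * ∑ i : Fin (k + 1) with i < j, ((θ i).1 : ZMod 2)) •
      lam ^ (N + 1 - k) • projTot (foldS gerst
        (DirectSum.lof 𝕜 ℕ (Fam 𝕜 Ω (A × V) (A × V)) N F) (fun i => inclTot (θ i).tot)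
        (Finset.univ.erase j))) := by
  rw [derivedPart_apply, Finset.sum_eq_single j]
  · congr 1
    -- Only the summand with `j` as the `𝔏'`-slot survives; `s` lists the families that it reads.
    let s : Fin (k + 1) → HFam 𝕜 Ω (A × V) (A × V) := fun i =>
      if i = j then ⟨N, F⟩ else inclH (θ i)
    have hsj : s j = ⟨N, F⟩ := if_pos rfl
    have hsi : ∀ i, i ≠ j → s i = inclH (θ i) := fun i hi => if_neg hi
    have h1 : (fun i => if i = j then ((x i).1 : TotFam 𝕜 Ω (A × V) (A × V))
        else inclTot (x i).2) = fun i => (s i).tot := by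
      funext i
      split_ifs with hi
      · subst hi
        rw [hsj, hj]
        rfl
      · rw [hsi i hi, hx i hi, inclH_tot]
        rfl
    rw [h1, movedNest_lof, map_smul, map_smul, hsj]
    have h2 : ∑ i : Fin (k + 1) with i < j, ((s i).1 : ZMod 2) =
        ∑ i : Fin (k + 1) with i < j, ((θ i).1 : ZMod 2) := by
      refine Finset.sum_congr rfl fun i hi => ?_
      rw [hsi i (Finset.mem_filter.1 hi).2.ne]
      rfl
    rw [h2]
    congr 3
    refine foldS_congr _ _ fun i hi => ?_
    rw [hsi i (Finset.ne_of_mem_erase hi), inclH_tot]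
  · intro t _ ht
    rw [(movedNest lam k t).map_coord_zero t, map_zero]
    rw [if_pos rfl, hx t ht]
    rfl
  · exact fun h => absurd (Finset.mem_univ j) h

theorem liePart_apply (x : Fin 2 → RelSpace 𝕜 Ω A V) :
    liePart x = (signedBracket (x 0).1 (x 1).1, 0) := rfl

theorem modBracket_two_apply (lam : 𝕜) (x : Fin 2 → RelSpace 𝕜 Ω A V) :
    modBracket lam 2 x = liePart x + derivedPart lam 1 x := rfl

theorem modBracket_add_three (lam : 𝕜) (k : ℕ) (x : Fin (k + 3) → RelSpace 𝕜 Ω A V) :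
    modBracket lam (k + 3) x = derivedPart lam (k + 2) x := rfl

/-- Since `P` vanishes on `𝔏'`, the convention `l'₁ = 0` agrees with the derived bracket formula
without any `θ`. This case then needs no separate treatment in the Jacobi identities. -/
theorem derivedPart_zero (lam : 𝕜) (x : Fin 1 → RelSpace 𝕜 Ω A V) (n : ℕ)
    (F : Fam 𝕜 Ω (A × V) (A × V) n) (hF : F ∈ LPrime 𝕜 Ω A V n) (hx : x 0 = relL F hF) :
    derivedPart lam 0 x = 0 := by
  rw [derivedPart_relL lam 0 x 0 hF (fun _ => ⟨0, 0⟩) hx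
    (fun i hi => absurd (Fin.ext (by omega)) hi)]
  have : Finset.univ.erase (0 : Fin 1) = ∅ := by decide
  rw [this, foldS_empty, projTot_lof, projFam_eq_zero_of_mem hF, map_zero, smul_zero, smul_zero]
  rfl

theorem liePart_eq_zero (x : Fin 2 → RelSpace 𝕜 Ω A V) (i : Fin 2) (h : (x i).1 = 0) :
    liePart x = 0 := by
  rw [liePart_apply]
  fin_cases i
  · have h : (x 0).1 = 0 := h
    rw [h, map_zero]
    rfl
  · have h : (x 1).1 = 0 := h
    rw [h, map_zero]
    rfl

theorem modBracket_eq_zero_of_fst (lam : 𝕜) (n : ℕ) (x : Fin n → RelSpace 𝕜 Ω A V)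
    (h : ∀ i, (x i).1 = 0) : modBracket lam n x = 0 := by
  match n with
  | 0 => rfl
  | 1 => rfl
  | 2 => rw [modBracket_two_apply, liePart_eq_zero x 0 (h 0), derivedPart_eq_zero_of_fst _ _ _ h,
      add_zero]
  | k + 3 => rw [modBracket_add_three, derivedPart_eq_zero_of_fst _ _ _ h]

theorem modBracket_eq_zero_of_snd (lam : 𝕜) (n : ℕ) (hn : 3 ≤ n) (x : Fin n → RelSpace 𝕜 Ω A V)
    {i j : Fin n} (hij : i ≠ j) (hi : (x i).2 = 0) (hj : (x j).2 = 0) :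
    modBracket lam n x = 0 := by
  obtain ⟨k, rfl⟩ : ∃ k, n = k + 3 := ⟨n - 3, by omega⟩
  rw [modBracket_add_three, derivedPart_eq_zero_of_snd _ _ _ hij hi hj]

/-- Only the Lie part has values in `s⁻¹𝔏'`, and it needs both of its arguments there. -/
theorem modBracket_fst_eq_zero (lam : 𝕜) (n : ℕ) (x : Fin n → RelSpace 𝕜 Ω A V) (i : Fin n)
    (h : (x i).1 = 0) : (modBracket lam n x).1 = 0 := by
  match n with
  | 0 => rfl
  | 1 => rfl
  | 2 => rw [modBracket_two_apply, liePart_eq_zero x i h, derivedPart_apply, zero_add]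
  | k + 3 => rw [modBracket_add_three, derivedPart_apply]

/-- The value of the modified brackets on one element of `s⁻¹𝔏'` and elements of `𝔞`, arranged
along a strictly monotone map. -/
theorem modBracket_relL {ι : Type*} [LinearOrder ι] (lam : 𝕜) (k : ℕ) (x : ι → RelSpace 𝕜 Ω A V)
    (e : Fin (k + 1) → ι) (he : StrictMono e) (S : Finset ι) (hS : Finset.univ.image e = S)
    {a : ι} (ha : a ∈ S) {N : ℕ} {F : Fam 𝕜 Ω (A × V) (A × V) N} (hF : F ∈ LPrime 𝕜 Ω A V N)
    (θ : ι → HFam 𝕜 Ω V A) (hxa : x a = relL F hF)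
    (hx : ∀ i ∈ S, i ≠ a → x i = relH (θ i)) :
    modBracket lam (k + 1) (fun i => x (e i)) = (0,
      ksgn 𝕜 ((N + 1) * ∑ i ∈ S with i < a, ((θ i).1 : ZMod 2)) •
      lam ^ (N + 1 - k) • projTot (foldS gerst
        (DirectSum.lof 𝕜 ℕ (Fam 𝕜 Ω (A × V) (A × V)) N F) (fun i => inclTot (θ i).tot)
        (S.erase a))) := by
  subst hS
  obtain ⟨j, -, rfl⟩ := Finset.mem_image.1 ha
  have hx' : ∀ i, i ≠ j → x (e i) = relH (θ (e i)) := fun i hi =>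
    hx _ (Finset.mem_image_of_mem e (Finset.mem_univ i)) fun h => hi (he.injective h)
  -- The bracket differs from its derived part at most for one or two arguments: for one both are
  -- zero, and for two the other argument lies in `𝔞` and kills the Lie part.
  have h1 : modBracket lam (k + 1) (fun i => x (e i)) = derivedPart lam k fun i => x (e i) := by
    match k with
    | 0 =>
      have hj : j = 0 := Fin.ext (by omega)
      subst hj
      rw [derivedPart_zero lam (fun i => x (e i)) N F hF hxa]
      rfl
    | 1 =>
      obtain ⟨i, hi⟩ : ∃ i : Fin 2, i ≠ j := exists_ne j
      rw [modBracket_two_apply, liePart_eq_zero _ i, zero_add]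
      rw [hx' i hi]
      rfl
    | k + 2 => rfl
  rw [h1, derivedPart_relL lam k (fun i => x (e i)) j hF (fun i => θ (e i)) hxa hx']
  have h2 : ∑ i ∈ Finset.univ.image e with i < e j, ((θ i).1 : ZMod 2) =
      ∑ i : Fin (k + 1) with i < j, ((θ (e i)).1 : ZMod 2) := by
    rw [Finset.filter_image, Finset.sum_image he.injective.injOn]
    simp only [he.lt_iff_lt]
  have h3 : (Finset.univ.image e).erase (e j) = (Finset.univ.erase j).image e := by
    rw [Finset.image_erase he.injective]
  rw [h2, h3, foldS_image _ _ _ _ _ (he.strictMonoOn _)]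

end Brackets

/-! ### Iterated brackets of a bracket -/

section Leibniz

/-- The sign exponent for moving the elements of `T'` in front of those of `T`. -/
def invExp {ι : Type*} [LinearOrder ι] (d : ι → ZMod 2) (T T' : Finset ι) : ZMod 2 :=
  ∑ t ∈ T, ∑ s ∈ T' with s < t, d t * d s

section InvExp

variable {ι : Type*} [LinearOrder ι] (d : ι → ZMod 2)

theorem invExp_insert_left {a : ι} {T : Finset ι} (ha : a ∉ T) (T' : Finset ι) :
    invExp d (insert a T) T' = d a * ∑ s ∈ T' with s < a, d s + invExp d T T' := by
  rw [invExp, Finset.sum_insert ha, ← Finset.mul_sum]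
  rfl

theorem invExp_insert_right {a : ι} {T' : Finset ι} (ha : a ∉ T') (T : Finset ι) :
    invExp d T (insert a T') = d a * ∑ t ∈ T with a < t, d t + invExp d T T' := by
  unfold invExp
  rw [Finset.sum_filter, Finset.mul_sum, ← Finset.sum_add_distrib]
  refine Finset.sum_congr rfl fun t _ => ?_
  rw [Finset.filter_insert]
  split_ifs with h
  · rw [Finset.sum_insert (by simp [ha])]
    ring
  · rw [mul_zero, zero_add]

/-- Every pair of elements from disjoint sets is inverted in exactly one of the two orders. -/
theorem invExp_add_swap {T T' : Finset ι} (h : Disjoint T T') :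
    invExp d T T' + invExp d T' T = (∑ t ∈ T, d t) * ∑ t ∈ T', d t := by
  unfold invExp
  simp only [Finset.sum_filter]
  rw [Finset.sum_comm (s := T'), ← Finset.sum_add_distrib, Finset.sum_mul]
  refine Finset.sum_congr rfl fun t ht => ?_
  rw [← Finset.sum_add_distrib, Finset.mul_sum]
  refine Finset.sum_congr rfl fun s hs => ?_
  rcases lt_trichotomy s t with hst | rfl | hst
  · rw [if_pos hst, if_neg hst.not_gt, add_zero]
  · exact absurd hs (Finset.disjoint_left.1 h ht)
  · rw [if_pos hst, if_neg hst.not_gt, zero_add, mul_comm]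

end InvExp

variable {𝕜 Ω : Type*} [Field 𝕜] [Semigroup Ω]
variable {W : Type*} [AddCommGroup W] [Module 𝕜 W] {ι : Type*} [LinearOrder ι]

/-- Bracketing with `x a` is a graded derivation, so each `x i` acts either on `u` or on `v`. The
sign comes from moving the elements that act on `u` past `v` and past the smaller elements that act
on `v`. -/
theorem foldS_gerst_leibniz {n m : ℕ} {u v : TotFam 𝕜 Ω W W} (hu : u ∈ homog 𝕜 Ω W n)
    (hv : v ∈ homog 𝕜 Ω W m) {p : ι → ℕ} {x : ι → TotFam 𝕜 Ω W W}
    (hx : ∀ i, x i ∈ homog 𝕜 Ω W (p i)) (U : Finset ι) :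
    foldS gerst (gerst u v) x U = ∑ T ∈ U.powerset,
      ksgn 𝕜 (m * ∑ t ∈ T, (p t : ZMod 2) + invExp (fun i => (p i : ZMod 2)) T (U \ T)) •
        gerst (foldS gerst u x T) (foldS gerst v x (U \ T)) := by
  induction U using Finset.induction_on_max with
  | empty => simp [invExp]
  | insert a U h ih =>
    have ha : a ∉ U := fun ha => lt_irrefl a (h a ha)
    rw [foldS_insert_max _ _ _ h, ih, map_sum, LinearMap.sum_apply,
      Finset.sum_powerset_insert ha, ← Finset.sum_add_distrib]
    refine Finset.sum_congr rfl fun T hT => ?_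
    have hTU := Finset.mem_powerset.1 hT
    have haT : a ∉ T := fun h' => ha (hTU h')
    have haT' : a ∉ U \ T := fun h' => ha (Finset.mem_sdiff.1 h').1
    rw [Finset.insert_sdiff_of_notMem _ haT, Finset.insert_sdiff_insert,
      Finset.sdiff_insert_of_notMem ha, foldS_insert_max _ _ _ fun i hi => h i (hTU hi),
      foldS_insert_max _ _ _ fun i hi => h i (Finset.mem_sdiff.1 hi).1, map_smul,
      LinearMap.smul_apply,
      gerst_leibniz (foldS_gerst_mem hu hx T) (foldS_gerst_mem hv hx (U \ T)) (hx a), smul_add,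
      smul_smul, ← ksgn_add, invExp_insert_left _ haT, invExp_insert_right _ haT',
      Finset.sum_insert haT]
    congr 2
    · rw [Finset.filter_false_of_mem fun t ht => (h t (hTU ht)).not_gt]
      simp
    · congr 1
      rw [Finset.filter_true_of_mem fun t ht => h t (Finset.mem_sdiff.1 ht).1]
      push_cast
      ring

/-- As `v` has zero bracket with every `x i`, bracketing with `v` can be moved to the front. It is
applied to `v` in `𝔞`, the projection of another iterated bracket. -/
theorem foldS_gerst_swap {n m : ℕ} {u v : TotFam 𝕜 Ω W W} (hu : u ∈ homog 𝕜 Ω W n)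
    (hv : v ∈ homog 𝕜 Ω W m) {p : ι → ℕ} {x : ι → TotFam 𝕜 Ω W W}
    (hx : ∀ i, x i ∈ homog 𝕜 Ω W (p i)) (hvx : ∀ i, gerst v (x i) = 0) (U : Finset ι) :
    gerst (foldS gerst u x U) v =
      ksgn 𝕜 (m * ∑ t ∈ U, (p t : ZMod 2)) • foldS gerst (gerst u v) x U := by
  induction U using Finset.induction_on_max with
  | empty => simp
  | insert a U h ih =>
    have ha : a ∉ U := fun ha => lt_irrefl a (h a ha)
    have h1 := gerst_leibniz (foldS_gerst_mem hu hx U) hv (hx a)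
    rw [hvx, map_zero, zero_add, ih, map_smul, LinearMap.smul_apply] at h1
    rw [foldS_insert_max _ _ _ h, foldS_insert_max _ _ _ h, Finset.sum_insert ha, mul_add,
      ksgn_add, mul_smul, h1, smul_smul, ksgn_mul_self, one_smul]

variable {A V : Type*} [AddCommGroup A] [Module 𝕜 A] [AddCommGroup V] [Module 𝕜 V]

theorem gerst_inclTot_tot (η : TotFam 𝕜 Ω V A) {n : ℕ} (hη : inclTot η ∈ homog 𝕜 Ω (A × V) n)
    (θ : HFam 𝕜 Ω V A) : gerst (inclTot η) (inclTot θ.tot) = 0 :=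
  gerst_inclTot hη (inclH_tot_mem θ)

/-- The projection to `𝔞` of the iterated bracket of `[u, v]` with elements of `𝔞`. -/
theorem projTot_foldS_gerst_gerst {n m : ℕ} {u v : TotFam 𝕜 Ω (A × V) (A × V)}
    (hu : u ∈ homog 𝕜 Ω (A × V) n) (hv : v ∈ homog 𝕜 Ω (A × V) m) (θ : ι → HFam 𝕜 Ω V A)
    (U : Finset ι) :
    projTot (foldS gerst (gerst u v) (fun i => inclTot (θ i).tot) U) =
      ∑ T ∈ U.powerset,
        (ksgn 𝕜 (invExp (fun i => ((θ i).1 : ZMod 2)) T (U \ T) + 1 + n * m) •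
          projTot (foldS gerst (gerst v
            (inclTot (projTot (foldS gerst u (fun i => inclTot (θ i).tot) T))))
            (fun i => inclTot (θ i).tot) (U \ T)) +
        ksgn 𝕜 (invExp (fun i => ((θ i).1 : ZMod 2)) T (U \ T)) •
          projTot (foldS gerst (gerst u
            (inclTot (projTot (foldS gerst v (fun i => inclTot (θ i).tot) T))))
            (fun i => inclTot (θ i).tot) (U \ T))) := by
  have hx : ∀ i, inclTot (θ i).tot ∈ homog 𝕜 Ω (A × V) (θ i).1 := fun i => inclH_tot_mem (θ i)
  rw [foldS_gerst_leibniz hu hv hx, map_sum]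
  -- The rule for `P` replaces one factor at a time by its projection to `𝔞`, which then commutes
  -- with all the `θ_i` and is moved to the front.
  have key : ∀ T ∈ U.powerset, projTot
      (ksgn 𝕜 (m * ∑ t ∈ T, ((θ t).1 : ZMod 2) +
        invExp (fun i => ((θ i).1 : ZMod 2)) T (U \ T)) •
      gerst (foldS gerst u (fun i => inclTot (θ i).tot) T)
        (foldS gerst v (fun i => inclTot (θ i).tot) (U \ T))) =
      ksgn 𝕜 (invExp (fun i => ((θ i).1 : ZMod 2)) T (U \ T) + 1 + n * m) •
          projTot (foldS gerst (gerst v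
            (inclTot (projTot (foldS gerst u (fun i => inclTot (θ i).tot) T))))
            (fun i => inclTot (θ i).tot) (U \ T)) +
        ksgn 𝕜 (invExp (fun i => ((θ i).1 : ZMod 2)) (U \ T) T) •
          projTot (foldS gerst (gerst u
            (inclTot (projTot (foldS gerst v (fun i => inclTot (θ i).tot) (U \ T)))))
            (fun i => inclTot (θ i).tot) T) := by
    intro T hT
    have h1 := foldS_gerst_mem hu hx T
    have h2 := foldS_gerst_mem hv hx (U \ T)
    have h3 := inclTot_projTot_mem h1
    have h4 := inclTot_projTot_mem h2
    rw [map_smul, projTot_gerst h1 h2, smul_add, gerst_antisymm h3 h2,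
      foldS_gerst_swap hv h3 hx (fun i => gerst_inclTot_tot _ h3 _),
      foldS_gerst_swap hu h4 hx (fun i => gerst_inclTot_tot _ h4 _)]
    simp only [map_smul, smul_smul, ← ksgn_add]
    have hinv := invExp_add_swap (fun i => ((θ i).1 : ZMod 2)) (T := T) (T' := U \ T)
      Finset.disjoint_sdiff
    congr 3
    · push_cast
      linear_combination (m * ∑ t ∈ T, ((θ t).1 : ZMod 2) + n * ∑ t ∈ U \ T, ((θ t).1 : ZMod 2) +
        (∑ t ∈ T, ((θ t).1 : ZMod 2)) * ∑ t ∈ U \ T, ((θ t).1 : ZMod 2)) * two_eq_zero_zmod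
    · push_cast
      linear_combination hinv + (m * ∑ t ∈ T, ((θ t).1 : ZMod 2) -
        invExp (fun i => ((θ i).1 : ZMod 2)) (U \ T) T +
        (∑ t ∈ T, ((θ t).1 : ZMod 2)) * ∑ t ∈ U \ T, ((θ t).1 : ZMod 2)) * two_eq_zero_zmod
  rw [Finset.sum_congr rfl key, Finset.sum_add_distrib, Finset.sum_add_distrib]
  congr 1
  -- Taking complements renames the set acting on `v` to `T`, so that the two families of terms have
  -- the same form.
  refine Finset.sum_bij' (fun T _ => U \ T) (fun T _ => U \ T) ?_ ?_ ?_ ?_ ?_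
  · exact fun T _ => Finset.mem_powerset.2 Finset.sdiff_subset
  · exact fun T _ => Finset.mem_powerset.2 Finset.sdiff_subset
  · exact fun T hT => Finset.sdiff_sdiff_eq_self (Finset.mem_powerset.1 hT)
  · exact fun T hT => Finset.sdiff_sdiff_eq_self (Finset.mem_powerset.1 hT)
  · intro T hT
    rw [Finset.sdiff_sdiff_eq_self (Finset.mem_powerset.1 hT)]

end Leibniz

/-! ### Shuffles and subsets -/

section Shuffles

open Classical in
/-- The set of the first `i` values of a permutation. -/
def firstBlock {n : ℕ} (i : ℕ) (σ : Equiv.Perm (Fin n)) : Finset (Fin n) :=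
  Finset.univ.filter fun v => (σ.symm v : ℕ) < i

theorem mem_firstBlock {n : ℕ} {i : ℕ} {σ : Equiv.Perm (Fin n)} {v : Fin n} :
    v ∈ firstBlock i σ ↔ (σ.symm v : ℕ) < i := by
  simp [firstBlock]

/-- A shuffle is increasing on each of its two blocks, so its inversions are pairs with one value
from each block. -/
theorem koszulExp_shuffle {n : ℕ} {i : ℕ} {σ : Equiv.Perm (Fin n)} (hσ : IsShuffle i σ)
    (d : Fin n → ZMod 2) :
    koszulExp σ d = invExp d (firstBlock i σ) (firstBlock i σ)ᶜ := by
  unfold koszulExp invExp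
  rw [← σ.symm.sum_comp, firstBlock, Finset.sum_filter]
  refine Finset.sum_congr rfl fun u _ => ?_
  rw [← σ.symm.sum_comp, Finset.compl_filter, Finset.filter_filter, Finset.sum_filter]
  simp only [Equiv.apply_symm_apply]
  split_ifs with hu
  · refine Finset.sum_congr rfl fun v _ => ?_
    refine if_congr ⟨fun ⟨h1, h2⟩ => ⟨fun h3 => ?_, h2⟩, fun ⟨h1, h2⟩ => ⟨?_, h2⟩⟩ rfl rfl
    · have := hσ.1 _ _ h1 h3
      simp only [Equiv.apply_symm_apply] at this
      exact lt_asymm this h2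
    · rw [Fin.lt_def]
      omega
  · refine Finset.sum_eq_zero fun v _ => if_neg fun ⟨h1, h2⟩ => ?_
    have := hσ.2 _ _ (not_lt.1 hu) h1
    simp only [Equiv.apply_symm_apply] at this
    exact lt_asymm this h2

theorem card_firstBlock {n : ℕ} (i : Fin n) (σ : Equiv.Perm (Fin n)) :
    (firstBlock (i + 1) σ).card = i + 1 := by
  have : firstBlock (i + 1) σ = (Finset.Iic i).map σ.toEmbedding := by
    ext v
    rw [mem_firstBlock, Finset.mem_map_equiv, Finset.mem_Iic, Fin.le_def]
    omega
  rw [this, Finset.card_map, Fin.card_Iic]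

theorem image_firstBlock {n : ℕ} (i : Fin n) (σ : Equiv.Perm (Fin n)) :
    Finset.univ.image (fun a : Fin (i + 1) => σ ⟨a, by omega⟩) = firstBlock (i + 1) σ := by
  ext v
  rw [mem_firstBlock, Finset.mem_image]
  constructor
  · rintro ⟨a, -, rfl⟩
    rw [Equiv.symm_apply_apply]
    exact a.2
  · intro h
    exact ⟨⟨σ.symm v, h⟩, Finset.mem_univ _, by simp⟩

theorem image_secondBlock {n : ℕ} (i : Fin n) (σ : Equiv.Perm (Fin n)) :
    Finset.univ.image (fun b : Fin (n - (i + 1)) => σ ⟨i + 1 + b, by omega⟩) =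
      (firstBlock (i + 1) σ)ᶜ := by
  ext v
  rw [Finset.mem_compl, mem_firstBlock, Finset.mem_image]
  constructor
  · rintro ⟨a, -, rfl⟩
    rw [Equiv.symm_apply_apply]
    dsimp only
    omega
  · intro h
    have := (σ.symm v).2
    refine ⟨⟨σ.symm v - (i + 1), by omega⟩, Finset.mem_univ _, ?_⟩
    have h2 : (⟨i + 1 + ((σ.symm v : ℕ) - (i + 1)), by omega⟩ : Fin n) = σ.symm v :=
      Fin.ext (by dsimp only; omega)
    dsimp only
    rw [h2, Equiv.apply_symm_apply]

theorem strictMono_firstBlock {n : ℕ} (i : Fin n) {σ : Equiv.Perm (Fin n)}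
    (hσ : IsShuffle (i + 1) σ) : StrictMono fun a : Fin (i + 1) => σ ⟨a, by omega⟩ :=
  fun a b hab => hσ.1 _ _ hab b.2

theorem strictMono_secondBlock {n : ℕ} (i : Fin n) {σ : Equiv.Perm (Fin n)}
    (hσ : IsShuffle (i + 1) σ) :
    StrictMono fun b : Fin (n - (i + 1)) => σ ⟨i + 1 + b, by omega⟩ :=
  fun a b hab => hσ.2 _ _ (Nat.le_add_right _ _) (by rw [Fin.lt_def] at hab ⊢; dsimp only; omega)

open Classical in
/-- Shuffles correspond to non-empty subsets. -/
theorem sum_shuffles {M : Type*} [AddCommMonoid M] {n : ℕ} (Φ : Finset (Fin n) → M) :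
    ∑ i : Fin n, ∑ σ : Equiv.Perm (Fin n) with IsShuffle (i + 1) σ, Φ (firstBlock (i + 1) σ) =
      ∑ S : Finset (Fin n) with S.Nonempty, Φ S := by
  rw [Finset.sum_sigma']
  refine Finset.sum_bij (fun x _ => firstBlock (x.1 + 1) x.2) ?_ ?_ ?_ ?_
  · rintro ⟨i, σ⟩ -
    refine Finset.mem_filter.2 ⟨Finset.mem_univ _, ?_⟩
    rw [← Finset.card_pos, card_firstBlock]
    omega
  · rintro ⟨i, σ⟩ hx ⟨i', σ'⟩ hx' heq
    simp only [Finset.mem_sigma, Finset.mem_filter, Finset.mem_univ, true_and] at hx hx'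
    dsimp only at heq
    have hi : i = i' := by
      have := congrArg Finset.card heq
      rw [card_firstBlock, card_firstBlock] at this
      exact Fin.ext (by omega)
    subst hi
    have h1 : (fun a : Fin (i + 1) => σ ⟨a, by omega⟩) = fun a : Fin (i + 1) => σ' ⟨a, by omega⟩ := by
      refine ((strictMono_firstBlock i hx).range_inj (strictMono_firstBlock i hx')).1 ?_
      have := congrArg (fun S : Finset (Fin n) => (S : Set (Fin n))) heq
      simpa [← image_firstBlock] using this
    have h2 : (fun b : Fin (n - (i + 1)) => σ ⟨i + 1 + b, by omega⟩) =
        fun b : Fin (n - (i + 1)) => σ' ⟨i + 1 + b, by omega⟩ := by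
      refine ((strictMono_secondBlock i hx).range_inj (strictMono_secondBlock i hx')).1 ?_
      have := congrArg (fun S : Finset (Fin n) => ((Sᶜ : Finset (Fin n)) : Set (Fin n))) heq
      rw [← image_secondBlock, ← image_secondBlock] at this
      simpa using this
    have h3 : σ = σ' := by
      ext v
      by_cases hv : (v : ℕ) < i + 1
      · exact congrArg Fin.val (congrFun h1 ⟨v, hv⟩)
      · have := congrArg Fin.val (congrFun h2 ⟨v - (i + 1), by omega⟩)
        dsimp only at this
        have h4 : (⟨i + 1 + ((v : ℕ) - (i + 1)), by omega⟩ : Fin n) = v :=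
          Fin.ext (by dsimp only; omega)
        rwa [h4] at this
    rw [h3]
  · intro S hS
    have hS := Finset.card_pos.2 (Finset.mem_filter.1 hS).2
    have hSn : S.card ≤ n := by simpa using Finset.card_le_univ S
    have hSc : Sᶜ.card = n - S.card := by
      rw [Finset.card_compl, Fintype.card_fin]
    -- The shuffle with first block `S` lists `S` in increasing order and then the complement. Its
    -- index is `S.card - 1`, since index `i` stands for a block of `i + 1` elements.
    let e₁ := S.orderEmbOfFin rfl
    let e₂ := Sᶜ.orderEmbOfFin hSc
    let g : Fin n → Fin n := fun a => if h : (a : ℕ) < S.card then e₁ ⟨a, h⟩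
      else e₂ ⟨a - S.card, by omega⟩
    have hg1 : ∀ (a : Fin n) (h : (a : ℕ) < S.card), g a = e₁ ⟨a, h⟩ := fun a h => dif_pos h
    have hg2 : ∀ (a : Fin n) (h : ¬ (a : ℕ) < S.card), g a = e₂ ⟨a - S.card, by omega⟩ :=
      fun a h => dif_neg h
    have hm1 : ∀ b, e₁ b ∈ S := fun b => S.orderEmbOfFin_mem rfl b
    have hm2 : ∀ b, e₂ b ∉ S := fun b => Finset.mem_compl.1 (Sᶜ.orderEmbOfFin_mem hSc b)
    have hmem : ∀ a : Fin n, g a ∈ S ↔ (a : ℕ) < S.card := by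
      intro a
      by_cases h : (a : ℕ) < S.card
      · rw [hg1 a h]
        exact iff_of_true (hm1 _) h
      · rw [hg2 a h]
        exact iff_of_false (hm2 _) h
    have hinj : Function.Injective g := by
      intro a b hab
      by_cases ha : (a : ℕ) < S.card
      · have hb : (b : ℕ) < S.card := by
          rw [← hmem, ← hab, hmem]
          exact ha
        rw [hg1 a ha, hg1 b hb] at hab
        have := congrArg Fin.val (e₁.injective hab)
        exact Fin.ext this
      · have hb : ¬ (b : ℕ) < S.card := by
          rw [← hmem, ← hab, hmem]
          exact ha
        rw [hg2 a ha, hg2 b hb] at hab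
        have := congrArg Fin.val (e₂.injective hab)
        dsimp only at this
        exact Fin.ext (by omega)
    let σ : Equiv.Perm (Fin n) := Equiv.ofBijective g (Finite.injective_iff_bijective.1 hinj)
    have hσ : ∀ a, σ a = g a := fun a => rfl
    have hcard : S.card - 1 + 1 = S.card := by omega
    refine ⟨⟨⟨S.card - 1, by omega⟩, σ⟩, ?_, ?_⟩
    · simp only [Finset.mem_sigma, Finset.mem_filter, Finset.mem_univ, true_and, hcard]
      constructor
      · intro a b hab hb
        have ha : (a : ℕ) < S.card := lt_trans hab hb
        rw [hσ, hσ, hg1 a ha, hg1 b hb]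
        exact e₁.strictMono hab
      · intro a b ha hab
        have hb : S.card ≤ (b : ℕ) := le_trans ha (le_of_lt hab)
        rw [hσ, hσ, hg2 a ha.not_gt, hg2 b hb.not_gt]
        refine e₂.strictMono ?_
        rw [Fin.lt_def] at hab ⊢
        dsimp only
        omega
    · ext v
      rw [mem_firstBlock]
      dsimp only
      rw [hcard, ← hmem, ← hσ, Equiv.apply_symm_apply]
  · rintro ⟨i, σ⟩ -
    rfl

end Shuffles

/-! ### Multilinearity of the terms of the Jacobi identity -/

section Jacobi

/-- Each argument occurs exactly once, in the inner or in the outer bracket according to its place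
under the permutation. -/
theorem jacobiTerm_update_add {𝕜 X : Type*} [Field 𝕜] [AddCommGroup X] [Module 𝕜 X]
    (l : ∀ n : ℕ, MultilinearMap 𝕜 (fun _ : Fin n => X) X) {n : ℕ} (x : Fin n → X)
    (i : Fin n) (σ : Equiv.Perm (Fin n)) (j : Fin n) (y z : X) :
    jacobiTerm l (Function.update x j (y + z)) i σ =
      jacobiTerm l (Function.update x j y) i σ + jacobiTerm l (Function.update x j z) i σ := by
  obtain ⟨t, rfl⟩ := σ.surjective j
  have hi := i.2
  by_cases ht : (t : ℕ) < i + 1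
  · have h1 : ∀ c, (fun a : Fin (i + 1) => Function.update x (σ t) c (σ ⟨a, by omega⟩)) =
        Function.update (fun a : Fin (i + 1) => x (σ ⟨a, by omega⟩)) ⟨t, ht⟩ c := by
      intro c
      funext a
      by_cases hat : a = ⟨t, ht⟩
      · subst hat
        simp
      · rw [Function.update_of_ne hat, Function.update_of_ne]
        exact fun h => hat (Fin.ext (show (a : ℕ) = t from congrArg Fin.val (σ.injective h)))
    have h2 : ∀ c, (fun b : Fin (n - (i + 1)) =>
        Function.update x (σ t) c (σ ⟨i + 1 + b, by omega⟩)) =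
        fun b : Fin (n - (i + 1)) => x (σ ⟨i + 1 + b, by omega⟩) := by
      intro c
      funext b
      rw [Function.update_of_ne]
      intro h
      have := congrArg Fin.val (σ.injective h)
      dsimp only at this
      omega
    simp only [jacobiTerm, h1, h2, MultilinearMap.map_update_add]
    generalize (l (i + 1)) _ = p
    generalize (l (i + 1)) _ = q
    generalize (fun b : Fin (n - (i + 1)) => x (σ ⟨i + 1 + b, by omega⟩)) = w
    have h3 : ∀ c, (Fin.cons c w : Fin (n - (i + 1) + 1) → X) =
        Function.update (Fin.cons 0 w : Fin (n - (i + 1) + 1) → X) 0 c := fun c => by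
      rw [Fin.update_cons_zero]
    rw [h3 (p + q), h3 p, h3 q, MultilinearMap.map_update_add]
  · have h1 : ∀ c, (fun a : Fin (i + 1) => Function.update x (σ t) c (σ ⟨a, by omega⟩)) =
        fun a : Fin (i + 1) => x (σ ⟨a, by omega⟩) := by
      intro c
      funext a
      rw [Function.update_of_ne]
      intro h
      have := congrArg Fin.val (σ.injective h)
      dsimp only at this
      omega
    have h2 : ∀ c, (fun b : Fin (n - (i + 1)) =>
        Function.update x (σ t) c (σ ⟨i + 1 + b, by omega⟩)) =
        Function.update (fun b : Fin (n - (i + 1)) => x (σ ⟨i + 1 + b, by omega⟩))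
          ⟨t - (i + 1), by omega⟩ c := by
      intro c
      funext b
      by_cases hbt : b = ⟨t - (i + 1), by omega⟩
      · have h3 : (⟨i + 1 + b, by omega⟩ : Fin n) = t := by
          subst hbt
          exact Fin.ext (by dsimp only; omega)
        rw [h3, hbt]
        simp
      · rw [Function.update_of_ne hbt, Function.update_of_ne]
        intro h
        have := congrArg Fin.val (σ.injective h)
        dsimp only at this
        exact hbt (Fin.ext (by dsimp only; omega))
    simp only [jacobiTerm, h1, h2, Fin.cons_update, MultilinearMap.map_update_add]

/-- Reduction to generators, one argument after the other. The map may have only additivity in each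
argument; zero summands are admitted because `T` vanishes on them, and the submonoid `K` serves both
for identities (`⊥`) and for degrees. -/
theorem mem_of_decomposition {X Y : Type*} [AddCommGroup X] [AddCommGroup Y] {n : ℕ}
    (T : (Fin n → X) → Y)
    (hT : ∀ x j y z, T (Function.update x j (y + z)) =
      T (Function.update x j y) + T (Function.update x j z))
    (Q R : Fin n → X → Prop)
    (hQ : ∀ i y, Q i y → ∃ a b, (a = 0 ∨ R i a) ∧ (b = 0 ∨ R i b) ∧ y = a + b)
    (K : AddSubmonoid Y) (h : ∀ x, (∀ i, R i (x i)) → T x ∈ K) (x : Fin n → X)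
    (hx : ∀ i, Q i (x i)) : T x ∈ K := by
  classical
  have h0 : ∀ x j, T (Function.update x j 0) = 0 := by
    intro x j
    have := hT x j 0 0
    rwa [add_zero, left_eq_add] at this
  suffices H : ∀ (s : Finset (Fin n)) (x : Fin n → X), (∀ i ∈ s, Q i (x i)) →
      (∀ i, i ∉ s → R i (x i)) → T x ∈ K from
    H Finset.univ x (fun i _ => hx i) fun i hi => absurd (Finset.mem_univ i) hi
  intro s
  induction s using Finset.induction_on with
  | empty => exact fun x _ hx => h x fun i => hx i (Finset.notMem_empty i)
  | insert a s ha ih =>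
    intro x hx hx'
    obtain ⟨y, z, hy, hz, hyz⟩ := hQ a (x a) (hx a (Finset.mem_insert_self _ _))
    have aux : ∀ c, (c = 0 ∨ R a c) → T (Function.update x a c) ∈ K := by
      rintro c (rfl | hc)
      · rw [h0]
        exact K.zero_mem
      · refine ih _ (fun i hi => ?_) fun i hi => ?_
        · have hia : i ≠ a := fun h => ha (h ▸ hi)
          rw [Function.update_of_ne hia]
          exact hx i (Finset.mem_insert_of_mem hi)
        · by_cases hia : i = a
          · subst hia
            rwa [Function.update_self]
          · rw [Function.update_of_ne hia]
            exact hx' i fun h => (Finset.mem_insert.1 h).elim hia hi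
    have : x = Function.update x a (y + z) := by rw [← hyz, Function.update_eq_self]
    rw [this, hT]
    exact K.add_mem (aux y hy) (aux z hz)

theorem foldS_smul {𝕜 X : Type*} [Field 𝕜] [AddCommGroup X] [Module 𝕜 X] {ι : Type*}
    [LinearOrder ι] (b : X →ₗ[𝕜] X →ₗ[𝕜] X) (c : 𝕜) (u : X) (x : ι → X) (U : Finset ι) :
    foldS b (c • u) x U = c • foldS b u x U := by
  induction U using Finset.induction_on_max with
  | empty => simp
  | insert a U h ih =>
    rw [foldS_insert_max _ _ _ h, foldS_insert_max _ _ _ h, ih, map_smul, LinearMap.smul_apply]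

theorem foldS_zero {𝕜 X : Type*} [Field 𝕜] [AddCommGroup X] [Module 𝕜 X] {ι : Type*}
    [LinearOrder ι] (b : X →ₗ[𝕜] X →ₗ[𝕜] X) (x : ι → X) (U : Finset ι) :
    foldS b 0 x U = 0 := by
  have := foldS_smul b 0 0 x U
  rwa [zero_smul, zero_smul] at this

variable {𝕜 Ω : Type*} [Field 𝕜]
variable {A V : Type*} [AddCommGroup A] [Module 𝕜 A] [AddCommGroup V] [Module 𝕜 V]

/-- The homogeneous elements of `s⁻¹𝔏'` or of `𝔞`. -/
def IsPure (d : ℤ) (x : RelSpace 𝕜 Ω A V) : Prop :=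
  (∃ (N : ℕ) (F : Fam 𝕜 Ω (A × V) (A × V) N) (hF : F ∈ LPrime 𝕜 Ω A V N),
    (N : ℤ) - 1 = d ∧ x = relL F hF) ∨
  ∃ θ : HFam 𝕜 Ω V A, (θ.1 : ℤ) = d ∧ x = relH θ

theorem totFam_eq_lof {V W : Type*} [AddCommGroup V] [Module 𝕜 V] [AddCommGroup W] [Module 𝕜 W]
    (u : TotFam 𝕜 Ω V W) (n : ℕ) (h : ∀ m, m ≠ n → u m = 0) :
    u = DirectSum.lof 𝕜 ℕ (Fam 𝕜 Ω V W) n (u n) := by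
  refine DFinsupp.ext fun m => ?_
  by_cases hm : m = n
  · subst hm
    exact (DirectSum.lof_apply 𝕜 m (u m)).symm
  · rw [h m hm, DirectSum.lof_eq_of, DirectSum.of_eq_of_ne _ _ _ hm]

/-- The alternative of a zero summand is needed because in negative degrees a summand may have no
arity: `𝔏'` starts in degree `-1` and `𝔞` in degree `0`. -/
theorem exists_pure_decomposition {d : ℤ} {x : RelSpace 𝕜 Ω A V}
    (hx : x ∈ relGrading 𝕜 Ω A V d) :
    ∃ a b, (a = 0 ∨ IsPure d a) ∧ (b = 0 ∨ IsPure d b) ∧ x = a + b := by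
  refine ⟨(x.1, 0), (0, x.2), ?_, ?_, by simp⟩
  · by_cases h : ∃ n : ℕ, (n : ℤ) - 1 = d
    · obtain ⟨n, hn⟩ := h
      refine Or.inr (Or.inl ⟨n, x.1.1 n, x.1.2 n, hn, ?_⟩)
      refine Prod.ext (Subtype.ext ?_) rfl
      exact totFam_eq_lof _ _ fun m hm => hx.1 m (by omega)
    · push Not at h
      refine Or.inl (Prod.ext (Subtype.ext (DFinsupp.ext fun n => ?_)) rfl)
      exact hx.1 n (h n)
  · by_cases h : ∃ n : ℕ, (n : ℤ) = d
    · obtain ⟨n, hn⟩ := h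
      refine Or.inr (Or.inr ⟨⟨n, x.2 n⟩, hn, ?_⟩)
      refine Prod.ext rfl ?_
      exact totFam_eq_lof _ _ fun m hm => hx.2 m (by have hm : m ≠ n := hm; omega)
    · push Not at h
      refine Or.inl (Prod.ext rfl (DFinsupp.ext fun n => ?_))
      exact hx.2 n (h n)

theorem relL_mem {N : ℕ} {F : Fam 𝕜 Ω (A × V) (A × V) N} (hF : F ∈ LPrime 𝕜 Ω A V N) {d : ℤ}
    (hd : (N : ℤ) - 1 = d) : relL F hF ∈ relGrading 𝕜 Ω A V d :=
  ⟨fun n hn => DirectSum.of_eq_of_ne _ _ _ (by rintro rfl; exact hn hd), fun n _ => rfl⟩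

theorem relH_mem (θ : HFam 𝕜 Ω V A) {d : ℤ} (hd : (θ.1 : ℤ) = d) :
    relH θ ∈ relGrading 𝕜 Ω A V d :=
  ⟨fun n _ => rfl, fun n hn => DirectSum.of_eq_of_ne _ _ _ (by rintro rfl; exact hn hd)⟩

theorem exists_projTot_eq {n : ℕ} {u : TotFam 𝕜 Ω (A × V) (A × V)}
    (hu : u ∈ homog 𝕜 Ω (A × V) n) : ∃ θ : HFam 𝕜 Ω V A, θ.1 = n ∧ θ.tot = projTot u := by
  obtain ⟨F, rfl⟩ := hu
  exact ⟨⟨n, projFam n F⟩, rfl, (projTot_lof F).symm⟩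

theorem exists_smul_tot {V W : Type*} [AddCommGroup V] [Module 𝕜 V] [AddCommGroup W] [Module 𝕜 W]
    (c : 𝕜) (θ : HFam 𝕜 Ω V W) : ∃ η : HFam 𝕜 Ω V W, η.1 = θ.1 ∧ η.tot = c • θ.tot :=
  ⟨⟨θ.1, c • θ.2⟩, rfl, map_smul _ c θ.2⟩

variable [Semigroup Ω]

/-- Bilinearity of the signed bracket and closure of `𝔏'` show that it is again a single homogeneous
element of `s⁻¹𝔏'`, which can be fed into an outer bracket. -/
theorem exists_signedBracket_eq {N M : ℕ} {F : Fam 𝕜 Ω (A × V) (A × V) N}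
    (hF : F ∈ LPrime 𝕜 Ω A V N) {G : Fam 𝕜 Ω (A × V) (A × V) M} (hG : G ∈ LPrime 𝕜 Ω A V M) :
    ∃ (H : Fam 𝕜 Ω (A × V) (A × V) (N + M)) (hH : H ∈ LPrime 𝕜 Ω A V (N + M)),
      (signedBracket (relL F hF).1 (relL G hG).1, 0) = relL H hH ∧
      DirectSum.lof 𝕜 ℕ (Fam 𝕜 Ω (A × V) (A × V)) (N + M) H = ksgn 𝕜 N •
        gerst (DirectSum.lof 𝕜 ℕ (Fam 𝕜 Ω (A × V) (A × V)) N F)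
          (DirectSum.lof 𝕜 ℕ (Fam 𝕜 Ω (A × V) (A × V)) M G) := by
  have h1 : ((signedBracket (relL F hF).1 (relL G hG).1 : TotLPrime 𝕜 Ω A V) :
      TotFam 𝕜 Ω (A × V) (A × V)) = ksgn 𝕜 N •
        gerst (DirectSum.lof 𝕜 ℕ (Fam 𝕜 Ω (A × V) (A × V)) N F)
          (DirectSum.lof 𝕜 ℕ (Fam 𝕜 Ω (A × V) (A × V)) M G) := by
    change gerst (parity (DirectSum.lof 𝕜 ℕ (Fam 𝕜 Ω (A × V) (A × V)) N F)) _ = _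
    rw [parity, DirectSum.lmap_lof, LinearMap.smul_apply, LinearMap.id_apply, map_smul, map_smul,
      LinearMap.smul_apply, ← ksgn_natCast]
    rfl
  obtain ⟨H, hH⟩ := Submodule.smul_mem _ (ksgn 𝕜 (N : ZMod 2))
    (gerst_mem_homog (lof_mem_homog F) (lof_mem_homog G))
  have h2 : H ∈ LPrime 𝕜 Ω A V (N + M) := by
    have h3 := (signedBracket (relL F hF).1 (relL G hG).1).2 (N + M)
    rw [h1, ← hH, DirectSum.lof_apply] at h3
    exact h3
  refine ⟨H, h2, Prod.ext (Subtype.ext ?_) rfl, hH⟩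
  rw [h1, ← hH]
  rfl

/-- The sequence with a new first entry. -/
def withBotSeq {ι X : Type*} (y : X) (x : ι → X) : WithBot ι → X := fun i =>
  WithBot.recBotCoe y x i

/-- The value of the inner bracket is the first argument of the outer one. Giving it the new least
index `⊥` keeps the arguments indexed by a linear order, so `modBracket_relL` applies to outer
brackets as well. -/
theorem cons_eq_withBotSeq {ι X : Type*} {k : ℕ} (y : X) (x : ι → X) (e : Fin k → ι) :
    (Fin.cons y fun b => x (e b) : Fin (k + 1) → X) = fun b => withBotSeq y x
      ((Fin.cons ⊥ fun b => (e b : WithBot ι) : Fin (k + 1) → WithBot ι) b) := by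
  funext b
  refine Fin.cases rfl (fun b => ?_) b
  rfl

section WithBot

variable {ι : Type*} [LinearOrder ι]

theorem strictMono_cons_bot {k : ℕ} {e : Fin k → ι} (he : StrictMono e) :
    StrictMono (Fin.cons ⊥ fun b => (e b : WithBot ι) : Fin (k + 1) → WithBot ι) := by
  intro i j hij
  induction j using Fin.cases with
  | zero => exact absurd hij (Fin.not_lt_zero i)
  | succ j =>
    induction i using Fin.cases with
    | zero => exact WithBot.bot_lt_coe _
    | succ i => exact WithBot.coe_lt_coe.2 (he (Fin.succ_lt_succ_iff.1 hij))

theorem image_cons_bot {k : ℕ} (e : Fin k → ι) :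
    Finset.univ.image (Fin.cons ⊥ fun b => (e b : WithBot ι) : Fin (k + 1) → WithBot ι) =
      insert ⊥ ((Finset.univ.image e).image fun i : ι => (i : WithBot ι)) := by
  ext v
  simp only [Finset.mem_image, Finset.mem_univ, true_and, Finset.mem_insert, Fin.exists_fin_succ,
    Fin.cons_zero, Fin.cons_succ, exists_exists_eq_and]
  rw [eq_comm]

theorem bot_notMem_image_coe (S : Finset ι) : (⊥ : WithBot ι) ∉ S.image fun i : ι => (i : WithBot ι) := by
  simp

theorem foldS_withBotSeq {X Y : Type*} [AddCommGroup X] [Module 𝕜 X] (b : X →ₗ[𝕜] X →ₗ[𝕜] X)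
    (u : X) (g : Y → X) (y : Y) (x : ι → Y) (S : Finset ι) :
    foldS b u (fun i => g (withBotSeq y x i)) (S.image fun i : ι => (i : WithBot ι)) =
      foldS b u (fun i => g (x i)) S := by
  rw [foldS_image]
  · rfl
  · exact fun i _ j _ hij => WithBot.coe_lt_coe.2 hij

theorem foldS_withBotSeq_insert {X Y : Type*} [AddCommGroup X] [Module 𝕜 X]
    (b : X →ₗ[𝕜] X →ₗ[𝕜] X) (u : X) (g : Y → X) (y : Y) (x : ι → Y) (S : Finset ι) :
    foldS b u (fun i => g (withBotSeq y x i)) (insert ⊥ (S.image fun i : ι => (i : WithBot ι))) =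
      foldS b (b u (g y)) (fun i => g (x i)) S := by
  rw [foldS_insert_min, foldS_withBotSeq]
  · rfl
  · intro i hi
    obtain ⟨j, -, rfl⟩ := Finset.mem_image.1 hi
    exact WithBot.bot_lt_coe j

variable (lam : 𝕜) (x : ι → RelSpace 𝕜 Ω A V) (θ : ι → HFam 𝕜 Ω V A)

theorem modBracket_cons_relL {k : ℕ} (e : Fin k → ι) (he : StrictMono e) (S : Finset ι)
    (hS : Finset.univ.image e = S) {N : ℕ} {F : Fam 𝕜 Ω (A × V) (A × V) N}
    (hF : F ∈ LPrime 𝕜 Ω A V N) (hx : ∀ i ∈ S, x i = relH (θ i)) :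
    modBracket lam (k + 1) (Fin.cons (relL F hF) fun b => x (e b)) = (0,
      lam ^ (N + 1 - k) • projTot (foldS gerst
        (DirectSum.lof 𝕜 ℕ (Fam 𝕜 Ω (A × V) (A × V)) N F) (fun i => inclTot (θ i).tot) S)) := by
  rw [cons_eq_withBotSeq, modBracket_relL lam k (withBotSeq (relL F hF) x) _
    (strictMono_cons_bot he) _ (image_cons_bot e) (Finset.mem_insert_self _ _) hF
    (withBotSeq ⟨0, 0⟩ θ) rfl, hS, Finset.erase_insert (bot_notMem_image_coe S)]
  · have h1 : (insert ⊥ (S.image fun i : ι => (i : WithBot ι))).filter (· < ⊥) = ∅ :=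
      Finset.filter_false_of_mem fun i _ => not_lt_bot
    rw [h1, Finset.sum_empty, mul_zero, ksgn_zero, one_smul,
      foldS_withBotSeq gerst _ (fun t : HFam 𝕜 Ω V A => inclTot t.tot)]
  · intro i hi hi'
    rw [hS] at hi
    obtain ⟨j, hj, rfl⟩ := Finset.mem_image.1 ((Finset.mem_insert.1 hi).resolve_left hi')
    exact hx j hj

/-- The entry from `s⁻¹𝔏'` passes `η` and the `θ_i` to its left, which gives the sign. As first
among the elements of `𝔞`, `η` is bracketed with `F` before all the others. -/
theorem modBracket_cons_relH {k : ℕ} (e : Fin k → ι) (he : StrictMono e) (S : Finset ι)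
    (hS : Finset.univ.image e = S) (η : HFam 𝕜 Ω V A) {b : ι} (hb : b ∈ S) {N : ℕ}
    {F : Fam 𝕜 Ω (A × V) (A × V) N} (hF : F ∈ LPrime 𝕜 Ω A V N) (hxb : x b = relL F hF)
    (hx : ∀ i ∈ S, i ≠ b → x i = relH (θ i)) :
    modBracket lam (k + 1) (Fin.cons (relH η) fun b => x (e b)) = (0,
      ksgn 𝕜 ((N + 1) * (η.1 + ∑ i ∈ S with i < b, ((θ i).1 : ZMod 2))) •
      lam ^ (N + 1 - k) • projTot (foldS gerst
        (gerst (DirectSum.lof 𝕜 ℕ (Fam 𝕜 Ω (A × V) (A × V)) N F) (inclTot η.tot))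
        (fun i => inclTot (θ i).tot) (S.erase b))) := by
  have hb' : (b : WithBot ι) ∈ insert ⊥ ((Finset.univ.image e).image fun i : ι => (i : WithBot ι)) := by
    rw [hS]
    exact Finset.mem_insert_of_mem (Finset.mem_image_of_mem _ hb)
  rw [cons_eq_withBotSeq, modBracket_relL lam k (withBotSeq (relH η) x) _
    (strictMono_cons_bot he) _ (image_cons_bot e) hb' hF (withBotSeq η θ) hxb, hS]
  · have h1 : ∑ i ∈ insert ⊥ (S.image fun i : ι => (i : WithBot ι)) with i < (b : WithBot ι),
        ((withBotSeq η θ i).1 : ZMod 2) = η.1 + ∑ i ∈ S with i < b, ((θ i).1 : ZMod 2) := by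
      rw [Finset.filter_insert, if_pos (WithBot.bot_lt_coe b), Finset.sum_insert, 
        Finset.filter_image, Finset.sum_image]
      · simp only [WithBot.coe_lt_coe]
        rfl
      · exact fun i _ j _ hij => WithBot.coe_injective hij
      · simp
    have h2 : (insert ⊥ (S.image fun i : ι => (i : WithBot ι))).erase (b : WithBot ι) =
        insert ⊥ ((S.erase b).image fun i : ι => (i : WithBot ι)) := by
      rw [Finset.erase_insert_of_ne WithBot.bot_ne_coe, Finset.image_erase WithBot.coe_injective]
    rw [h1, h2, foldS_withBotSeq_insert gerst _ (fun t : HFam 𝕜 Ω V A => inclTot t.tot)]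
  · intro i hi hi'
    rw [hS] at hi
    rcases Finset.mem_insert.1 hi with rfl | hi
    · rfl
    · obtain ⟨j, hj, rfl⟩ := Finset.mem_image.1 hi
      exact hx j hj fun h => hi' (congrArg _ h)

theorem projTot_foldS_gerst_gerst_eq_zero [Fintype ι] {N : ℕ}
    {F : Fam 𝕜 Ω (A × V) (A × V) N} (hF : F ∈ LPrime 𝕜 Ω A V N) (η : HFam 𝕜 Ω V A)
    (U : Finset ι) (hU : N + 1 < U.card + 1) :
    projTot (foldS gerst (gerst (DirectSum.lof 𝕜 ℕ (Fam 𝕜 Ω (A × V) (A × V)) N F)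
      (inclTot η.tot)) (fun i => inclTot (θ i).tot) U) = 0 := by
  have h := projTot_foldS_gerst_eq_zero hF (withBotSeq η θ)
    (insert ⊥ (U.image fun i : ι => (i : WithBot ι))) (by
      rwa [Finset.card_insert_of_notMem (bot_notMem_image_coe U),
        Finset.card_image_of_injective _ WithBot.coe_injective])
  rwa [foldS_withBotSeq_insert gerst _ (fun t : HFam 𝕜 Ω V A => inclTot t.tot)] at h

end WithBot

end Jacobi

/-! ### The generalised Jacobi identities -/

section JacobiTerms

variable {𝕜 Ω : Type*} [Field 𝕜] [Semigroup Ω]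
variable {A V : Type*} [AddCommGroup A] [Module 𝕜 A] [AddCommGroup V] [Module 𝕜 V]

theorem exists_relH_eq {N : ℕ} {F : Fam 𝕜 Ω (A × V) (A × V) N} {ι : Type*} [LinearOrder ι]
    (θ : ι → HFam 𝕜 Ω V A) (T : Finset ι) (c : 𝕜) :
    ∃ η : HFam 𝕜 Ω V A, η.1 = N + ∑ t ∈ T, (θ t).1 ∧ η.tot = c • projTot (foldS gerst
      (DirectSum.lof 𝕜 ℕ (Fam 𝕜 Ω (A × V) (A × V)) N F) (fun i => inclTot (θ i).tot) T) := by
  obtain ⟨η, h1, h2⟩ := exists_projTot_eq (foldS_gerst_mem (lof_mem_homog F)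
    (fun i => inclH_tot_mem (θ i)) T)
  obtain ⟨η', h3, h4⟩ := exists_smul_tot c η
  exact ⟨η', h3.trans h1, by rw [h4, h2]⟩

variable (lam : 𝕜) {n : ℕ} {x : Fin n → RelSpace 𝕜 Ω A V} {d : Fin n → ZMod 2}
  {θ : Fin n → HFam 𝕜 Ω V A} {a b : Fin n} {N M : ℕ} {F : Fam 𝕜 Ω (A × V) (A × V) N}
  {G : Fam 𝕜 Ω (A × V) (A × V) M}

/-- Normal form of a Jacobi term whose two arguments from `s⁻¹𝔏'` are separated: the inner bracket
lands in `𝔞` and becomes the first element bracketed with `G`. Apart from the last summand of the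
exponent, signs and powers of `λ` take a form common to all blocks. -/
theorem smul_jacobiTerm_of_mem_of_notMem (hab : a ≠ b) (hF : F ∈ LPrime 𝕜 Ω A V N)
    (hG : G ∈ LPrime 𝕜 Ω A V M) (hxa : x a = relL F hF) (hxb : x b = relL G hG)
    (hx : ∀ i, i ≠ a → i ≠ b → x i = relH (θ i)) (hda : d a = N + 1) (hdb : d b = M + 1)
    (hd : ∀ i, i ≠ a → i ≠ b → d i = (θ i).1) {i : Fin n} {σ : Equiv.Perm (Fin n)}
    (hσ : IsShuffle (i + 1) σ) {U T : Finset (Fin n)} (hU : (Finset.univ.erase a).erase b = U)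
    (hT : (firstBlock (i + 1) σ).erase a = T)
    (ha : a ∈ firstBlock (i + 1) σ) (hb : b ∉ firstBlock (i + 1) σ) :
    ksgn 𝕜 (koszulExp σ d) • jacobiTerm (modBracket lam) x i σ = (0,
      ksgn 𝕜 ((N + 1) * ∑ i ∈ U with i < a, ((θ i).1 : ZMod 2) +
        (M + 1) * ∑ i ∈ U with i < b, ((θ i).1 : ZMod 2) +
        invExp (fun i => ((θ i).1 : ZMod 2)) T (U \ T) + (M + 1) * N +
        if b < a then ((N : ZMod 2) + 1) * (M + 1) else 0) •
      lam ^ (N + M + 1 - (n - 2)) • projTot (foldS gerst (gerst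
        (DirectSum.lof 𝕜 ℕ (Fam 𝕜 Ω (A × V) (A × V)) M G) (inclTot (projTot (foldS gerst
          (DirectSum.lof 𝕜 ℕ (Fam 𝕜 Ω (A × V) (A × V)) N F) (fun i => inclTot (θ i).tot) T))))
        (fun i => inclTot (θ i).tot) (U \ T))) := by
  have hi := i.2
  set S := firstBlock (i + 1) σ with hS
  have haT : a ∉ T := hT ▸ Finset.notMem_erase a S
  have hbT : b ∉ T := fun h => hb (Finset.mem_of_mem_erase (hT.symm ▸ h))
  have hST : S = insert a T := by rw [← hT, Finset.insert_erase ha]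
  have hbR : b ∉ U \ T := by
    rw [← hU]
    simp
  have haR : a ∉ U \ T := by
    rw [← hU]
    simp
  have hcompl : Sᶜ = insert b (U \ T) := by
    rw [hST, ← hU]
    ext v
    simp only [Finset.mem_compl, Finset.mem_insert, Finset.mem_sdiff, Finset.mem_erase,
      Finset.mem_univ, and_true, not_or]
    by_cases hv : v = b
    · subst hv
      simp [hab.symm, hbT]
    · simp [hv]
  have hTU : T ⊆ U := by
    intro v hv
    rw [← hU]
    simp only [Finset.mem_erase, Finset.mem_univ, and_true]
    exact ⟨fun h => hbT (h ▸ hv), fun h => haT (h ▸ hv)⟩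
  have hcardT : T.card = i := by
    have := card_firstBlock i σ
    rw [← hS, hST, Finset.card_insert_of_notMem haT] at this
    omega
  have hcardR : (U \ T).card + 2 + i = n := by
    have h1 : (Sᶜ).card = n - S.card := by rw [Finset.card_compl, Fintype.card_fin]
    rw [card_firstBlock, hcompl, Finset.card_insert_of_notMem hbR] at h1
    omega
  obtain ⟨η, hη1, hη2⟩ := exists_relH_eq (F := F) θ T (ksgn 𝕜 ((N + 1) *
    ∑ i ∈ T with i < a, ((θ i).1 : ZMod 2)) * lam ^ (N + 1 - (i : ℕ)))
  have hfilt : S.filter (· < a) = T.filter (· < a) := by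
    rw [hST, Finset.filter_insert, if_neg (lt_irrefl a)]
  have inner : modBracket lam (i + 1) (fun c : Fin (i + 1) => x (σ ⟨c, by omega⟩)) = relH η := by
    rw [modBracket_relL lam i x (fun c : Fin (i + 1) => σ ⟨c, by omega⟩)
      (strictMono_firstBlock i hσ) S (image_firstBlock i σ) ha hF θ hxa]
    · rw [relH, hη2, hT, hfilt, mul_smul]
    · intro j hj hja
      exact hx j hja fun h => hb (h ▸ hj)
  have outer := modBracket_cons_relH lam x θ
    (fun c : Fin (n - (i + 1)) => σ ⟨i + 1 + c, by omega⟩)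
    (strictMono_secondBlock i hσ) Sᶜ (image_secondBlock i σ) η (b := b)
    (Finset.mem_compl.2 hb) hG hxb (by
      intro j hj hjb
      exact hx j (fun h => Finset.mem_compl.1 hj (h ▸ ha)) hjb)
  have hfilt' : Sᶜ.filter (· < b) = (U \ T).filter (· < b) := by
    rw [hcompl, Finset.filter_insert, if_neg (lt_irrefl b)]
  rw [jacobiTerm, inner, outer, hfilt', hcompl, Finset.erase_insert hbR, koszulExp_shuffle hσ,
    ← hS, hcompl, hST, invExp_insert_left d haT, invExp_insert_right d hbR, hη1, hη2, map_smul,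
    map_smul, foldS_smul, map_smul, Prod.smul_mk, smul_zero]
  refine Prod.ext rfl ?_
  dsimp only
  -- The truncated exponents of `λ` add up correctly only if neither bracket takes more elements of
  -- `𝔞` than its arity; otherwise both sides are zero.
  by_cases h1 : N + 1 < T.card
  · rw [projTot_foldS_gerst_eq_zero hF θ T h1]
    simp [foldS_zero]
  by_cases h2 : M + 1 < (U \ T).card + 1
  · obtain ⟨η', -, h4⟩ := exists_relH_eq (F := F) θ T 1
    rw [one_smul] at h4
    rw [← h4, projTot_foldS_gerst_gerst_eq_zero θ hG η' _ h2]
    simp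
  have hpow : lam ^ (N + M + 1 - (n - 2)) =
      lam ^ (M + 1 - (n - ((i : ℕ) + 1))) * lam ^ (N + 1 - (i : ℕ)) := by
    rw [← pow_add]
    congr 1
    omega
  rw [hpow]
  simp only [smul_smul]
  congr 1
  have hsum1 : ∀ s ∈ U \ T, d s = (θ s).1 := fun s hs =>
    hd s (fun h => haR (h ▸ hs)) fun h => hbR (h ▸ hs)
  have hsum2 : ∀ s ∈ T, d s = (θ s).1 := fun s hs =>
    hd s (fun h => haT (h ▸ hs)) fun h => hbT (h ▸ hs)
  have e1 : invExp d T (U \ T) = invExp (fun i => ((θ i).1 : ZMod 2)) T (U \ T) := by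
    refine Finset.sum_congr rfl fun t ht => Finset.sum_congr rfl fun s hs => ?_
    rw [hsum2 t ht, hsum1 s (Finset.mem_filter.1 hs).1]
  -- The Koszul sign counts the elements of `T` to the right of `b`, the outer bracket counts all of
  -- `T`; modulo 2 those to the left of `b` remain.
  have e2 : ∑ t ∈ T with b < t, d t + ∑ t ∈ T with t < b, ((θ t).1 : ZMod 2) =
      ∑ t ∈ T, ((θ t).1 : ZMod 2) := by
    rw [← Finset.sum_filter_add_sum_filter_not T (fun t => b < t)]
    congr 1
    · exact Finset.sum_congr rfl fun t ht => hsum2 t (Finset.mem_filter.1 ht).1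
    · refine Finset.sum_congr (Finset.filter_congr fun t ht => ?_) fun _ _ => rfl
      exact ⟨fun h => h.not_gt, fun h => (not_lt.1 h).lt_of_ne fun h' => hbT (h' ▸ ht)⟩
  have e3 : ∀ c, ∑ s ∈ U with s < c, ((θ s).1 : ZMod 2) =
      ∑ s ∈ T with s < c, ((θ s).1 : ZMod 2) + ∑ s ∈ U \ T with s < c, ((θ s).1 : ZMod 2) := by
    intro c
    simp only [Finset.sum_filter]
    rw [add_comm, Finset.sum_sdiff hTU]
  have e4 : ∑ s ∈ insert b (U \ T) with s < a, d s = (if b < a then d b else 0) +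
      ∑ s ∈ U \ T with s < a, ((θ s).1 : ZMod 2) := by
    rw [Finset.sum_filter, Finset.sum_insert hbR, Finset.sum_filter]
    congr 1
    exact Finset.sum_congr rfl fun s hs => by rw [hsum1 s hs]
  rw [e1, e3 a, e3 b, e4, hda, hdb]
  have e5 := eq_sub_of_add_eq e2
  rw [e5]
  rw [mul_left_comm (lam ^ _), ← mul_assoc, ← mul_assoc, ← ksgn_add, ← ksgn_add]
  congr 2
  push_cast
  generalize (∑ s ∈ T with s < a, ((θ s).1 : ZMod 2)) = u1
  generalize (∑ s ∈ T with s < b, ((θ s).1 : ZMod 2)) = u2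
  generalize (∑ s ∈ U \ T with s < a, ((θ s).1 : ZMod 2)) = u3
  generalize (∑ s ∈ U \ T with s < b, ((θ s).1 : ZMod 2)) = u4
  generalize (∑ s ∈ T, ((θ s).1 : ZMod 2)) = u5
  generalize invExp (fun i => ((θ i).1 : ZMod 2)) T (U \ T) = u6
  generalize (N : ZMod 2) = u7
  generalize (M : ZMod 2) = u8
  split_ifs
  · linear_combination ((u8 + 1) * (u5 - u2)) * two_eq_zero_zmod
  · linear_combination ((u8 + 1) * (u5 - u2)) * two_eq_zero_zmod

/-- Here the inner bracket is the Lie part, with value in `s⁻¹𝔏'`, and the outer bracket is the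
derived bracket of `[F, G]`, of arity `N + M + 1`, with all remaining arguments. -/
theorem smul_jacobiTerm_of_eq_pair (hab : a < b) (hF : F ∈ LPrime 𝕜 Ω A V N)
    (hG : G ∈ LPrime 𝕜 Ω A V M) (hxa : x a = relL F hF) (hxb : x b = relL G hG)
    (hx : ∀ i, i ≠ a → i ≠ b → x i = relH (θ i)) (hda : d a = N + 1) (hdb : d b = M + 1)
    (hd : ∀ i, i ≠ a → i ≠ b → d i = (θ i).1) {i : Fin n} {σ : Equiv.Perm (Fin n)}
    (hσ : IsShuffle (i + 1) σ) {U : Finset (Fin n)} (hU : (Finset.univ.erase a).erase b = U)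
    (hS : firstBlock (i + 1) σ = {a, b}) :
    ksgn 𝕜 (koszulExp σ d) • jacobiTerm (modBracket lam) x i σ = (0,
      ksgn 𝕜 ((N + 1) * ∑ i ∈ U with i < a, ((θ i).1 : ZMod 2) +
        (M + 1) * ∑ i ∈ U with i < b, ((θ i).1 : ZMod 2) + N) •
      lam ^ (N + M + 1 - (n - 2)) • projTot (foldS gerst (gerst
        (DirectSum.lof 𝕜 ℕ (Fam 𝕜 Ω (A × V) (A × V)) N F)
        (DirectSum.lof 𝕜 ℕ (Fam 𝕜 Ω (A × V) (A × V)) M G))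
        (fun i => inclTot (θ i).tot) U)) := by
  have hi := i.2
  have hi1 : (i : ℕ) = 1 := by
    have := card_firstBlock i σ
    rw [hS, Finset.card_pair hab.ne] at this
    omega
  have hcompl : ({a, b} : Finset (Fin n))ᶜ = U := by
    rw [← hU]
    ext v
    simp only [Finset.mem_compl, Finset.mem_insert, Finset.mem_singleton, Finset.mem_erase,
      Finset.mem_univ, and_true, not_or]
    exact and_comm
  obtain ⟨H, hH, hH1, hH2⟩ := exists_signedBracket_eq hF hG
  have himg := image_firstBlock i σ
  have hmono := strictMono_firstBlock i hσ
  have inner : modBracket lam (i + 1) (fun c : Fin (i + 1) => x (σ ⟨c, by omega⟩)) =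
      relL H hH := by
    obtain ⟨iv, hiv⟩ := i
    dsimp only at hi1
    subst hi1
    rw [hS] at himg
    have h0 : ∀ c : Fin 2, σ ⟨c, by omega⟩ = a ∨ σ ⟨c, by omega⟩ = b := fun c => by
      have := himg ▸ Finset.mem_image_of_mem (fun c : Fin 2 => σ ⟨c, by omega⟩) (Finset.mem_univ c)
      simpa using this
    have h01 : σ ⟨(0 : Fin 2), by omega⟩ < σ ⟨(1 : Fin 2), by omega⟩ := hmono Fin.zero_lt_one
    have hs : σ ⟨(0 : Fin 2), by omega⟩ = a ∧ σ ⟨(1 : Fin 2), by omega⟩ = b := by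
      rcases h0 0 with h2 | h2 <;> rcases h0 1 with h3 | h3
      · rw [h2, h3] at h01
        exact absurd h01 (lt_irrefl _)
      · exact ⟨h2, h3⟩
      · rw [h2, h3] at h01
        exact absurd h01 hab.not_gt
      · rw [h2, h3] at h01
        exact absurd h01 (lt_irrefl _)
    change modBracket lam 2 (fun c : Fin 2 => x (σ ⟨c, by omega⟩)) = _
    rw [modBracket_two_apply, derivedPart_eq_zero_of_snd lam 1 _ (i := 0) (j := 1) zero_ne_one,
      add_zero, liePart_apply]
    · change (signedBracket (x (σ ⟨(0 : Fin 2), by omega⟩)).1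
        (x (σ ⟨(1 : Fin 2), by omega⟩)).1, 0) = _
      rw [hs.1, hs.2, hxa, hxb, hH1]
    · change (x (σ ⟨(0 : Fin 2), by omega⟩)).2 = 0
      rw [hs.1, hxa]
      rfl
    · change (x (σ ⟨(1 : Fin 2), by omega⟩)).2 = 0
      rw [hs.2, hxb]
      rfl
  have haU : a ∉ U := by
    rw [← hU]
    simp
  have hbU : b ∉ U := by
    rw [← hU]
    simp
  have outer := modBracket_cons_relL lam x θ
    (fun c : Fin (n - (i + 1)) => σ ⟨i + 1 + c, by omega⟩)
    (strictMono_secondBlock i hσ) U (by rw [image_secondBlock i σ, hS, hcompl]) hH (by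
      intro j hj
      exact hx j (fun h => haU (h ▸ hj)) fun h => hbU (h ▸ hj))
  rw [jacobiTerm, inner, outer, koszulExp_shuffle hσ, hS, hcompl, hH2,
    invExp_insert_left d (by simpa using hab.ne), ← insert_empty_eq,
    invExp_insert_left d (Finset.notMem_empty b), foldS_smul, map_smul, Prod.smul_mk, smul_zero,
    hi1]
  refine Prod.ext rfl ?_
  dsimp only
  rw [smul_comm (lam ^ _), smul_smul, ← ksgn_add]
  have hsum : ∀ c, ∑ s ∈ U with s < c, d s = ∑ s ∈ U with s < c, ((θ s).1 : ZMod 2) := fun c =>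
    Finset.sum_congr rfl fun s hs => by
      have hs := (Finset.mem_filter.1 hs).1
      exact hd s (fun h => haU (h ▸ hs)) fun h => hbU (h ▸ hs)
  rw [hsum, hsum, hda, hdb]
  congr 2
  simp [invExp]

end JacobiTerms

section JacobiSum

variable {𝕜 Ω : Type*} [Field 𝕜] [Semigroup Ω]
variable {A V : Type*} [AddCommGroup A] [Module 𝕜 A] [AddCommGroup V] [Module 𝕜 V]
variable (lam : 𝕜) {n : ℕ} {x : Fin n → RelSpace 𝕜 Ω A V} {d : Fin n → ZMod 2}

/-! ### Jacobi terms with too few or too many arguments from `s⁻¹𝔏'` -/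

section Vanishing

variable {a b c : Fin n} {i : Fin n} {σ : Equiv.Perm (Fin n)}

theorem jacobiTerm_eq_zero_of_inner
    (h : modBracket lam (i + 1) (fun a : Fin (i + 1) => x (σ ⟨a, by omega⟩)) = 0) :
    jacobiTerm (modBracket lam) x i σ = 0 := by
  rw [jacobiTerm, h]
  exact MultilinearMap.map_coord_zero _ 0 rfl

theorem exists_index_of_mem_firstBlock (ha : a ∈ firstBlock (i + 1) σ) :
    ∃ t : Fin (i + 1), σ ⟨t, by omega⟩ = a :=
  ⟨⟨σ.symm a, mem_firstBlock.1 ha⟩, σ.apply_symm_apply a⟩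

theorem exists_index_of_notMem_firstBlock (ha : a ∉ firstBlock (i + 1) σ) :
    ∃ t : Fin (n - (i + 1)), σ ⟨i + 1 + t, by omega⟩ = a := by
  rw [mem_firstBlock, not_lt] at ha
  refine ⟨⟨σ.symm a - (i + 1), by omega⟩, σ.symm.injective (Fin.ext ?_)⟩
  simp only [Equiv.symm_apply_apply]
  omega

theorem jacobiTerm_eq_zero_of_fst (h : ∀ v ∈ firstBlock (i + 1) σ, (x v).1 = 0) :
    jacobiTerm (modBracket lam) x i σ = 0 := by
  refine jacobiTerm_eq_zero_of_inner lam (modBracket_eq_zero_of_fst lam _ _ fun t => h _ ?_)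
  rw [mem_firstBlock, Equiv.symm_apply_apply]
  exact t.2

theorem jacobiTerm_eq_zero_of_mem (hab : a ≠ b) (ha : a ∈ firstBlock (i + 1) σ)
    (hb : b ∈ firstBlock (i + 1) σ) (hxa : (x a).2 = 0) (hxb : (x b).2 = 0) (hi : 2 ≤ (i : ℕ)) :
    jacobiTerm (modBracket lam) x i σ = 0 := by
  obtain ⟨s, rfl⟩ := exists_index_of_mem_firstBlock ha
  obtain ⟨t, rfl⟩ := exists_index_of_mem_firstBlock hb
  exact jacobiTerm_eq_zero_of_inner lam (modBracket_eq_zero_of_snd lam _ (by omega) _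
    (fun h => hab (by rw [h])) hxa hxb)

theorem jacobiTerm_eq_zero_of_notMem (hab : a ≠ b) (ha : a ∉ firstBlock (i + 1) σ)
    (hb : b ∉ firstBlock (i + 1) σ) (hxa : (x a).2 = 0) (hxb : (x b).2 = 0) :
    jacobiTerm (modBracket lam) x i σ = 0 := by
  obtain ⟨s, rfl⟩ := exists_index_of_notMem_firstBlock ha
  obtain ⟨t, rfl⟩ := exists_index_of_notMem_firstBlock hb
  have hst : s ≠ t := fun h => hab (by rw [h])
  have hst' : (s : ℕ) ≠ t := fun h => hst (Fin.ext h)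
  refine modBracket_eq_zero_of_snd lam _ ?_ _ (i := s.succ) (j := t.succ)
    (fun h => hst (Fin.succ_injective _ h)) hxa hxb
  omega

/-- Either the inner bracket has at least three arguments, two of them from `s⁻¹𝔏'`, or it is the
Lie bracket of these two. In the latter case its value and `x c` are two arguments from `s⁻¹𝔏'` of
an outer bracket with at least three, because `4 ≤ n`. -/
theorem jacobiTerm_eq_zero_of_mem_of_mem (hn : 4 ≤ n) (hab : a ≠ b) (hac : a ≠ c) (hbc : b ≠ c)
    (ha : a ∈ firstBlock (i + 1) σ) (hb : b ∈ firstBlock (i + 1) σ) (hxa : (x a).2 = 0)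
    (hxb : (x b).2 = 0) (hxc : (x c).2 = 0) : jacobiTerm (modBracket lam) x i σ = 0 := by
  by_cases hi : 2 ≤ (i : ℕ)
  · exact jacobiTerm_eq_zero_of_mem lam hab ha hb hxa hxb hi
  have hcard := card_firstBlock i σ
  have h2 : ({a, b} : Finset (Fin n)) ⊆ firstBlock (i + 1) σ := by
    intro v hv
    rcases Finset.mem_insert.1 hv with rfl | hv
    · exact ha
    · rwa [Finset.mem_singleton.1 hv]
  have h3 := Finset.card_le_card h2
  rw [Finset.card_pair hab] at h3
  have hc : c ∉ firstBlock (i + 1) σ := by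
    rw [← Finset.eq_of_subset_of_card_le h2 (by rw [Finset.card_pair hab]; omega)]
    simp [hac.symm, hbc.symm]
  obtain ⟨s, rfl⟩ := exists_index_of_mem_firstBlock ha
  obtain ⟨t, rfl⟩ := exists_index_of_mem_firstBlock hb
  obtain ⟨r, rfl⟩ := exists_index_of_notMem_firstBlock hc
  refine modBracket_eq_zero_of_snd lam _ (by omega) _ (i := 0) (j := r.succ)
    (Fin.succ_ne_zero r).symm ?_ hxc
  obtain ⟨iv, hiv⟩ := i
  obtain rfl : iv = 1 := by dsimp only at hcard h3 hi; omega
  change (modBracket lam 2 _).2 = 0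
  rw [modBracket_two_apply, derivedPart_eq_zero_of_snd lam 1 _ (i := s) (j := t)
    (fun h => hab (by rw [h])) hxa hxb, add_zero]
  rfl

/-- Two of the three indices lie on the same side of the shuffle. -/
theorem jacobiTerm_eq_zero_of_three (hn : 4 ≤ n) (hab : a ≠ b) (hac : a ≠ c) (hbc : b ≠ c)
    (hxa : (x a).2 = 0) (hxb : (x b).2 = 0) (hxc : (x c).2 = 0) :
    jacobiTerm (modBracket lam) x i σ = 0 := by
  by_cases ha : a ∈ firstBlock (i + 1) σ
  · by_cases hb : b ∈ firstBlock (i + 1) σ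
    · exact jacobiTerm_eq_zero_of_mem_of_mem lam hn hab hac hbc ha hb hxa hxb hxc
    · by_cases hc : c ∈ firstBlock (i + 1) σ
      · exact jacobiTerm_eq_zero_of_mem_of_mem lam hn hac hab hbc.symm ha hc hxa hxc hxb
      · exact jacobiTerm_eq_zero_of_notMem lam hbc hb hc hxb hxc
  · by_cases hb : b ∈ firstBlock (i + 1) σ
    · by_cases hc : c ∈ firstBlock (i + 1) σ
      · exact jacobiTerm_eq_zero_of_mem_of_mem lam hn hbc hab.symm hac.symm hb hc hxb hxc hxa
      · exact jacobiTerm_eq_zero_of_notMem lam hac ha hc hxa hxc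
    · exact jacobiTerm_eq_zero_of_notMem lam hab ha hb hxa hxb

/-- If the inner bracket contains the argument from `s⁻¹𝔏'`, its value lies in `𝔞` and the outer
bracket has no such argument left; otherwise the inner bracket has none. -/
theorem jacobiTerm_eq_zero_of_one (h : ∀ v, v ≠ a → (x v).1 = 0) :
    jacobiTerm (modBracket lam) x i σ = 0 := by
  by_cases ha : a ∈ firstBlock (i + 1) σ
  · have h1 : (modBracket lam (i + 1) (fun a : Fin (i + 1) => x (σ ⟨a, by omega⟩))).1 = 0 := by
      obtain ⟨s, hs⟩ := exists_index_of_mem_firstBlock ha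
      rcases Nat.eq_zero_or_pos (i : ℕ) with hi | hi
      · obtain ⟨iv, hiv⟩ := i
        dsimp only at hi
        subst hi
        rfl
      · have : Nontrivial (Fin (i + 1)) := Fin.nontrivial_iff_two_le.2 (by omega)
        obtain ⟨t, ht⟩ := exists_ne s
        refine modBracket_fst_eq_zero lam _ _ t (h _ fun h' => ht ?_)
        have := σ.injective (h'.trans hs.symm)
        exact Fin.ext (Fin.mk.inj this)
    refine modBracket_eq_zero_of_fst lam _ _ fun t => ?_
    induction t using Fin.cases with
    | zero => exact h1
    | succ t =>
      refine h _ fun h' => ?_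
      rw [← h', mem_firstBlock, Equiv.symm_apply_apply] at ha
      dsimp only at ha
      omega
  · exact jacobiTerm_eq_zero_of_fst lam fun v hv => h v fun hva => ha (hva ▸ hv)

end Vanishing

/-- The core of the Jacobi identity. Each term depends only on the first block `S`: it may contain
`a` only, `b` only, or be `{a, b}`, and all other blocks give zero. Expanding the term of `{a, b}`
by `projTot_foldS_gerst_gerst` gives, for each set `T` of the remaining indices, the negatives of
the terms of `insert a T` and `insert b T`. -/
theorem sum_jacobiTerm_pair {θ : Fin n → HFam 𝕜 Ω V A} {a b : Fin n} {N M : ℕ}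
    {F : Fam 𝕜 Ω (A × V) (A × V) N} {G : Fam 𝕜 Ω (A × V) (A × V) M} (hab : a < b)
    (hF : F ∈ LPrime 𝕜 Ω A V N) (hG : G ∈ LPrime 𝕜 Ω A V M) (hxa : x a = relL F hF)
    (hxb : x b = relL G hG) (hx : ∀ i, i ≠ a → i ≠ b → x i = relH (θ i)) (hda : d a = N + 1)
    (hdb : d b = M + 1) (hd : ∀ i, i ≠ a → i ≠ b → d i = (θ i).1) [∀ i : Fin n,
      DecidablePred fun σ : Equiv.Perm (Fin n) => IsShuffle ((i : ℕ) + 1) σ] :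
    ∑ i : Fin n, ∑ σ : Equiv.Perm (Fin n) with IsShuffle ((i : ℕ) + 1) σ,
      ksgn 𝕜 (koszulExp σ d) • jacobiTerm (modBracket lam) x i σ = 0 := by
  classical
  set U := (Finset.univ.erase a).erase b with hU
  have hU' : (Finset.univ.erase b).erase a = U := Finset.erase_right_comm
  have haU : a ∉ U := by simp [hU]
  have hbU : b ∉ U := by simp [hU]
  have haU' : a ∉ insert b U := by simp [hU, hab.ne]
  have hins : insert a (insert b U) = Finset.univ := by
    rw [hU, Finset.insert_erase (by simp [hab.ne']), Finset.insert_erase (Finset.mem_univ a)]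
  set E : ZMod 2 := (N + 1) * ∑ i ∈ U with i < a, ((θ i).1 : ZMod 2) +
        (M + 1) * ∑ i ∈ U with i < b, ((θ i).1 : ZMod 2) with hE
  set u := DirectSum.lof 𝕜 ℕ (Fam 𝕜 Ω (A × V) (A × V)) N F with hu
  set v := DirectSum.lof 𝕜 ℕ (Fam 𝕜 Ω (A × V) (A × V)) M G with hv
  set X : Fin n → TotFam 𝕜 Ω (A × V) (A × V) := fun i => inclTot (θ i).tot with hX
  set inv : Finset (Fin n) → ZMod 2 :=
    fun T => invExp (fun i => ((θ i).1 : ZMod 2)) T (U \ T) with hinv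
  set w := N + M + 1 - (n - 2) with hw
  let Φ : Finset (Fin n) → TotFam 𝕜 Ω V A := fun S =>
    if a ∈ S then
      if b ∈ S then
        if S = {a, b} then
          ksgn 𝕜 (E + N) • lam ^ w • projTot (foldS gerst (gerst u v) X U)
        else 0
      else ksgn 𝕜 (E + inv (S.erase a) + (M + 1) * N) • lam ^ w •
        projTot (foldS gerst (gerst v (inclTot (projTot (foldS gerst u X (S.erase a))))) X
          (U \ S.erase a))
    else
      if b ∈ S then
        ksgn 𝕜 (E + inv (S.erase b) + N + 1) • lam ^ w •
          projTot (foldS gerst (gerst u (inclTot (projTot (foldS gerst v X (S.erase b))))) X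
            (U \ S.erase b))
      else 0
  have key : ∀ (i : Fin n) (σ : Equiv.Perm (Fin n)), IsShuffle ((i : ℕ) + 1) σ →
      ksgn 𝕜 (koszulExp σ d) • jacobiTerm (modBracket lam) x i σ =
        ((0, Φ (firstBlock (i + 1) σ)) : RelSpace 𝕜 Ω A V) := by
    intro i σ hσ
    by_cases ha : a ∈ firstBlock (i + 1) σ
    · by_cases hb : b ∈ firstBlock (i + 1) σ
      · by_cases hS : firstBlock (i + 1) σ = {a, b}
        · rw [smul_jacobiTerm_of_eq_pair lam hab hF hG hxa hxb hx hda hdb hd hσ hU.symm hS]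
          simp only [Φ, hS]
          simp
          rfl
        · have hsub : ({a, b} : Finset (Fin n)) ⊆ firstBlock (i + 1) σ := by
            intro v hv
            rcases Finset.mem_insert.1 hv with rfl | hv
            · exact ha
            · rwa [Finset.mem_singleton.1 hv]
          have hlt := Finset.card_lt_card (hsub.ssubset_of_ne fun h => hS h.symm)
          rw [Finset.card_pair hab.ne, card_firstBlock] at hlt
          rw [jacobiTerm_eq_zero_of_mem lam hab.ne ha hb (by rw [hxa]; rfl) (by rw [hxb]; rfl)
            (by omega), smul_zero]
          simp only [Φ, if_pos ha, if_pos hb, if_neg hS]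
          rfl
      · rw [smul_jacobiTerm_of_mem_of_notMem lam hab.ne hF hG hxa hxb hx hda hdb hd hσ hU.symm rfl
          ha hb, if_neg hab.not_gt, add_zero]
        simp only [Φ, if_pos ha, if_neg hb]
        rfl
    · by_cases hb : b ∈ firstBlock (i + 1) σ
      · rw [smul_jacobiTerm_of_mem_of_notMem lam hab.ne' hG hF hxb hxa (fun i h h' => hx i h' h)
          hdb hda (fun i h h' => hd i h' h) hσ hU' rfl hb ha, if_pos hab]
        simp only [Φ, if_neg ha, if_pos hb]
        refine Prod.ext rfl ?_
        rw [hw, add_comm N M]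
        dsimp only
        congr 2
        rw [hE]
        change _ + _ + inv _ + _ + _ = _
        linear_combination (M : ZMod 2) * ((N : ZMod 2) + 1) * two_eq_zero_zmod
      · rw [jacobiTerm_eq_zero_of_fst lam, smul_zero]
        · simp only [Φ, if_neg ha, if_neg hb]
          rfl
        · intro v hv
          rw [hx v (fun h => ha (h ▸ hv)) fun h => hb (h ▸ hv)]
          rfl
  have hsum : ∑ S : Finset (Fin n) with S.Nonempty, Φ S = 0 := by
    have h0 : ∑ S : Finset (Fin n) with S.Nonempty, Φ S = ∑ S : Finset (Fin n), Φ S := by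
      refine Finset.sum_filter_of_ne fun S _ hS => ?_
      rw [Finset.nonempty_iff_ne_empty]
      rintro rfl
      exact hS rfl
    -- The subsets are sorted by whether they contain `a` and `b`; `T` is the part inside `U`.
    rw [h0, ← Finset.powerset_univ, ← hins, Finset.sum_powerset_insert haU',
      Finset.sum_powerset_insert hbU, Finset.sum_powerset_insert hbU]
    have hmem : ∀ T ∈ U.powerset, a ∉ T ∧ b ∉ T := fun T hT =>
      ⟨fun h => haU (Finset.mem_powerset.1 hT h), fun h => hbU (Finset.mem_powerset.1 hT h)⟩
    have s1 : ∑ T ∈ U.powerset, Φ T = 0 := Finset.sum_eq_zero fun T hT => by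
      simp only [Φ, if_neg (hmem T hT).1, if_neg (hmem T hT).2]
    have s2 : ∑ T ∈ U.powerset, Φ (insert b T) = ∑ T ∈ U.powerset,
        ksgn 𝕜 (E + inv T + N + 1) • lam ^ w •
          projTot (foldS gerst (gerst u (inclTot (projTot (foldS gerst v X T)))) X (U \ T)) := by
      refine Finset.sum_congr rfl fun T hT => ?_
      have ha' : a ∉ insert b T := by simp [hab.ne, (hmem T hT).1]
      simp only [Φ, if_neg ha', if_pos (Finset.mem_insert_self b T),
        Finset.erase_insert (hmem T hT).2]
    have s3 : ∑ T ∈ U.powerset, Φ (insert a T) = ∑ T ∈ U.powerset,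
        ksgn 𝕜 (E + inv T + (M + 1) * N) • lam ^ w •
          projTot (foldS gerst (gerst v (inclTot (projTot (foldS gerst u X T)))) X (U \ T)) := by
      refine Finset.sum_congr rfl fun T hT => ?_
      have hb' : b ∉ insert a T := by simp [hab.ne', (hmem T hT).2]
      simp only [Φ, if_neg hb', if_pos (Finset.mem_insert_self a T),
        Finset.erase_insert (hmem T hT).1]
    have s4 : ∑ T ∈ U.powerset, Φ (insert a (insert b T)) =
        ksgn 𝕜 (E + N) • lam ^ w • projTot (foldS gerst (gerst u v) X U) := by
      rw [Finset.sum_eq_single ∅]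
      · simp only [Φ]
        simp
      · intro T hT hT0
        have h1 : insert a (insert b T) ≠ {a, b} := by
          intro h
          obtain ⟨t, ht⟩ := Finset.nonempty_iff_ne_empty.2 hT0
          have : t ∈ ({a, b} : Finset (Fin n)) := h ▸ (by simp [ht])
          rcases Finset.mem_insert.1 this with rfl | h2
          · exact (hmem T hT).1 ht
          · rw [Finset.mem_singleton.1 h2] at ht
            exact (hmem T hT).2 ht
        simp only [Φ, if_neg h1]
        simp
      · simp
    rw [s1, s2, s3, s4, projTot_foldS_gerst_gerst (lof_mem_homog F) (lof_mem_homog G) θ U,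
      Finset.smul_sum, Finset.smul_sum, zero_add, ← Finset.sum_add_distrib,
      ← Finset.sum_add_distrib]
    refine Finset.sum_eq_zero fun T _ => ?_
    change _ • lam ^ w • projTot (foldS gerst (gerst u (inclTot (projTot (foldS gerst v X T)))) X
      (U \ T)) + (_ • lam ^ w • projTot (foldS gerst (gerst v (inclTot (projTot (foldS gerst u X
      T)))) X (U \ T)) + _ • lam ^ w • (ksgn 𝕜 (inv T + 1 + N * M) • projTot (foldS gerst (gerst v
      (inclTot (projTot (foldS gerst u X T)))) X (U \ T)) + ksgn 𝕜 (inv T) • projTot (foldS gerst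
      (gerst u (inclTot (projTot (foldS gerst v X T)))) X (U \ T)))) = 0
    rw [smul_add, smul_add, smul_comm (lam ^ w), smul_comm (lam ^ w),
      smul_smul (ksgn 𝕜 (E + N)), smul_smul (ksgn 𝕜 (E + N)), ← ksgn_add, ← ksgn_add]
    -- The exponents of matching terms differ by one, which is the cancellation.
    have e1 : E + N + (inv T + 1 + N * M) = (E + inv T + (M + 1) * N) + 1 := by ring
    have e2 : E + inv T + N + 1 = (E + N + inv T) + 1 := by ring
    rw [e1, e2, ← neg_ksgn, ← neg_ksgn, neg_smul, neg_smul]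
    abel
  calc _ = ∑ i : Fin n, ∑ σ : Equiv.Perm (Fin n) with IsShuffle ((i : ℕ) + 1) σ,
        LinearMap.inr 𝕜 (TotLPrime 𝕜 Ω A V) (TotFam 𝕜 Ω V A) (Φ (firstBlock (i + 1) σ)) :=
        Finset.sum_congr rfl fun i _ => Finset.sum_congr rfl fun σ hσ =>
          key i σ (Finset.mem_filter.1 hσ).2
    _ = LinearMap.inr 𝕜 (TotLPrime 𝕜 Ω A V) (TotFam 𝕜 Ω V A)
        (∑ S : Finset (Fin n) with S.Nonempty, Φ S) := by
        rw [map_sum, ← sum_shuffles]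
        refine Finset.sum_congr rfl fun i _ => Finset.sum_congr ?_ fun _ _ => rfl
        ext σ
        simp
    _ = 0 := by rw [hsum, map_zero]

end JacobiSum

/-! ### The Jacobi identities by the number of arguments from `s⁻¹𝔏'` -/

section JacobiIdentity

variable {𝕜 Ω : Type*} [Field 𝕜] [Semigroup Ω]
variable {A V : Type*} [AddCommGroup A] [Module 𝕜 A] [AddCommGroup V] [Module 𝕜 V]
variable (lam : 𝕜)

theorem jacobiTerm_one_of_three {𝕜 X : Type*} [Field 𝕜] [AddCommGroup X] [Module 𝕜 X]
    (l : ∀ n : ℕ, MultilinearMap 𝕜 (fun _ : Fin n => X) X) (x : Fin 3 → X)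
    (σ : Equiv.Perm (Fin 3)) : jacobiTerm l x 1 σ =
      l 2 (Fin.cons (l 2 fun a : Fin 2 => x (σ ⟨a, by omega⟩))
        fun b : Fin 1 => x (σ ⟨2 + b, by omega⟩)) := rfl

theorem jacobiTerm_modBracket_three (x : Fin 3 → RelSpace 𝕜 Ω A V) (σ : Equiv.Perm (Fin 3))
    (hx : ∀ v, (x v).2 = 0) : jacobiTerm (modBracket lam) x 1 σ =
      (signedBracket (signedBracket (x (σ 0)).1 (x (σ 1)).1) (x (σ 2)).1, 0) := by
  rw [jacobiTerm_one_of_three, modBracket_two_apply, modBracket_two_apply,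
    derivedPart_eq_zero_of_snd lam 1 _ (i := 0) (j := 1) zero_ne_one (hx _) (hx _), add_zero,
    derivedPart_eq_zero_of_snd lam 1 _ (i := 0) (j := 1) zero_ne_one rfl (hx _), add_zero]
  rfl

theorem filter_isShuffle_two_three [DecidablePred fun σ : Equiv.Perm (Fin 3) =>
    IsShuffle (((1 : Fin 3) : ℕ) + 1) σ] :
    (Finset.univ.filter fun σ : Equiv.Perm (Fin 3) => IsShuffle (((1 : Fin 3) : ℕ) + 1) σ) =
      {1, Equiv.swap 1 2, Equiv.swap 0 1 * Equiv.swap 1 2} := by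
  have key : ∀ a b c : Fin 3, a < b → a ≠ c → b ≠ c →
      (a = 0 ∧ b = 1 ∧ c = 2) ∨ (a = 0 ∧ b = 2 ∧ c = 1) ∨ (a = 1 ∧ b = 2 ∧ c = 0) := by decide
  ext σ
  simp only [Finset.mem_filter, Finset.mem_univ, true_and, Finset.mem_insert, Finset.mem_singleton]
  constructor
  · intro h
    have hne : ∀ {a b : Fin 3}, a ≠ b → σ a ≠ σ b := fun hab h' => hab (σ.injective h')
    rcases key (σ 0) (σ 1) (σ 2) (h.1 0 1 (by decide) (by decide)) (hne (by decide))
      (hne (by decide)) with ⟨h0, h1, h2⟩ | ⟨h0, h1, h2⟩ | ⟨h0, h1, h2⟩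
    · refine Or.inl (Equiv.ext fun v => ?_)
      fin_cases v <;> [exact h0; exact h1; exact h2]
    · refine Or.inr (Or.inl (Equiv.ext fun v => ?_))
      fin_cases v <;> [exact h0; exact h1; exact h2]
    · refine Or.inr (Or.inr (Equiv.ext fun v => ?_))
      fin_cases v <;> [exact h0; exact h1; exact h2]
  · rintro (rfl | rfl | rfl) <;> exact ⟨by decide, by decide⟩

theorem koszulExp_three (d : Fin 3 → ZMod 2) : koszulExp 1 d = 0 ∧
    koszulExp (Equiv.swap 1 2) d = d 2 * d 1 ∧
    koszulExp (Equiv.swap 0 1 * Equiv.swap 1 2) d = d 1 * d 0 + d 2 * d 0 := by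
  revert d
  unfold koszulExp
  decide

/-- Inner brackets with one or three arguments vanish here. The three shuffles with an inner pair
give the graded Jacobi identity of the bracket, with signs shifted by the desuspension. -/
theorem sum_jacobiTerm_three {x : Fin 3 → RelSpace 𝕜 Ω A V} {d : Fin 3 → ZMod 2} {N : Fin 3 → ℕ}
    {F : ∀ v, Fam 𝕜 Ω (A × V) (A × V) (N v)} (hF : ∀ v, F v ∈ LPrime 𝕜 Ω A V (N v))
    (hx : ∀ v, x v = relL (F v) (hF v)) (hd : ∀ v, d v = N v + 1) [∀ i : Fin 3,
      DecidablePred fun σ : Equiv.Perm (Fin 3) => IsShuffle ((i : ℕ) + 1) σ] :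
    ∑ i : Fin 3, ∑ σ : Equiv.Perm (Fin 3) with IsShuffle ((i : ℕ) + 1) σ,
      ksgn 𝕜 (koszulExp σ d) • jacobiTerm (modBracket lam) x i σ = 0 := by
  classical
  have hx2 : ∀ v, (x v).2 = 0 := fun v => by rw [hx v]; rfl
  have h0 : ∀ σ : Equiv.Perm (Fin 3), jacobiTerm (modBracket lam) x 0 σ = 0 := fun σ =>
    jacobiTerm_eq_zero_of_inner lam rfl
  have h2 : ∀ σ : Equiv.Perm (Fin 3), jacobiTerm (modBracket lam) x 2 σ = 0 := fun σ =>
    jacobiTerm_eq_zero_of_inner lam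
      (modBracket_eq_zero_of_snd lam 3 le_rfl _ (i := 0) (j := 1) zero_ne_one (hx2 _) (hx2 _))
  set u := fun v => DirectSum.lof 𝕜 ℕ (Fam 𝕜 Ω (A × V) (A × V)) (N v) (F v) with hu
  have hum : ∀ v, u v ∈ homog 𝕜 Ω (A × V) (N v) := fun v => lof_mem_homog _
  have h1 : ∀ σ : Equiv.Perm (Fin 3), ∃ H : TotLPrime 𝕜 Ω A V,
      jacobiTerm (modBracket lam) x 1 σ = (H, 0) ∧
      (H : TotFam 𝕜 Ω (A × V) (A × V)) =
        ksgn 𝕜 (N (σ 1)) • gerst (gerst (u (σ 0)) (u (σ 1))) (u (σ 2)) := by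
    intro σ
    rw [jacobiTerm_modBracket_three lam x σ hx2]
    refine ⟨_, rfl, ?_⟩
    obtain ⟨H, hH, e1, e2⟩ := exists_signedBracket_eq (hF (σ 0)) (hF (σ 1))
    obtain ⟨K, hK, e3, e4⟩ := exists_signedBracket_eq hH (hF (σ 2))
    have e1' : signedBracket (relL (F (σ 0)) (hF (σ 0))).1 (relL (F (σ 1)) (hF (σ 1))).1 =
        (relL H hH).1 := congrArg Prod.fst e1
    have e3' : signedBracket (relL H hH).1 (relL (F (σ 2)) (hF (σ 2))).1 = (relL K hK).1 :=
      congrArg Prod.fst e3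
    rw [hx, hx, hx, e1', e3']
    change DirectSum.lof 𝕜 ℕ (Fam 𝕜 Ω (A × V) (A × V)) _ K = _
    rw [e4, e2, map_smul, LinearMap.smul_apply, smul_smul, ← ksgn_add]
    congr 2
    push_cast
    linear_combination (N (σ 0) : ZMod 2) * two_eq_zero_zmod
  have hfilt : (Finset.univ.filter fun σ : Equiv.Perm (Fin 3) => IsShuffle (((1 : Fin 3) : ℕ) + 1) σ) =
      {1, Equiv.swap 1 2, Equiv.swap 0 1 * Equiv.swap 1 2} :=
    filter_isShuffle_two_three
  rw [Fin.sum_univ_three, Finset.sum_eq_zero (fun σ _ => by rw [h0, smul_zero]),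
    Finset.sum_eq_zero (s := Finset.univ.filter _) (f := fun σ => ksgn 𝕜 (koszulExp σ d) •
      jacobiTerm (modBracket lam) x 2 σ) (fun σ _ => by rw [h2, smul_zero]), zero_add, add_zero,
    hfilt, Finset.sum_insert (by decide), Finset.sum_insert (by decide), Finset.sum_singleton]
  obtain ⟨k1, k2, k3⟩ := koszulExp_three d
  obtain ⟨H1, e1, f1⟩ := h1 1
  obtain ⟨H2, e2, f2⟩ := h1 (Equiv.swap 1 2)
  obtain ⟨H3, e3, f3⟩ := h1 (Equiv.swap 0 1 * Equiv.swap 1 2)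
  rw [e1, e2, e3, k1, k2, k3]
  refine Prod.ext (Subtype.ext ?_) (by simp)
  change ksgn 𝕜 0 • (H1 : TotFam 𝕜 Ω (A × V) (A × V)) +
    (ksgn 𝕜 (d 2 * d 1) • (H2 : TotFam 𝕜 Ω (A × V) (A × V)) +
      ksgn 𝕜 (d 1 * d 0 + d 2 * d 0) • (H3 : TotFam 𝕜 Ω (A × V) (A × V))) = 0
  have f1' : (H1 : TotFam 𝕜 Ω (A × V) (A × V)) =
      ksgn 𝕜 (N 1) • gerst (gerst (u 0) (u 1)) (u 2) := f1
  have f2' : (H2 : TotFam 𝕜 Ω (A × V) (A × V)) =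
      ksgn 𝕜 (N 2) • gerst (gerst (u 0) (u 2)) (u 1) := f2
  have f3' : (H3 : TotFam 𝕜 Ω (A × V) (A × V)) =
      ksgn 𝕜 (N 2) • gerst (gerst (u 1) (u 2)) (u 0) := f3
  rw [f1', f2', f3', gerst_leibniz (hum 0) (hum 1) (hum 2),
    gerst_antisymm (hum 0) (gerst_mem_homog (hum 1) (hum 2)), hd 0, hd 1, hd 2]
  simp only [smul_add, smul_smul, ← ksgn_add]
  have c1 : ((N 2 : ZMod 2) + 1) * (N 1 + 1) + N 2 = 0 + (N 1 + N 1 * N 2) + 1 := by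
    linear_combination (N 2 : ZMod 2) * two_eq_zero_zmod
  have c2 : ((N 1 : ZMod 2) + 1) * (N 0 + 1) + (N 2 + 1) * (N 0 + 1) + N 2 =
      0 + (N 1 + (N 0 * ((N 1 + N 2 : ℕ) : ZMod 2) + 1)) + 1 := by
    push_cast
    linear_combination ((N 2 : ZMod 2) + N 0) * two_eq_zero_zmod
  rw [c1, c2, ← neg_ksgn, ← neg_ksgn, neg_smul, neg_smul]
  abel

open Classical in
theorem modBracket_jacobi_of_isPure (n : ℕ) (d : Fin n → ℤ) (x : Fin n → RelSpace 𝕜 Ω A V)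
    (hx : ∀ i, IsPure (d i) (x i)) :
    ∑ i : Fin n, ∑ σ : Equiv.Perm (Fin n) with IsShuffle (i + 1) σ,
      koszulSign σ d • jacobiTerm (modBracket lam) x i σ = 0 := by
  simp only [koszulSign_smul (𝕜 := 𝕜)]
  set δ : Fin n → ZMod 2 := fun i => ((d i : ℤ) : ZMod 2) with hδ
  -- `L` marks the arguments taken from `s⁻¹𝔏'`; the others come from `𝔞`, and `θ` has a dummy value
  -- where `L` holds.
  let L : Fin n → Prop := fun i => ∃ (N : ℕ) (F : Fam 𝕜 Ω (A × V) (A × V) N)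
    (hF : F ∈ LPrime 𝕜 Ω A V N), δ i = N + 1 ∧ x i = relL F hF
  have hH : ∀ i, ∃ θ : HFam 𝕜 Ω V A, ¬ L i → δ i = θ.1 ∧ x i = relH θ := by
    intro i
    rcases hx i with ⟨N, F, hF, hd, h⟩ | ⟨θ, hd, h⟩
    · refine ⟨⟨0, 0⟩, fun h' => absurd ⟨N, F, hF, ?_, h⟩ h'⟩
      rw [hδ]
      dsimp only
      rw [← hd]
      push_cast
      linear_combination -two_eq_zero_zmod
    · refine ⟨θ, fun _ => ⟨?_, h⟩⟩
      rw [hδ]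
      dsimp only
      rw [← hd, Int.cast_natCast]
  choose θ hθ using hH
  have hL2 : ∀ i, L i → (x i).2 = 0 := by
    rintro i ⟨N, F, hF, -, h⟩
    rw [h]
    rfl
  have hH1 : ∀ i, ¬ L i → (x i).1 = 0 := fun i hi => by
    rw [(hθ i hi).2]
    rfl
  by_cases h3 : ∃ a b c, a ≠ b ∧ a ≠ c ∧ b ≠ c ∧ L a ∧ L b ∧ L c
  · obtain ⟨a, b, c, hab, hac, hbc, ha, hb, hc⟩ := h3
    by_cases hn : 4 ≤ n
    · exact Finset.sum_eq_zero fun i _ => Finset.sum_eq_zero fun σ _ => by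
        rw [jacobiTerm_eq_zero_of_three lam hn hab hac hbc (hL2 a ha) (hL2 b hb) (hL2 c hc),
          smul_zero]
    · have hcard : ({a, b, c} : Finset (Fin n)).card = 3 :=
        Finset.card_eq_three.2 ⟨a, b, c, hab, hac, hbc, rfl⟩
      have hle := Finset.card_le_univ ({a, b, c} : Finset (Fin n))
      rw [hcard, Fintype.card_fin] at hle
      obtain rfl : n = 3 := by omega
      have huniv : ({a, b, c} : Finset (Fin 3)) = Finset.univ :=
        Finset.eq_univ_of_card _ (by rw [hcard, Fintype.card_fin])
      have hall : ∀ v, L v := by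
        intro v
        have : v ∈ ({a, b, c} : Finset (Fin 3)) := huniv ▸ Finset.mem_univ v
        simp only [Finset.mem_insert, Finset.mem_singleton] at this
        rcases this with rfl | rfl | rfl <;> assumption
      choose N F hF hd hxF using hall
      exact sum_jacobiTerm_three lam hF hxF hd
  by_cases h2 : ∃ a b, a < b ∧ L a ∧ L b
  · obtain ⟨a, b, hab, ha, hb⟩ := h2
    have hrest : ∀ i, i ≠ a → i ≠ b → ¬ L i := fun i hia hib hi =>
      h3 ⟨a, b, i, hab.ne, hia.symm, hib.symm, ha, hb, hi⟩
    obtain ⟨N, F, hF, hda, hxa⟩ := ha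
    obtain ⟨M, G, hG, hdb, hxb⟩ := hb
    exact sum_jacobiTerm_pair lam hab hF hG hxa hxb (fun i h h' => (hθ i (hrest i h h')).2) hda hdb
      fun i h h' => (hθ i (hrest i h h')).1
  by_cases h1 : ∃ a, L a
  · obtain ⟨a, ha⟩ := h1
    refine Finset.sum_eq_zero fun i _ => Finset.sum_eq_zero fun σ _ => ?_
    rw [jacobiTerm_eq_zero_of_one lam (a := a), smul_zero]
    intro v hv
    refine hH1 v fun hLv => ?_
    rcases lt_or_gt_of_ne hv with h | h
    · exact h2 ⟨v, a, h, hLv, ha⟩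
    · exact h2 ⟨a, v, h, ha, hLv⟩
  · refine Finset.sum_eq_zero fun i _ => Finset.sum_eq_zero fun σ _ => ?_
    rw [jacobiTerm_eq_zero_of_fst lam, smul_zero]
    exact fun v _ => hH1 v fun h => h1 ⟨v, h⟩

open Classical in
theorem modBracket_jacobi (n : ℕ) (d : Fin n → ℤ) (x : Fin n → RelSpace 𝕜 Ω A V)
    (hx : ∀ i, x i ∈ relGrading 𝕜 Ω A V (d i)) :
    ∑ i : Fin n, ∑ σ : Equiv.Perm (Fin n) with IsShuffle (i + 1) σ,
      koszulSign σ d • jacobiTerm (modBracket lam) x i σ = 0 :=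
  mem_of_decomposition (fun x => ∑ i : Fin n, ∑ σ : Equiv.Perm (Fin n) with IsShuffle (i + 1) σ,
      koszulSign σ d • jacobiTerm (modBracket lam) x i σ)
    (fun x j y z => by
      simp only [jacobiTerm_update_add, smul_add, Finset.sum_add_distrib])
    (fun i y => y ∈ relGrading 𝕜 Ω A V (d i)) (fun i y => IsPure (d i) y)
    (fun i y hy => exists_pure_decomposition hy) ⊥
    (fun x hx => modBracket_jacobi_of_isPure lam n d x hx) x hx

end JacobiIdentity

/-! ### Graded symmetry -/

section KoszulCocycle

theorem sum_sum_eq_sum_sum_lt {ι M : Type*} [Fintype ι] [LinearOrder ι] [AddCommMonoid M]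
    (f : ι → ι → M) (h : ∀ a, f a a = 0) :
    ∑ a, ∑ b, f a b = ∑ a, ∑ b, if a < b then f a b + f b a else 0 := by
  have h1 : ∀ a b, f a b = (if a < b then f a b else 0) + if b < a then f a b else 0 := by
    intro a b
    rcases lt_trichotomy a b with hab | rfl | hab
    · rw [if_pos hab, if_neg hab.not_gt, add_zero]
    · simp [h]
    · rw [if_pos hab, if_neg hab.not_gt, zero_add]
  have h2 : ∑ a, ∑ b, f a b =
      ∑ a, ∑ b, (if a < b then f a b else 0) + ∑ a, ∑ b, if b < a then f a b else 0 := by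
    simp only [← Finset.sum_add_distrib]
    exact Finset.sum_congr rfl fun a _ => Finset.sum_congr rfl fun b _ => h1 a b
  rw [h2, Finset.sum_comm (f := fun a b => if b < a then f a b else 0)]
  simp only [← Finset.sum_add_distrib]
  refine Finset.sum_congr rfl fun a _ => Finset.sum_congr rfl fun b _ => ?_
  split_ifs <;> simp

/-- A pair is inverted by `σ * τ` if exactly one of `τ` and, afterwards, `σ` inverts it; a double
inversion contributes twice the same product, which is zero modulo 2. -/
theorem koszulExp_mul {n : ℕ} (σ τ : Equiv.Perm (Fin n)) (d : Fin n → ZMod 2) :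
    koszulExp (σ * τ) d = koszulExp τ (fun i => d (σ i)) + koszulExp σ d := by
  have h : koszulExp σ d = ∑ a, ∑ b, if τ a < τ b ∧ σ (τ b) < σ (τ a) then
      d (σ (τ a)) * d (σ (τ b)) else 0 := by
    rw [koszulExp, ← Equiv.sum_comp τ]
    refine Finset.sum_congr rfl fun a _ => ?_
    rw [← Equiv.sum_comp τ]
  rw [h, sum_sum_eq_sum_sum_lt (fun a b => if τ a < τ b ∧ σ (τ b) < σ (τ a) then
      d (σ (τ a)) * d (σ (τ b)) else 0) (fun a => by simp)]
  unfold koszulExp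
  rw [← Finset.sum_add_distrib]
  refine Finset.sum_congr rfl fun a _ => ?_
  rw [← Finset.sum_add_distrib]
  refine Finset.sum_congr rfl fun b _ => ?_
  simp only [Equiv.Perm.mul_apply]
  by_cases hab : a < b
  · have h1 : τ a ≠ τ b := fun h => hab.ne (τ.injective h)
    have h2 : σ (τ a) ≠ σ (τ b) := fun h => h1 (σ.injective h)
    rcases lt_or_gt_of_ne h1 with h1 | h1 <;> rcases lt_or_gt_of_ne h2 with h2 | h2 <;>
      simp only [hab, h1, h2, h1.not_gt, h2.not_gt, and_true, and_false,
        if_true, if_false, add_zero, zero_add]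
    linear_combination -(d (σ (τ a)) * d (σ (τ b))) * two_eq_zero_zmod
  · simp [hab]

theorem koszulExp_one {n : ℕ} (d : Fin n → ZMod 2) : koszulExp 1 d = 0 := by
  refine Finset.sum_eq_zero fun a _ => Finset.sum_eq_zero fun b _ => if_neg fun h => ?_
  exact h.1.not_gt h.2

variable {m : ℕ} (i : Fin m)

theorem swap_castSucc_succ_lt_iff {a b : Fin (m + 1)} (hab : a < b) :
    Equiv.swap i.castSucc i.succ b < Equiv.swap i.castSucc i.succ a ↔
      a = i.castSucc ∧ b = i.succ := by
  have hi := i.2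
  simp only [Equiv.swap_apply_def]
  split_ifs <;> simp only [Fin.lt_def, Fin.ext_iff, Fin.val_castSucc, Fin.val_succ] at * <;> omega

theorem koszulExp_swap (d : Fin (m + 1) → ZMod 2) :
    koszulExp (Equiv.swap i.castSucc i.succ) d = d i.castSucc * d i.succ := by
  unfold koszulExp
  rw [Finset.sum_eq_single i.castSucc, Finset.sum_eq_single i.succ]
  · rw [if_pos]
    · simp [mul_comm]
    · simp
  · intro b _ hb
    refine if_neg fun h => hb ?_
    exact ((swap_castSucc_succ_lt_iff i h.1).1 h.2).2
  · simp
  · intro a _ ha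
    refine Finset.sum_eq_zero fun b _ => if_neg fun h => ha ?_
    exact ((swap_castSucc_succ_lt_iff i h.1).1 h.2).1
  · simp

theorem strictMonoOn_swap (U : Set (Fin (m + 1))) (hU : i.succ ∉ U) :
    StrictMonoOn (Equiv.swap i.castSucc i.succ) U := by
  intro a _ b hb hab
  have h1 : Equiv.swap i.castSucc i.succ a ≠ Equiv.swap i.castSucc i.succ b := fun h =>
    hab.ne ((Equiv.swap i.castSucc i.succ).injective h)
  refine (lt_or_gt_of_ne h1).resolve_right fun h => hU ?_
  rwa [← ((swap_castSucc_succ_lt_iff i hab).1 h).2]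

end KoszulCocycle

/-! ### Symmetry of the brackets under adjacent transpositions -/

section Symmetry

variable {𝕜 Ω : Type*} [Field 𝕜] [Semigroup Ω]
variable {W : Type*} [AddCommGroup W] [Module 𝕜 W]

/-- Only two consecutive brackets are affected, and the Leibniz rule with `h0` exchanges them at the
cost of the Koszul sign. The parts of `U` below and above the pair are left alone. -/
theorem foldS_gerst_adjacent {m : ℕ} (i : Fin m) {n : ℕ} {u : TotFam 𝕜 Ω W W}
    (hu : u ∈ homog 𝕜 Ω W n) {p : Fin (m + 1) → ℕ} {x : Fin (m + 1) → TotFam 𝕜 Ω W W}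
    (hx : ∀ v, x v ∈ homog 𝕜 Ω W (p v)) (h0 : gerst (x i.succ) (x i.castSucc) = 0)
    {U : Finset (Fin (m + 1))} (h1 : i.castSucc ∈ U) (h2 : i.succ ∈ U) :
    foldS gerst u (fun v => x (Equiv.swap i.castSucc i.succ v)) U =
      ksgn 𝕜 (p i.castSucc * p i.succ) • foldS gerst u x U := by
  have hlt := Fin.castSucc_lt_succ (i := i)
  set s := Equiv.swap i.castSucc i.succ with hs
  have hU : U = U.filter (· < i.castSucc) ∪
      (({i.castSucc, i.succ} : Finset (Fin (m + 1))) ∪ U.filter (i.succ < ·)) := by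
    ext v
    simp only [Finset.mem_union, Finset.mem_filter, Finset.mem_insert, Finset.mem_singleton]
    constructor
    · intro hv
      by_cases hvc : v < i.castSucc
      · exact Or.inl ⟨hv, hvc⟩
      · by_cases hvs : i.succ < v
        · exact Or.inr (Or.inr ⟨hv, hvs⟩)
        · refine Or.inr (Or.inl ?_)
          simp only [Fin.lt_def, Fin.ext_iff, Fin.val_castSucc, Fin.val_succ] at *
          omega
    · rintro (h | (rfl | rfl) | h)
      exacts [h.1, h1, h2, h.1]
  rw [hU]
  have d1 : ∀ v ∈ U.filter (· < i.castSucc),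
      ∀ w ∈ ({i.castSucc, i.succ} : Finset (Fin (m + 1))) ∪ U.filter (i.succ < ·), v < w := by
    intro v hv w hw
    have hv := (Finset.mem_filter.1 hv).2
    simp only [Finset.mem_union, Finset.mem_filter, Finset.mem_insert,
      Finset.mem_singleton] at hw
    rcases hw with (rfl | rfl) | hw
    exacts [hv, hv.trans hlt, (hv.trans hlt).trans hw.2]
  have d2 : ∀ v ∈ ({i.castSucc, i.succ} : Finset (Fin (m + 1))), ∀ w ∈ U.filter (i.succ < ·), v < w := by
    intro v hv w hw
    have hw := (Finset.mem_filter.1 hw).2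
    simp only [Finset.mem_insert, Finset.mem_singleton] at hv
    rcases hv with rfl | rfl
    exacts [hlt.trans hw, hw]
  have hd : ∀ v ∈ ({i.succ} : Finset (Fin (m + 1))), i.castSucc < v := fun v hv => by
    rwa [Finset.mem_singleton.1 hv]
  simp only [foldS_union_of_lt _ _ _ d1, foldS_union_of_lt _ _ _ d2, foldS_insert_min _ _ _ hd,
    foldS_singleton]
  have c1 : foldS gerst u (fun v => x (s v)) (U.filter (· < i.castSucc)) =
      foldS gerst u x (U.filter (· < i.castSucc)) := foldS_congr _ _ fun v hv => by
    have hv := (Finset.mem_filter.1 hv).2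
    rw [hs, Equiv.swap_apply_of_ne_of_ne hv.ne (hv.trans hlt).ne]
  have c2 : ∀ u', foldS gerst u' (fun v => x (s v)) (U.filter (i.succ < ·)) =
      foldS gerst u' x (U.filter (i.succ < ·)) := fun u' => foldS_congr _ _ fun v hv => by
    have hv := (Finset.mem_filter.1 hv).2
    rw [hs, Equiv.swap_apply_of_ne_of_ne (hlt.trans hv).ne' hv.ne']
  rw [c1, c2, hs, Equiv.swap_apply_left, Equiv.swap_apply_right,
    gerst_leibniz (foldS_gerst_mem hu hx _) (hx i.succ) (hx i.castSucc), h0, map_zero, zero_add,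
    foldS_smul, mul_comm]

variable {A V : Type*} [AddCommGroup A] [Module 𝕜 A] [AddCommGroup V] [Module 𝕜 V]
variable (lam : 𝕜)

theorem isPure_cases {d : ℤ} {x : RelSpace 𝕜 Ω A V} (hx : IsPure d x) :
    (∃ (N : ℕ) (F : Fam 𝕜 Ω (A × V) (A × V) N) (hF : F ∈ LPrime 𝕜 Ω A V N),
      (d : ZMod 2) = N + 1 ∧ x = relL F hF) ∨
    ∃ θ : HFam 𝕜 Ω V A, (d : ZMod 2) = θ.1 ∧ x = relH θ := by
  rcases hx with ⟨N, F, hF, hd, h⟩ | ⟨θ, hd, h⟩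
  · refine Or.inl ⟨N, F, hF, ?_, h⟩
    rw [← hd]
    push_cast
    linear_combination -two_eq_zero_zmod
  · refine Or.inr ⟨θ, ?_, h⟩
    rw [← hd, Int.cast_natCast]

/-- The order of the elements of `𝔞` is unchanged. The entry from `s⁻¹𝔏'` merely has to pass one
more of them, which accounts for the sign. -/
theorem derivedPart_swap_of_eq {m : ℕ} (i : Fin m) {x : Fin (m + 1) → RelSpace 𝕜 Ω A V} {N : ℕ}
    {F : Fam 𝕜 Ω (A × V) (A × V) N} (hF : F ∈ LPrime 𝕜 Ω A V N) (θ : Fin (m + 1) → HFam 𝕜 Ω V A)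
    (hxj : x i.castSucc = relL F hF) (hx : ∀ v, v ≠ i.castSucc → x v = relH (θ v)) :
    derivedPart lam m (fun v => x (Equiv.swap i.castSucc i.succ v)) =
      ksgn 𝕜 ((N + 1) * (θ i.succ).1) • derivedPart lam m x := by
  have hlt := Fin.castSucc_lt_succ (i := i)
  set s := Equiv.swap i.castSucc i.succ with hs
  have hs2 : s i.succ = i.castSucc := Equiv.swap_apply_right _ _
  rw [derivedPart_relL lam m x i.castSucc hF θ hxj hx,
    derivedPart_relL lam m (fun v => x (s v)) i.succ hF (fun v => θ (s v)) (by rw [hs2, hxj])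
      (fun v hv => hx _ fun h => hv (s.injective (h.trans hs2.symm))),
    ← foldS_image gerst _ (fun v => inclTot (θ v).tot) s (Finset.univ.erase i.succ)
      (strictMonoOn_swap i _ (by simp)), Finset.image_erase s.injective, hs2,
    Finset.image_univ_of_surjective s.surjective]
  have h1 : (Finset.univ.filter fun v => v < i.succ) =
      insert i.castSucc (Finset.univ.filter fun v : Fin (m + 1) => v < i.castSucc) := by
    ext v
    simp only [Finset.mem_filter, Finset.mem_univ, true_and, Finset.mem_insert, Fin.lt_def,
      Fin.ext_iff, Fin.val_castSucc, Fin.val_succ]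
    omega
  rw [h1, Finset.sum_insert (by simp), hs, Equiv.swap_apply_left, Prod.smul_mk, smul_zero,
    smul_smul (ksgn 𝕜 _) (ksgn 𝕜 _), ← ksgn_add, mul_add]
  congr 5
  refine Finset.sum_congr rfl fun v hv => ?_
  have hv := (Finset.mem_filter.1 hv).2
  rw [Equiv.swap_apply_of_ne_of_ne hv.ne (hv.trans hlt).ne]

/-- Two neighbours in `𝔞` are exchanged, which is possible since `𝔞` is abelian. Both lie on the
same side of `j`, so the sign for moving the `j`-th entry does not change. -/
theorem derivedPart_swap_of_ne {m : ℕ} (i : Fin m) {x : Fin (m + 1) → RelSpace 𝕜 Ω A V} {N : ℕ}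
    {F : Fam 𝕜 Ω (A × V) (A × V) N} (hF : F ∈ LPrime 𝕜 Ω A V N) (θ : Fin (m + 1) → HFam 𝕜 Ω V A)
    {j : Fin (m + 1)} (h1 : j ≠ i.castSucc) (h2 : j ≠ i.succ)
    (hxj : x j = relL F hF) (hx : ∀ v, v ≠ j → x v = relH (θ v)) :
    derivedPart lam m (fun v => x (Equiv.swap i.castSucc i.succ v)) =
      ksgn 𝕜 ((θ i.castSucc).1 * (θ i.succ).1) • derivedPart lam m x := by
  set s := Equiv.swap i.castSucc i.succ with hs
  have hsj : s j = j := Equiv.swap_apply_of_ne_of_ne h1 h2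
  rw [derivedPart_relL lam m x j hF θ hxj hx,
    derivedPart_relL lam m (fun v => x (s v)) j hF (fun v => θ (s v)) (by rw [hsj, hxj])
      (fun v hv => hx _ fun h => hv (s.injective (h.trans hsj.symm))),
    foldS_gerst_adjacent i (lof_mem_homog F) (fun v => inclH_tot_mem (θ v))
      (gerst_inclTot_tot (θ i.succ).tot (inclH_tot_mem _) _) (by simp [h1.symm])
      (by simp [h2.symm]), map_smul, Prod.smul_mk, smul_zero]
  have hsum : ∑ v : Fin (m + 1) with v < j, ((θ (s v)).1 : ZMod 2) =
      ∑ v : Fin (m + 1) with v < j, ((θ v).1 : ZMod 2) := by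
    refine Finset.sum_equiv s (fun v => ?_) fun v _ => rfl
    have hj1 : (j : ℕ) ≠ i := fun h => h1 (Fin.ext h)
    have hj2 : (j : ℕ) ≠ i + 1 := fun h => h2 (Fin.ext h)
    simp only [Finset.mem_filter, Finset.mem_univ, true_and, hs, Equiv.swap_apply_def]
    split_ifs with h3 h4
    · rw [h3]
      simp only [Fin.lt_def, Fin.val_castSucc, Fin.val_succ]
      omega
    · rw [h4]
      simp only [Fin.lt_def, Fin.val_castSucc, Fin.val_succ]
      omega
    · rfl
  rw [hsum]
  simp only [smul_smul]
  congr 2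
  ring

theorem derivedPart_swap {m : ℕ} (i : Fin m) (d : Fin (m + 1) → ℤ)
    (x : Fin (m + 1) → RelSpace 𝕜 Ω A V) (hx : ∀ v, IsPure (d v) (x v)) :
    derivedPart lam m (fun v => x (Equiv.swap i.castSucc i.succ v)) =
      ksgn 𝕜 ((d i.castSucc : ZMod 2) * d i.succ) • derivedPart lam m x := by
  classical
  set s := Equiv.swap i.castSucc i.succ with hs
  have hss : ∀ v, s (s v) = v := Equiv.swap_apply_self _ _
  let L : Fin (m + 1) → Prop := fun v => ∃ (N : ℕ) (F : Fam 𝕜 Ω (A × V) (A × V) N)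
    (hF : F ∈ LPrime 𝕜 Ω A V N), ((d v : ℤ) : ZMod 2) = N + 1 ∧ x v = relL F hF
  have hH : ∀ v, ∃ θ : HFam 𝕜 Ω V A, ¬ L v → ((d v : ℤ) : ZMod 2) = θ.1 ∧ x v = relH θ := by
    intro v
    rcases isPure_cases (hx v) with h | ⟨θ, h⟩
    · exact ⟨⟨0, 0⟩, fun h' => absurd h h'⟩
    · exact ⟨θ, fun _ => h⟩
  choose θ hθ using hH
  have hL2 : ∀ v, L v → (x v).2 = 0 := by
    rintro v ⟨N, F, hF, -, h⟩
    rw [h]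
    rfl
  have hH1 : ∀ v, ¬ L v → (x v).1 = 0 := fun v hv => by
    rw [(hθ v hv).2]
    rfl
  by_cases h2 : ∃ a b, a ≠ b ∧ L a ∧ L b
  · obtain ⟨a, b, hab, ha, hb⟩ := h2
    rw [derivedPart_eq_zero_of_snd lam m x hab (hL2 a ha) (hL2 b hb),
      derivedPart_eq_zero_of_snd lam m _ (i := s a) (j := s b) (fun h => hab (s.injective h))
        (by rw [hss]; exact hL2 a ha) (by rw [hss]; exact hL2 b hb), smul_zero]
  by_cases h1 : ∃ j, L j
  · obtain ⟨j, hj⟩ := h1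
    have hrest : ∀ v, v ≠ j → ¬ L v := fun v hv hLv => h2 ⟨v, j, hv, hLv, hj⟩
    have hlt := Fin.castSucc_lt_succ (i := i)
    obtain ⟨N, F, hF, hd, hxj⟩ := hj
    by_cases hj1 : j = i.castSucc
    · subst hj1
      rw [derivedPart_swap_of_eq lam i hF θ hxj fun v hv => (hθ v (hrest v hv)).2, hd,
        (hθ _ (hrest i.succ hlt.ne')).1]
    by_cases hj2 : j = i.succ
    · subst hj2
      -- This is the previous case for the transposed arguments, solved for the other side; the sign
      -- is its own inverse.
      have h := derivedPart_swap_of_eq lam i (x := fun v => x (s v)) hF (fun v => θ (s v))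
        (by simp only [hs, Equiv.swap_apply_left]; exact hxj)
        (fun v hv => (hθ _ (hrest _ fun h => hv (s.injective
          (h.trans (Equiv.swap_apply_left _ _).symm)))).2)
      simp only [← hs, hss] at h
      rw [h, smul_smul, hd, (hθ _ (hrest i.castSucc hlt.ne)).1, hs, Equiv.swap_apply_right,
        mul_comm ((θ _).1 : ZMod 2), ksgn_mul_self, one_smul]
    · rw [derivedPart_swap_of_ne lam i hF θ hj1 hj2 hxj fun v hv => (hθ v (hrest v hv)).2,
        (hθ _ (hrest i.castSucc (Ne.symm hj1))).1, (hθ _ (hrest i.succ (Ne.symm hj2))).1]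
  · rw [derivedPart_eq_zero_of_fst lam m x fun v => hH1 v fun h => h1 ⟨v, h⟩,
      derivedPart_eq_zero_of_fst lam m _ fun v => hH1 _ fun h => h1 ⟨_, h⟩, smul_zero]

theorem liePart_swap (d : Fin 2 → ℤ) (x : Fin 2 → RelSpace 𝕜 Ω A V)
    (hx : ∀ v, IsPure (d v) (x v)) :
    liePart (fun v => x (Equiv.swap 0 1 v)) =
      ksgn 𝕜 ((d 0 : ZMod 2) * d 1) • liePart x := by
  rcases isPure_cases (hx 0) with ⟨N, F, hF, h0, hx0⟩ | ⟨θ, -, hx0⟩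
  · rcases isPure_cases (hx 1) with ⟨M, G, hG, h1, hx1⟩ | ⟨θ, -, hx1⟩
    · rw [liePart_apply, liePart_apply, Equiv.swap_apply_left, Equiv.swap_apply_right, hx0, hx1]
      obtain ⟨H, hH, e1, e2⟩ := exists_signedBracket_eq hF hG
      obtain ⟨K, hK, e3, e4⟩ := exists_signedBracket_eq hG hF
      rw [e1, e3]
      refine Prod.ext (Subtype.ext ?_) (smul_zero _).symm
      change DirectSum.lof 𝕜 ℕ (Fam 𝕜 Ω (A × V) (A × V)) _ K =
        _ • DirectSum.lof 𝕜 ℕ (Fam 𝕜 Ω (A × V) (A × V)) _ H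
      rw [e2, e4, gerst_antisymm (lof_mem_homog G) (lof_mem_homog F), smul_smul, smul_smul,
        ← ksgn_add, ← ksgn_add, h0, h1]
      congr 2
      linear_combination -(N : ZMod 2) * two_eq_zero_zmod
    · have h : (x 1).1 = 0 := by rw [hx1]; rfl
      rw [liePart_eq_zero x 1 h, liePart_eq_zero _ 0 (by rwa [Equiv.swap_apply_left]), smul_zero]
  · have h : (x 0).1 = 0 := by rw [hx0]; rfl
    rw [liePart_eq_zero x 0 h, liePart_eq_zero _ 1 (by rwa [Equiv.swap_apply_right]), smul_zero]

theorem modBracket_swap {m : ℕ} (i : Fin m) (d : Fin (m + 1) → ℤ)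
    (x : Fin (m + 1) → RelSpace 𝕜 Ω A V) (hx : ∀ v, IsPure (d v) (x v)) :
    modBracket lam (m + 1) (fun v => x (Equiv.swap i.castSucc i.succ v)) =
      ksgn 𝕜 ((d i.castSucc : ZMod 2) * d i.succ) • modBracket lam (m + 1) x := by
  match m, i with
  | 1, i =>
    obtain rfl := Subsingleton.elim i 0
    rw [modBracket_two_apply, modBracket_two_apply, smul_add, ← derivedPart_swap lam 0 d x hx]
    congr 1
    exact liePart_swap d x hx
  | m + 2, i => exact derivedPart_swap lam i d x hx

theorem modBracket_perm_of_isPure {n : ℕ} (σ : Equiv.Perm (Fin n)) :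
    ∀ (d : Fin n → ℤ) (x : Fin n → RelSpace 𝕜 Ω A V), (∀ v, IsPure (d v) (x v)) →
    modBracket lam n (fun v => x (σ v)) =
      ksgn 𝕜 (koszulExp σ fun i => (d i : ZMod 2)) • modBracket lam n x := by
  match n with
  | 0 =>
    intro d x _
    exact (smul_zero _).symm
  | m + 1 =>
    -- Adjacent transpositions generate the symmetric group, and `koszulExp_mul` is the matching
    -- cocycle rule. The arguments are quantified after `σ` because the second factor acts on
    -- permuted ones.
    have hσ : σ ∈ Submonoid.closure
        (Set.range fun i : Fin m => Equiv.swap i.castSucc i.succ) := by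
      rw [Equiv.Perm.mclosure_swap_castSucc_succ]
      trivial
    induction hσ using Submonoid.closure_induction with
    | mem τ hτ =>
      obtain ⟨i, rfl⟩ := hτ
      intro d x hx
      rw [koszulExp_swap]
      exact modBracket_swap lam i d x hx
    | one =>
      intro d x _
      rw [koszulExp_one, ksgn_zero, one_smul]
      rfl
    | mul σ τ _ _ ihσ ihτ =>
      intro d x hx
      rw [koszulExp_mul, ksgn_add, mul_smul, ← ihσ d x hx]
      exact ihτ (fun v => d (σ v)) (fun v => x (σ v)) fun v => hx (σ v)

theorem modBracket_symmetric (n : ℕ) (d : Fin n → ℤ) (x : Fin n → RelSpace 𝕜 Ω A V)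
    (hx : ∀ i, x i ∈ relGrading 𝕜 Ω A V (d i)) (σ : Equiv.Perm (Fin n)) :
    modBracket lam n (fun i => x (σ i)) = koszulSign σ d • modBracket lam n x := by
  rw [koszulSign_smul (𝕜 := 𝕜), ← sub_eq_zero]
  let T : MultilinearMap 𝕜 (fun _ : Fin n => RelSpace 𝕜 Ω A V) (RelSpace 𝕜 Ω A V) :=
    (modBracket lam n).domDomCongr σ -
      ksgn 𝕜 (koszulExp σ fun i => (d i : ZMod 2)) • modBracket lam n
  exact mem_of_decomposition T (fun x j y z => T.map_update_add x j y z)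
    (fun i y => y ∈ relGrading 𝕜 Ω A V (d i)) (fun i y => IsPure (d i) y)
    (fun i y hy => exists_pure_decomposition hy) ⊥
    (fun x hx => sub_eq_zero.2 (modBracket_perm_of_isPure lam σ d x hx)) x hx

end Symmetry

/-! ### The gradings and the modified algebra -/

section Gradings

/-- Each coordinate, with kernel `K k`, is nonzero on at most one graded piece. An element of one
piece and of the sum of the others is thus killed by all coordinates. -/
theorem iSupIndep_of_le {𝕜 X κ : Type*} [Field 𝕜] [AddCommGroup X] [Module 𝕜 X]
    (K : κ → Submodule 𝕜 X) (hK : ∀ x, (∀ k, x ∈ K k) → x = 0) (deg : κ → ℤ)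
    (gr : ℤ → Submodule 𝕜 X) (hgr : ∀ d k, deg k ≠ d → gr d ≤ K k) : iSupIndep gr := by
  rw [iSupIndep_def]
  intro d
  rw [Submodule.disjoint_def]
  intro x hx hx'
  refine hK x fun k => ?_
  by_cases hk : deg k = d
  · have h : (⨆ j, ⨆ (_ : j ≠ d), gr j) ≤ K k :=
      iSup₂_le fun j hj => hgr j k fun h => hj (h.symm.trans hk)
    exact h hx'
  · exact hgr d k hk hx

variable {𝕜 Ω : Type*} [Field 𝕜]

theorem mem_of_lof_mem {V W X : Type*} [AddCommGroup V] [Module 𝕜 V] [AddCommGroup W] [Module 𝕜 W]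
    [AddCommGroup X] [Module 𝕜 X] (φ : TotFam 𝕜 Ω V W →ₗ[𝕜] X) (S : Submodule 𝕜 X)
    (h : ∀ n f, φ (DirectSum.lof 𝕜 ℕ (Fam 𝕜 Ω V W) n f) ∈ S) (u : TotFam 𝕜 Ω V W) :
    φ u ∈ S := by
  induction u using DirectSum.induction_on with
  | zero =>
    rw [map_zero]
    exact S.zero_mem
  | of n f => exact h n f
  | add u v hu hv =>
    rw [map_add]
    exact S.add_mem hu hv

section Rel

variable {A V : Type*} [AddCommGroup A] [Module 𝕜 A] [AddCommGroup V] [Module 𝕜 V]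

theorem iSupIndep_relGrading : iSupIndep (relGrading 𝕜 Ω A V) := by
  refine iSupIndep_of_le (κ := ℕ ⊕ ℕ) (Sum.elim
    (fun n => LinearMap.ker (DirectSum.component 𝕜 ℕ (Fam 𝕜 Ω (A × V) (A × V)) n ∘ₗ
      (TotLPrime 𝕜 Ω A V).subtype ∘ₗ LinearMap.fst 𝕜 _ _))
    (fun n => LinearMap.ker (DirectSum.component 𝕜 ℕ (Fam 𝕜 Ω V A) n ∘ₗ LinearMap.snd 𝕜 _ _)))
    (fun x hx => ?_) (Sum.elim (fun n => (n : ℤ) - 1) fun n => n) _ ?_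
  · exact Prod.ext (Subtype.ext (DFinsupp.ext fun n => hx (Sum.inl n)))
      (DFinsupp.ext fun n => hx (Sum.inr n))
  · rintro d (n | n) hn x hx
    · exact hx.1 n hn
    · exact hx.2 n hn

theorem iSup_relGrading : ⨆ d, relGrading 𝕜 Ω A V d = ⊤ := by
  classical
  refine eq_top_iff.2 fun x _ => ?_
  have hx : x = LinearMap.inl 𝕜 _ _ x.1 + LinearMap.inr 𝕜 _ _ x.2 := by simp
  rw [hx]
  refine add_mem ?_ (mem_of_lof_mem _ _ (fun n f =>
    Submodule.mem_iSup_of_mem (n : ℤ) (relH_mem (𝕜 := 𝕜) (Ω := Ω) (A := A) ⟨n, f⟩ rfl)) _)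
  have h1 : x.1 = ∑ n ∈ DFinsupp.support x.1.1, (relL (x.1.1 n) (x.1.2 n)).1 := by
    refine Subtype.ext ?_
    rw [AddSubmonoidClass.coe_finsetSum]
    exact (DirectSum.sum_support_of x.1.1).symm
  rw [h1, map_sum]
  exact sum_mem fun n _ => Submodule.mem_iSup_of_mem ((n : ℤ) - 1) (relL_mem (x.1.2 n) rfl)

theorem isInternal_relGrading : DirectSum.IsInternal (relGrading 𝕜 Ω A V) :=
  DirectSum.isInternal_submodule_of_iSupIndep_of_iSup_eq_top iSupIndep_relGrading iSup_relGrading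

end Rel

section Abs

variable {A : Type*} [AddCommGroup A] [Module 𝕜 A]

theorem iSup_absGrading : ⨆ d, absGrading 𝕜 Ω A d = ⊤ := by
  refine eq_top_iff.2 fun x _ => ?_
  have hx : x = LinearMap.inl 𝕜 _ _ x.1 + LinearMap.inr 𝕜 _ _ x.2 := by simp
  rw [hx]
  refine add_mem (mem_of_lof_mem _ _ (fun n f => ?_) _) (mem_of_lof_mem _ _ (fun n f => ?_) _)
  · exact Submodule.mem_iSup_of_mem ((n : ℤ) - 1) ⟨fun m hm =>
      DirectSum.of_eq_of_ne _ _ _ (by rintro rfl; exact hm rfl), fun _ _ => rfl⟩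
  · exact Submodule.mem_iSup_of_mem (n : ℤ) ⟨fun _ _ => rfl, fun m hm =>
      DirectSum.of_eq_of_ne _ _ _ (by rintro rfl; exact hm rfl)⟩

end Abs

/-! ### The degree of the brackets and the modified algebra -/

section Degree

variable {A V : Type*} [AddCommGroup A] [Module 𝕜 A] [AddCommGroup V] [Module 𝕜 V]
variable [Semigroup Ω] (lam : 𝕜)

/-- Iterated brackets add the degrees of families, and the desuspended `F` has degree `N - 1`; the
difference is the degree one of the bracket. -/
theorem derivedPart_mem {m : ℕ} (d : Fin (m + 1) → ℤ) (x : Fin (m + 1) → RelSpace 𝕜 Ω A V)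
    (hx : ∀ v, IsPure (d v) (x v)) :
    derivedPart lam m x ∈ relGrading 𝕜 Ω A V ((∑ i, d i) + 1) := by
  classical
  let L : Fin (m + 1) → Prop := fun v => ∃ (N : ℕ) (F : Fam 𝕜 Ω (A × V) (A × V) N)
    (hF : F ∈ LPrime 𝕜 Ω A V N), (N : ℤ) - 1 = d v ∧ x v = relL F hF
  have hH : ∀ v, ∃ θ : HFam 𝕜 Ω V A, ¬ L v → (θ.1 : ℤ) = d v ∧ x v = relH θ := by
    intro v
    rcases hx v with h | ⟨θ, h⟩
    · exact ⟨⟨0, 0⟩, fun h' => absurd h h'⟩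
    · exact ⟨θ, fun _ => h⟩
  choose θ hθ using hH
  have hL2 : ∀ v, L v → (x v).2 = 0 := by
    rintro v ⟨N, F, hF, -, h⟩
    rw [h]
    rfl
  by_cases h2 : ∃ a b, a ≠ b ∧ L a ∧ L b
  · obtain ⟨a, b, hab, ha, hb⟩ := h2
    rw [derivedPart_eq_zero_of_snd lam m x hab (hL2 a ha) (hL2 b hb)]
    exact zero_mem _
  by_cases h1 : ∃ j, L j
  · obtain ⟨j, hj⟩ := h1
    have hrest : ∀ v, v ≠ j → ¬ L v := fun v hv hLv => h2 ⟨v, j, hv, hLv, hj⟩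
    obtain ⟨N, F, hF, hd, hxj⟩ := hj
    rw [derivedPart_relL lam m x j hF θ hxj fun v hv => (hθ v (hrest v hv)).2, smul_smul]
    obtain ⟨η, h3, h4⟩ := exists_relH_eq (F := F) θ (Finset.univ.erase j) (ksgn 𝕜 ((N + 1) *
      ∑ i : Fin (m + 1) with i < j, ((θ i).1 : ZMod 2)) * lam ^ (N + 1 - m))
    rw [← h4]
    refine relH_mem η ?_
    rw [h3, ← Finset.add_sum_erase _ _ (Finset.mem_univ j), ← hd,
      Finset.sum_congr rfl fun v hv => ((hθ v (hrest v (Finset.ne_of_mem_erase hv))).1).symm]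
    push_cast
    ring
  · rw [derivedPart_eq_zero_of_fst lam m x fun v => by
      rw [(hθ v fun h => h1 ⟨v, h⟩).2]
      rfl]
    exact zero_mem _

theorem liePart_mem (d : Fin 2 → ℤ) (x : Fin 2 → RelSpace 𝕜 Ω A V)
    (hx : ∀ v, IsPure (d v) (x v)) : liePart x ∈ relGrading 𝕜 Ω A V ((∑ i, d i) + 1) := by
  rcases hx 0 with ⟨N, F, hF, h0, hx0⟩ | ⟨θ, -, hx0⟩
  · rcases hx 1 with ⟨M, G, hG, h1, hx1⟩ | ⟨θ, -, hx1⟩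
    · rw [liePart_apply, hx0, hx1]
      obtain ⟨H, hH, e1, -⟩ := exists_signedBracket_eq hF hG
      rw [e1]
      refine relL_mem hH ?_
      rw [Fin.sum_univ_two, ← h0, ← h1]
      push_cast
      ring
    · rw [liePart_eq_zero x 1 (by rw [hx1]; rfl)]
      exact zero_mem _
  · rw [liePart_eq_zero x 0 (by rw [hx0]; rfl)]
    exact zero_mem _

theorem modBracket_mem (n : ℕ) (d : Fin n → ℤ) (x : Fin n → RelSpace 𝕜 Ω A V)
    (hx : ∀ i, x i ∈ relGrading 𝕜 Ω A V (d i)) :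
    modBracket lam n x ∈ relGrading 𝕜 Ω A V ((∑ i, d i) + 1) := by
  refine mem_of_decomposition (modBracket lam n)
    (fun x j y z => (modBracket lam n).map_update_add x j y z)
    (fun i y => y ∈ relGrading 𝕜 Ω A V (d i)) (fun i y => IsPure (d i) y)
    (fun i y hy => exists_pure_decomposition hy) (relGrading 𝕜 Ω A V ((∑ i, d i) + 1)).toAddSubmonoid
    (fun x hx => ?_) x hx
  match n with
  | 0 => exact zero_mem _
  | 1 => exact zero_mem _
  | 2 => exact add_mem (liePart_mem d x hx) (derivedPart_mem lam d x hx)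
  | n + 3 => exact derivedPart_mem lam d x hx

theorem isLInftyOneAlgebra_modBracket :
    IsLInftyOneAlgebra (relGrading 𝕜 Ω A V) (modBracket lam) where
  isInternal := isInternal_relGrading
  degree_one n _ d x hx := modBracket_mem lam n d x hx
  symmetric n _ d x hx σ := modBracket_symmetric lam n d x hx σ
  jacobi n _ d x hx := modBracket_jacobi lam n d x hx

end Degree

end Gradings

/-! ### The diagonal embedding -/

section Diagonal

variable {𝕜 Ω : Type*} [Field 𝕜] {A : Type*} [AddCommGroup A] [Module 𝕜 A]

theorem diagRetr_diagEmb (x : AbsSpace 𝕜 Ω A) : diagRetr (diagEmb x) = x := by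
  refine Prod.ext ?_ rfl
  change DirectSum.lmap topFam (DirectSum.lmap tildeFam x.1) = x.1
  refine DFinsupp.ext fun n => ?_
  rw [DirectSum.lmap_apply, DirectSum.lmap_apply]
  refine Fam.ext fun α v => ?_
  change (tildeFam n (x.1 n) α fun j => (v j, 0)).1 = _
  rw [tildeFam_apply]

theorem diagEmb_injective : Function.Injective (diagEmb : AbsSpace 𝕜 Ω A →ₗ[𝕜] RelSpace 𝕜 Ω A A) :=
  Function.LeftInverse.injective diagRetr_diagEmb

theorem diagEmb_mem {d : ℤ} {x : AbsSpace 𝕜 Ω A} (hx : x ∈ absGrading 𝕜 Ω A d) :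
    diagEmb x ∈ relGrading 𝕜 Ω A A d := by
  refine ⟨fun n hn => ?_, hx.2⟩
  change DirectSum.lmap tildeFam x.1 n = 0
  rw [DirectSum.lmap_apply, hx.1 n hn, map_zero]

theorem diagRetr_mem {d : ℤ} {x : RelSpace 𝕜 Ω A A} (hx : x ∈ relGrading 𝕜 Ω A A d) :
    diagRetr x ∈ absGrading 𝕜 Ω A d := by
  refine ⟨fun n hn => ?_, hx.2⟩
  change DirectSum.lmap topFam (x.1 : TotFam 𝕜 Ω (A × A) (A × A)) n = 0
  rw [DirectSum.lmap_apply, hx.1 n hn, map_zero]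

/-- Independence is inherited from the larger space along the injective graded map `ι`. -/
theorem iSupIndep_absGrading : iSupIndep (absGrading 𝕜 Ω A) := by
  rw [iSupIndep_def]
  intro d
  rw [Submodule.disjoint_def]
  intro x hx hx'
  refine diagEmb_injective ?_
  rw [map_zero]
  refine Submodule.disjoint_def.1 (iSupIndep_def.1 iSupIndep_relGrading d) _ (diagEmb_mem hx) ?_
  have h : (⨆ j, ⨆ (_ : j ≠ d), absGrading 𝕜 Ω A j) ≤
      (⨆ j, ⨆ (_ : j ≠ d), relGrading 𝕜 Ω A A j).comap diagEmb :=
    iSup₂_le fun j hj y hy => Submodule.mem_iSup_of_mem j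
      (Submodule.mem_iSup_of_mem hj (diagEmb_mem hy))
  exact h hx'

theorem parity_tildeTot (u : TotFam 𝕜 Ω A A) : parity (tildeTot u) = tildeTot (parity u) := by
  refine DFinsupp.ext fun n => ?_
  simp only [parity, tildeTot, DirectSum.lmap_apply, LinearMap.smul_apply, LinearMap.id_apply,
    map_smul]

variable [Semigroup Ω] (lam : 𝕜)

theorem liePart_diagEmb (x : Fin 2 → AbsSpace 𝕜 Ω A) :
    liePart (fun i => diagEmb (x i)) = diagEmb (gerst (parity (x 0).1) (x 1).1, 0) := by
  refine Prod.ext (Subtype.ext ?_) rfl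
  change gerst (parity (tildeTot (x 0).1)) (tildeTot (x 1).1) =
    tildeTot (gerst (parity (x 0).1) (x 1).1)
  rw [parity_tildeTot, gerst_tildeTot]

/-- Derived brackets take values in `𝔞`, and `ι` maps `𝔥` onto `𝔞`. -/
theorem derivedPart_mem_range (k : ℕ) (x : Fin (k + 1) → RelSpace 𝕜 Ω A A) :
    derivedPart lam k x ∈ LinearMap.range (diagEmb : AbsSpace 𝕜 Ω A →ₗ[𝕜] RelSpace 𝕜 Ω A A) := by
  rw [derivedPart_apply]
  exact ⟨(0, _), Prod.ext (Subtype.ext (map_zero tildeTot)) rfl⟩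

theorem modBracket_diagEmb_mem_range (n : ℕ) (x : Fin n → AbsSpace 𝕜 Ω A) :
    modBracket lam n (fun i => diagEmb (x i)) ∈
      LinearMap.range (diagEmb : AbsSpace 𝕜 Ω A →ₗ[𝕜] RelSpace 𝕜 Ω A A) := by
  match n with
  | 0 => exact zero_mem _
  | 1 => exact zero_mem _
  | 2 =>
    refine add_mem ?_ (derivedPart_mem_range lam _ _)
    rw [liePart_diagEmb]
    exact LinearMap.mem_range_self _ _
  | n + 3 => exact derivedPart_mem_range lam _ _

theorem isLInftyOneSubalgebra_range_diagEmb :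
    IsLInftyOneSubalgebra (relGrading 𝕜 Ω A A) (modBracket lam)
      (LinearMap.range (diagEmb : AbsSpace 𝕜 Ω A →ₗ[𝕜] RelSpace 𝕜 Ω A A)) where
  isAlgebra := isLInftyOneAlgebra_modBracket lam
  graded := by
    have h : (⨆ d, absGrading 𝕜 Ω A d).map diagEmb ≤ ⨆ d, LinearMap.range
        (diagEmb : AbsSpace 𝕜 Ω A →ₗ[𝕜] RelSpace 𝕜 Ω A A) ⊓ relGrading 𝕜 Ω A A d := by
      rw [Submodule.map_iSup]
      refine iSup_mono fun d => ?_
      rintro _ ⟨x, hx, rfl⟩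
      exact ⟨LinearMap.mem_range_self _ x, diagEmb_mem hx⟩
    rwa [iSup_absGrading, ← LinearMap.range_eq_map] at h
  closed n _ x hx := by
    choose y hy using hx
    obtain rfl : (fun i => diagEmb (y i)) = x := funext hy
    exact modBracket_diagEmb_mem_range lam n y

theorem diagEmb_rho (n : ℕ) (x : Fin n → AbsSpace 𝕜 Ω A) :
    diagEmb (rho lam n x) = modBracket lam n fun i => diagEmb (x i) := by
  obtain ⟨y, hy⟩ := modBracket_diagEmb_mem_range lam n x
  change diagEmb (diagRetr (modBracket lam n fun i => diagEmb (x i))) = _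
  rw [← hy, diagRetr_diagEmb]

theorem diagEmb_jacobiTerm {n : ℕ} (x : Fin n → AbsSpace 𝕜 Ω A) (i : Fin n)
    (σ : Equiv.Perm (Fin n)) : diagEmb (jacobiTerm (rho lam) x i σ) =
      jacobiTerm (modBracket lam) (fun j => diagEmb (x j)) i σ := by
  rw [jacobiTerm, jacobiTerm, diagEmb_rho]
  congr 1
  funext j
  refine Fin.cases ?_ (fun j => ?_) j
  · exact diagEmb_rho lam _ _
  · rfl

/-- The map `ι` is injective and intertwines the brackets, so symmetry and the Jacobi identities can
be checked after applying it; the degree passes through `p`. -/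
theorem isLInftyOneAlgebra_rho : IsLInftyOneAlgebra (absGrading 𝕜 Ω A) (rho lam) where
  isInternal := DirectSum.isInternal_submodule_of_iSupIndep_of_iSup_eq_top iSupIndep_absGrading
    iSup_absGrading
  degree_one n _ d x hx := diagRetr_mem (modBracket_mem lam n d _ fun i => diagEmb_mem (hx i))
  symmetric n _ d x hx σ := by
    refine diagEmb_injective ?_
    rw [Units.smul_def, map_zsmul, ← Units.smul_def, diagEmb_rho, diagEmb_rho]
    exact modBracket_symmetric lam n d _ (fun i => diagEmb_mem (hx i)) σ
  jacobi n _ d x hx := by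
    refine diagEmb_injective ?_
    rw [map_zero, ← modBracket_jacobi lam n d _ fun i => diagEmb_mem (hx i), map_sum]
    refine Finset.sum_congr rfl fun i _ => ?_
    rw [map_sum]
    refine Finset.sum_congr rfl fun σ _ => ?_
    rw [Units.smul_def, map_zsmul, ← Units.smul_def, diagEmb_jacobiTerm]

end Diagonal

/-! ### The explicit formulas -/

section Explicit

/-- All pairs together with the inverted ones leave, modulo 2, the pairs that are not inverted. This
translates the exponent of a colouring, which counts pairs in increasing order, into a Koszul sign.
-/
theorem koszulExp_add_sum {K m : ℕ} (τ : Fin K → Fin m) (hτ : Function.Injective τ)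
    (w : Fin K → ZMod 2) :
    (∑ a : Fin K, ∑ b : Fin K, if a < b ∧ τ b < τ a then w a * w b else 0) +
      ∑ i : Fin K, (∑ j : Fin K with j < i, w j) * w i =
      ∑ i : Fin K, ∑ j : Fin K with j < i, if τ j < τ i then w j * w i else 0 := by
  rw [Finset.sum_comm, ← Finset.sum_add_distrib]
  refine Finset.sum_congr rfl fun i _ => ?_
  rw [Finset.sum_mul, Finset.sum_filter, Finset.sum_filter, ← Finset.sum_add_distrib]
  refine Finset.sum_congr rfl fun j _ => ?_
  by_cases hji : j < i
  · rcases lt_or_gt_of_ne fun h => hji.ne (hτ h) with h | h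
    · simp [hji, h, h.not_gt]
    · simp only [hji, h, h.not_gt, and_self, if_true, if_false]
      linear_combination (w j * w i) * two_eq_zero_zmod
  · simp [hji]

/-- The inversions involving the first entry are the pairs of `σ 0` with the smaller indices; they
match the sign for taking `θ_{σ(1)}` out of the iterated bracket. -/
theorem koszulExp_succ {K : ℕ} (σ : Equiv.Perm (Fin (K + 1))) (d : Fin (K + 1) → ZMod 2) :
    koszulExp σ d = d (σ 0) * ∑ i : Fin (K + 1) with i < σ 0, d i +
      ∑ a : Fin K, ∑ b : Fin K, if a < b ∧ σ b.succ < σ a.succ then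
        d (σ a.succ) * d (σ b.succ) else 0 := by
  rw [koszulExp, Fin.sum_univ_succ]
  congr 1
  · rw [Finset.sum_filter, ← Equiv.sum_comp σ (fun i => if i < σ 0 then d i else 0), Fin.sum_univ_succ, Fin.sum_univ_succ,
      if_neg (by simp), if_neg (by simp), zero_add, zero_add, Finset.mul_sum]
    refine Finset.sum_congr rfl fun b _ => ?_
    simp
  · refine Finset.sum_congr rfl fun a _ => ?_
    rw [Fin.sum_univ_succ, if_neg (by simp), zero_add]
    simp only [Fin.succ_lt_succ_iff]

theorem colExp_eq_sum {N K m : ℕ} (p : Fin m → ℕ) (q : Fin K → Fin (N + 1)) (hq : StrictMono q)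
    (τ : Fin K → Fin m) (G : Fin (N + 1) → Option (Fin m)) (hG : ∀ i, G (q i) = some (τ i))
    (hG' : ∀ c, c ∉ Set.range q → G c = none) :
    colExp p G = ∑ i : Fin K, ((q i : ℕ) * (p (τ i) : ZMod 2)) +
      ∑ i : Fin K, ∑ j : Fin K with j < i, if τ j < τ i then (p (τ j) * p (τ i) : ZMod 2)
        else 0 := by
  rw [← Finset.sum_add_distrib]
  symm
  refine Finset.sum_of_injOn q hq.injective.injOn (fun _ _ => Finset.mem_univ _) (fun c _ hc => ?_)
    fun i _ => ?_
  · rw [hG' c fun ⟨i, hi⟩ => hc ⟨i, Finset.mem_univ i, hi⟩]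
    simp [colDeg, colPair_none_right]
  · rw [hG]
    congr 1
    rw [Finset.sum_filter, Finset.sum_filter]
    refine Finset.sum_of_injOn q hq.injective.injOn (fun _ _ => Finset.mem_univ _)
      (fun c _ hc => ?_) fun j _ => ?_
    · rw [hG' c fun ⟨i, hi⟩ => hc ⟨i, Finset.mem_univ i, hi⟩, colPair_none_left, ite_self]
    · rw [hG]
      simp only [hq.lt_iff_lt]
      rfl

variable {𝕜 Ω : Type*} [Field 𝕜] [Semigroup Ω]
variable {A : Type*} [AddCommGroup A] [Module 𝕜 A]

/-- A colouring of `n + 1` inputs by `n + 1` colours, each used once, is a permutation. -/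
theorem fullTerm_eq_sum {n : ℕ} (f : Fam 𝕜 Ω A A n) (p : Fin (n + 1) → ℕ)
    (θ : ∀ i, Fam 𝕜 Ω A A (p i)) [DecidablePred (IsColouring (N := n)
      (Finset.univ : Finset (Fin (n + 1))))] :
    fullTerm f p θ = ∑ G : Fin (n + 1) → Option (Fin (n + 1)) with IsColouring Finset.univ G,
      ksgn 𝕜 (colExp p G) • fullTot f fun c =>
        colFam (fun i => (⟨p i, θ i⟩ : HFam 𝕜 Ω A A)) (G c) := by
  refine Finset.sum_bij (fun σ _ c => some (σ c)) (fun σ _ => ?_) (fun σ _ σ' _ h => ?_)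
    (fun G hG => ?_) fun σ _ => ?_
  · refine Finset.mem_filter.2 ⟨Finset.mem_univ _, fun i _ => ⟨σ.symm i, by simp⟩,
      fun _ _ _ => Finset.mem_univ _, fun c c' i h h' => σ.injective ?_⟩
    exact Option.some_injective _ (h.trans h'.symm)
  · exact Equiv.ext fun c => Option.some_injective _ (congrFun h c)
  · have hG := (Finset.mem_filter.1 hG).2
    have h0 : ∀ c, ∃ i, G c = some i := by
      intro c
      refine Option.ne_none_iff_exists'.1 fun h => hG.exists_none_iff.1 ⟨c, h⟩ ?_
      simp
    choose τ hτ using h0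
    have hinj : Function.Injective τ := fun c c' h =>
      hG.2.2 c c' _ (hτ c) ((hτ c').trans (congrArg some h.symm))
    refine ⟨Equiv.ofBijective τ (Finite.injective_iff_bijective.1 hinj), Finset.mem_univ _, ?_⟩
    funext c
    exact (hτ c).symm
  · have h1 : ((xiFull p σ : ℕ) : ZMod 2) = ∑ i : Fin (n + 1), ((i : ℕ) * (p (σ i) : ZMod 2)) +
        ∑ i : Fin (n + 1), (∑ j : Fin (n + 1) with j < i, (p (σ j) : ZMod 2)) * p (σ i) := by
      rw [xiFull, ← Finset.sum_add_distrib]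
      push_cast
      refine Finset.sum_congr rfl fun i _ => ?_
      rw [Finset.sum_add_distrib, add_mul, add_comm]
      congr 2
      have hc : (Finset.univ.filter fun j : Fin (n + 1) => j < i) = Finset.Iio i := by
        ext j
        simp
      rw [Finset.sum_const, hc, Fin.card_Iio, nsmul_one]
    rw [koszulSign_smul (𝕜 := 𝕜), ← ksgn_natCast, smul_smul, ← ksgn_add, h1,
      colExp_eq_sum p id strictMono_id σ _ (fun _ => rfl) fun c hc => absurd ⟨c, rfl⟩ hc,
      ← koszulExp_add_sum σ σ.injective, koszulExp]
    simp only [Int.cast_natCast, id]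
    rw [add_left_comm]
    rfl

theorem innerTerm_eq_sum (lam : 𝕜) {n K : ℕ} (f : Fam 𝕜 Ω A A n) (p : Fin (K + 1) → ℕ)
    (θ : ∀ i, Fam 𝕜 Ω A A (p i)) [∀ j, DecidablePred (IsColouring (N := n)
      ((Finset.univ : Finset (Fin (K + 1))).erase j))] :
    innerTerm lam f p θ = lam ^ (n - K) • ∑ j : Fin (K + 1),
      ∑ G : Fin (n + 1) → Option (Fin (K + 1)) with IsColouring (Finset.univ.erase j) G,
        ksgn 𝕜 (1 + p j * (n + ∑ i : Fin (K + 1) with i < j, (p i : ZMod 2)) + colExp p G) •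
          insT (DirectSum.lof 𝕜 ℕ (Fam 𝕜 Ω A A) (p j) (θ j)) (fullTot f fun c =>
            colFam (fun i => (⟨p i, θ i⟩ : HFam 𝕜 Ω A A)) (G c)) := by
  classical
  rw [innerTerm, ← Fintype.sum_prod_type']
  conv_rhs => rw [Finset.sum_sigma', Finset.smul_sum]
  have hext : ∀ (σ : Equiv.Perm (Fin (K + 1))) (q : Fin K ↪o Fin (n + 1)) (i : Fin K),
      Function.extend q (fun i => some (σ i.succ)) (fun _ => none) (q i) = some (σ i.succ) :=
    fun σ q i => q.injective.extend_apply _ _ i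
  have hext' : ∀ (σ : Equiv.Perm (Fin (K + 1))) (q : Fin K ↪o Fin (n + 1)) (c : Fin (n + 1)),
      c ∉ Set.range q →
      Function.extend q (fun i => some (σ i.succ)) (fun _ => none) c = none :=
    fun σ q c hc => Function.extend_apply' _ _ _ hc
  have hsome : ∀ (σ : Equiv.Perm (Fin (K + 1))) (q : Fin K ↪o Fin (n + 1)) (c : Fin (n + 1)) j,
      Function.extend q (fun i => some (σ i.succ)) (fun _ => none) c = some j →
      ∃ i, q i = c ∧ σ i.succ = j := by
    intro σ q c j h
    by_cases hc : c ∈ Set.range q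
    · obtain ⟨i, rfl⟩ := hc
      exact ⟨i, rfl, Option.some_injective _ ((hext σ q i).symm.trans h)⟩
    · rw [hext' σ q c hc] at h
      exact absurd h (by simp)
  -- A pair `(σ, q)` corresponds to the outermost index `j = σ 0` and a colouring by the remaining
  -- ones: `q` lists the occupied inputs increasingly, and the colour at `q i` is `σ i.succ`.
  refine Finset.sum_bij (fun x _ => ⟨x.1 0, Function.extend x.2 (fun i => some (x.1 i.succ))
    fun _ => none⟩) (fun x _ => ?_) (fun x _ y _ h => ?_) (fun y hy => ?_) fun x _ => ?_
  · obtain ⟨σ, q⟩ := x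
    refine Finset.mem_sigma.2 ⟨Finset.mem_univ _, Finset.mem_filter.2 ⟨Finset.mem_univ _,
      fun j hj => ?_, fun c j h => ?_, fun c c' j h h' => ?_⟩⟩
    · obtain ⟨k, rfl⟩ := σ.surjective j
      have hk : k ≠ 0 := fun h => Finset.ne_of_mem_erase hj (congrArg σ h)
      obtain ⟨i, rfl⟩ := Fin.exists_succ_eq.2 hk
      exact ⟨q i, hext σ q i⟩
    · obtain ⟨i, -, rfl⟩ := hsome σ q c j h
      exact Finset.mem_erase.2 ⟨fun h' => Fin.succ_ne_zero i (σ.injective h'), Finset.mem_univ _⟩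
    · obtain ⟨i, rfl, rfl⟩ := hsome σ q c j h
      obtain ⟨i', rfl, h2⟩ := hsome σ q c' _ h'
      rw [Fin.succ_injective _ (σ.injective h2)]
  · obtain ⟨σ, q⟩ := x
    obtain ⟨σ', q'⟩ := y
    obtain ⟨h1, h2⟩ := Sigma.mk.inj h
    dsimp only at h1 h2
    have h2 := congrFun (eq_of_heq h2)
    have hr : Set.range q = Set.range q' := by
      ext c
      constructor
      · rintro ⟨i, rfl⟩
        by_contra hc
        have := h2 (q i)
        rw [hext, hext' σ' q' _ hc] at this
        exact absurd this (by simp)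
      · rintro ⟨i, rfl⟩
        by_contra hc
        have := h2 (q' i)
        rw [hext, hext' σ q _ hc] at this
        exact absurd this (by simp)
    obtain rfl : q = q' := DFunLike.coe_injective ((StrictMono.range_inj q.strictMono
      q'.strictMono).1 hr)
    refine Prod.ext (Equiv.ext fun k => ?_) rfl
    refine Fin.cases h1 (fun i => ?_) k
    have := h2 (q i)
    rw [hext, hext] at this
    exact Option.some_injective _ this
  · obtain ⟨j, G⟩ := y
    have hG := (Finset.mem_filter.1 (Finset.mem_sigma.1 hy).2).2
    dsimp only at hG
    have hcard := hG.card_eq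
    rw [Finset.card_erase_of_mem (Finset.mem_univ j), Finset.card_univ, Fintype.card_fin,
      Nat.add_sub_cancel] at hcard
    set S := Finset.univ.filter fun c => G c ≠ none with hS
    have hq : ∀ i, ∃ k, G (S.orderEmbOfFin hcard i) = some k := fun i =>
      Option.ne_none_iff_exists'.1
        (Finset.mem_filter.1 (S.orderEmbOfFin_mem hcard i)).2
    choose τ hτ using hq
    have hinj : Function.Injective τ := fun i i' h => (S.orderEmbOfFin hcard).injective
      (hG.2.2 _ _ _ (hτ i) ((hτ i').trans (congrArg some h.symm)))
    have hj : j ∉ Set.range τ := by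
      rintro ⟨i, hi⟩
      exact Finset.notMem_erase j _ (hi ▸ hG.2.1 _ _ (hτ i))
    have hcons : Function.Injective (Fin.cons j τ : Fin (K + 1) → Fin (K + 1)) :=
      Fin.cons_injective_iff.2 ⟨hj, hinj⟩
    refine ⟨(Equiv.ofBijective _ (Finite.injective_iff_bijective.1 hcons), S.orderEmbOfFin hcard),
      Finset.mem_univ _, Sigma.ext rfl (heq_of_eq ?_)⟩
    funext c
    dsimp only
    by_cases hc : c ∈ Set.range (S.orderEmbOfFin hcard)
    · obtain ⟨i, rfl⟩ := hc
      rw [hext, hτ]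
      rfl
    · rw [hext' _ _ c hc]
      rw [Finset.range_orderEmbOfFin] at hc
      by_contra h
      exact hc (Finset.mem_filter.2 ⟨Finset.mem_univ _, fun h' => h h'.symm⟩)
  · obtain ⟨σ, q⟩ := x
    dsimp only
    set G := Function.extend q (fun i => some (σ i.succ)) fun _ => none with hG
    have hcol : (fun c => colFam (fun i => (⟨p i, θ i⟩ : HFam 𝕜 Ω A A)) (G c)) =
        Function.extend q (fun i => (⟨p (σ i.succ), θ (σ i.succ)⟩ : HFam 𝕜 Ω A A))
          fun _ => ⟨0, idFam 𝕜 Ω A⟩ := by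
      funext c
      by_cases hc : c ∈ Set.range q
      · obtain ⟨i, rfl⟩ := hc
        rw [hG, hext, q.injective.extend_apply]
        rfl
      · rw [hG, hext' σ q c hc, Function.extend_apply' _ _ _ hc]
        rfl
    have hdeg : ∑ c, (Function.extend q (fun i => (⟨p (σ i.succ), θ (σ i.succ)⟩ : HFam 𝕜 Ω A A))
        (fun _ => ⟨0, idFam 𝕜 Ω A⟩) c).1 = ∑ i : Fin K, p (σ i.succ) := by
      symm
      refine Finset.sum_of_injOn q q.injective.injOn (fun _ _ => Finset.mem_univ _)
        (fun c _ hc => ?_) fun i _ => ?_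
      · rw [Function.extend_apply' _ _ _ fun ⟨i, hi⟩ => hc ⟨i, Finset.mem_univ i, hi⟩]
      · rw [q.injective.extend_apply]
    rw [hcol, fullTot, insT_lof_eq_sum, Finset.smul_sum, Finset.smul_sum]
    refine Finset.sum_congr rfl fun r _ => ?_
    rw [koszulSign_smul (𝕜 := 𝕜), ← ksgn_natCast, smul_smul, smul_smul, smul_smul, ← mul_assoc,
      ← ksgn_add, mul_assoc, ← ksgn_add, mul_comm (lam ^ _)]
    have hexp : koszulExp σ (fun i => (((p i : ℕ) : ℤ) : ZMod 2)) +
        (xiInner n p σ (fun i => (q i : ℕ)) r : ℕ) =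
        1 + p (σ 0) * (n + ∑ i : Fin (K + 1) with i < σ 0, (p i : ZMod 2)) + colExp p G +
          (r : ℕ) * ((n + ∑ c, (Function.extend q
            (fun i => (⟨p (σ i.succ), θ (σ i.succ)⟩ : HFam 𝕜 Ω A A))
            (fun _ => ⟨0, idFam 𝕜 Ω A⟩) c).1 : ℕ) : ZMod 2) := by
      rw [hdeg, colExp_eq_sum p q q.strictMono (fun i => σ i.succ) G (hext σ q) (hext' σ q),
        ← koszulExp_add_sum (fun i => σ i.succ) (fun a b h => Fin.succ_injective _ (σ.injective h)),
        koszulExp_succ, xiInner]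
      push_cast
      simp only [add_mul, Finset.sum_add_distrib]
      ring
    rw [hexp]
    rfl

theorem rho_cons (lam : 𝕜) {n K : ℕ} (f : Fam 𝕜 Ω A A n) (p : Fin (K + 1) → ℕ)
    (θ : ∀ i, Fam 𝕜 Ω A A (p i)) :
    rho lam (K + 2) (Fin.cons (inM f) fun i => inH (θ i)) = (0, lam ^ (n - K) • projTot (foldS gerst
      (DirectSum.lof 𝕜 ℕ (Fam 𝕜 Ω (A × A) (A × A)) n (tildeFam n f))
      (fun i => inclTot (HFam.tot ⟨p i, θ i⟩)) Finset.univ)) := by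
  have h1 : (fun i => diagEmb ((Fin.cons (inM f) fun i => inH (θ i) :
      Fin (K + 2) → AbsSpace 𝕜 Ω A) i)) = Fin.cons (relL (tildeFam n f) (tildeFam_mem n f))
        fun i : Fin (K + 1) => relH ⟨p i, θ i⟩ := by
    funext i
    refine Fin.cases ?_ (fun i => Prod.ext (Subtype.ext (map_zero tildeTot)) rfl) i
    exact Prod.ext (Subtype.ext (tildeTot_lof f)) rfl
  have h2 := modBracket_cons_relL lam (fun i : Fin (K + 1) => relH ⟨p i, θ i⟩)
    (fun i => (⟨p i, θ i⟩ : HFam 𝕜 Ω A A)) id strictMono_id Finset.univ Finset.image_id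
    (tildeFam_mem n f) fun _ _ => rfl
  change diagRetr (modBracket lam (K + 2) _) = _
  rw [h1]
  refine (congrArg diagRetr h2).trans (Prod.ext (map_zero (DirectSum.lmap topFam)) ?_)
  dsimp only
  -- There are `K + 1` elements of `𝔥` and `f` has arity `n + 1`, so the truncated exponents `n + 1
  -- - (K + 1)` and `n - K` agree.
  rw [← Nat.add_sub_add_right n 1 K]
  rfl

theorem rho_cons_of_lt (lam : 𝕜) {n K : ℕ} (hK : K < n) (f : Fam 𝕜 Ω A A n) (p : Fin (K + 1) → ℕ)
    (θ : ∀ i, Fam 𝕜 Ω A A (p i)) :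
    rho lam (K + 2) (Fin.cons (inM f) fun i => inH (θ i)) = (0, innerTerm lam f p θ) := by
  classical
  rw [rho_cons, projTot_foldS_gerst_tildeFam, innerTerm_eq_sum, if_neg, if_pos, zero_add]
  · rfl
  · rw [Finset.card_univ, Fintype.card_fin]
    omega
  · rw [Finset.card_univ, Fintype.card_fin]
    omega

theorem rho_cons_self (lam : 𝕜) {n : ℕ} (f : Fam 𝕜 Ω A A n) (p : Fin (n + 1) → ℕ)
    (θ : ∀ i, Fam 𝕜 Ω A A (p i)) :
    rho lam (n + 2) (Fin.cons (inM f) fun i => inH (θ i)) =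
      (0, fullTerm f p θ + innerTerm lam f p θ) := by
  classical
  rw [rho_cons, projTot_foldS_gerst_tildeFam, innerTerm_eq_sum, fullTerm_eq_sum, if_pos, if_pos,
    Nat.sub_self, pow_zero, one_smul, one_smul]
  · rfl
  · rw [Finset.card_univ, Fintype.card_fin]
  · rw [Finset.card_univ, Fintype.card_fin]

theorem rho_cons_of_gt (lam : 𝕜) {n K : ℕ} (hK : n < K) (f : Fam 𝕜 Ω A A n) (p : Fin (K + 1) → ℕ)
    (θ : ∀ i, Fam 𝕜 Ω A A (p i)) :
    rho lam (K + 2) (Fin.cons (inM f) fun i => inH (θ i)) = 0 := by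
  rw [rho_cons, projTot_foldS_gerst_eq_zero (tildeFam_mem n f), smul_zero]
  · rfl
  · rw [Finset.card_univ, Fintype.card_fin]
    omega

theorem rho_two (lam : 𝕜) {n m : ℕ} (f : Fam 𝕜 Ω A A n) (g : Fam 𝕜 Ω A A m) :
    rho lam 2 ![inM f, inM g] = ((-1 : 𝕜) ^ n • gerstHom n m f g, 0) := by
  refine diagEmb_injective ?_
  rw [diagEmb_rho, modBracket_two_apply, derivedPart_eq_zero_of_snd lam 1 _ (i := 0) (j := 1)
    zero_ne_one rfl rfl, add_zero, liePart_diagEmb]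
  congr 2
  change gerst (parity (DirectSum.lof 𝕜 ℕ (Fam 𝕜 Ω A A) n f))
    (DirectSum.lof 𝕜 ℕ (Fam 𝕜 Ω A A) m g) = _
  rw [parity, DirectSum.lmap_lof, LinearMap.smul_apply, LinearMap.id_apply, map_smul, map_smul,
    LinearMap.smul_apply, gerst_lof]

theorem rho_eq_zero_of_fst (lam : 𝕜) (k : ℕ) (θ : Fin k → TotFam 𝕜 Ω A A) :
    rho lam k (fun i => (0, θ i)) = 0 := by
  refine diagEmb_injective ?_
  rw [diagEmb_rho, map_zero]
  exact modBracket_eq_zero_of_fst lam k _ fun i => Subtype.ext (map_zero tildeTot)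

theorem rho_eq_zero_of_snd (lam : 𝕜) {k : ℕ} (hk : 3 ≤ k) {f g : TotFam 𝕜 Ω A A} {i j : Fin k}
    {x : Fin k → AbsSpace 𝕜 Ω A} (hij : i ≠ j) (hi : x i = (f, 0)) (hj : x j = (g, 0)) :
    rho lam k x = 0 := by
  refine diagEmb_injective ?_
  rw [diagEmb_rho, map_zero]
  exact modBracket_eq_zero_of_snd lam k hk _ hij (congrArg Prod.snd hi) (congrArg Prod.snd hj)

end Explicit

end OmegaFamily

end

open LInftyOne OmegaFamily

theorem mainTheorem4 {𝕜 Ω A : Type*} [Field 𝕜] [CharZero 𝕜] [Semigroup Ω]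
    [AddCommGroup A] [Module 𝕜 A] (lam : 𝕜) :
    -- the diagonal map is an embedding of graded vector spaces
    ((∀ x : AbsSpace 𝕜 Ω A, diagRetr (diagEmb x) = x) ∧
      ∀ (d : ℤ) (x : AbsSpace 𝕜 Ω A),
        x ∈ absGrading 𝕜 Ω A d → diagEmb x ∈ relGrading 𝕜 Ω A A d) ∧
    -- its image is a subalgebra of the modified algebra, from which the brackets are transferred
    IsLInftyOneSubalgebra (relGrading 𝕜 Ω A A) (modBracket lam)
      (LinearMap.range (diagEmb : AbsSpace 𝕜 Ω A →ₗ[𝕜] RelSpace 𝕜 Ω A A)) ∧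
    (∀ (k : ℕ) (x : Fin k → AbsSpace 𝕜 Ω A),
      diagEmb (rho lam k x) = modBracket lam k fun i => diagEmb (x i)) ∧
    -- the transferred brackets form an algebra
    IsLInftyOneAlgebra (absGrading 𝕜 Ω A) (rho lam) ∧
    -- the explicit formulas
    (∀ x : Fin 1 → AbsSpace 𝕜 Ω A, rho lam 1 x = 0) ∧
    (∀ (n m : ℕ) (f : Fam 𝕜 Ω A A n) (g : Fam 𝕜 Ω A A m),
      rho lam 2 ![inM f, inM g] = ((-1 : 𝕜) ^ n • gerstHom n m f g, 0)) ∧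
    (∀ (n : ℕ) (f : Fam 𝕜 Ω A A n) (p : Fin (n + 1) → ℕ) (θ : ∀ i, Fam 𝕜 Ω A A (p i)),
      rho lam (n + 2) (Fin.cons (inM f) fun i => inH (θ i)) =
        (0, fullTerm f p θ + innerTerm lam f p θ)) ∧
    (∀ (n K : ℕ), K < n → ∀ (f : Fam 𝕜 Ω A A n) (p : Fin (K + 1) → ℕ)
      (θ : ∀ i, Fam 𝕜 Ω A A (p i)),
      rho lam (K + 2) (Fin.cons (inM f) fun i => inH (θ i)) = (0, innerTerm lam f p θ)) ∧
    -- all other brackets that do not arise from these by permutations of the arguments vanish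
    (∀ (n K : ℕ), n < K → ∀ (f : Fam 𝕜 Ω A A n) (p : Fin (K + 1) → ℕ)
      (θ : ∀ i, Fam 𝕜 Ω A A (p i)),
      rho lam (K + 2) (Fin.cons (inM f) fun i => inH (θ i)) = 0) ∧
    (∀ (k : ℕ) (θ : Fin k → TotFam 𝕜 Ω A A), rho lam k (fun i => (0, θ i)) = 0) ∧
    (∀ (k : ℕ), 3 ≤ k → ∀ (f g : TotFam 𝕜 Ω A A) (i j : Fin k) (x : Fin k → AbsSpace 𝕜 Ω A),
      i ≠ j → x i = (f, 0) → x j = (g, 0) → rho lam k x = 0) :=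
  ⟨⟨diagRetr_diagEmb, fun _ _ => diagEmb_mem⟩, isLInftyOneSubalgebra_range_diagEmb lam,
    diagEmb_rho lam, isLInftyOneAlgebra_rho lam, fun _ => map_zero diagRetr,
    fun _ _ f g => rho_two lam f g, fun _ f p θ => rho_cons_self lam f p θ,
    fun _ _ hK f p θ => rho_cons_of_lt lam hK f p θ,
    fun _ _ hK f p θ => rho_cons_of_gt lam hK f p θ, rho_eq_zero_of_fst lam,
    fun _ hk _ _ _ _ _ => rho_eq_zero_of_snd lam hk⟩
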